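/- **The calculus $\lambda\beta\mathsf R'$.** Finite types are $0$ and $(\sigma\tau)$; association is to the right; $\mathrm{lv}(0)=0$, $\mathrm{lv}(\sigma\tau)=\max\{\mathrm{lv}(\sigma)+1,\mathrm{lv}(\tau)\}$. The terms of $\mathcal T'$ are the simply typed $\lambda$-terms (taken up to renaming of bound variables) built from typed variables and the constants $\mathsf 0:0$, $\mathsf S:00$, $\mathsf D_\tau:0\tau\tau\tau$, $\mathsf R_\tau:0(0\tau\tau)\tau\tau$ by application, abstraction, and the formation of $\mathsf R_\tau^t:(0\tau\tau)\tau\tau$ for $t$ of type $0$. One-step reduction $\rhd$ is generated by $\mathsf D\mathsf 0AB\rhd A$, $\mathsf D(\mathsf St)AB\rhd B$, $(R)$ $\mathsf Rt\rhd\mathsf R^t$, $(R^0)$ $\mathsf R^{\mathsf 0}AB\rhd B$, $(R^{\mathsf S})$ $\mathsf R^{\mathsf St}AB\rhd At(\mathsf R^tAB)$, $(\beta)$ $(\lambda X.G)H\rhd G\{X:=H\}$ (capture-avoiding), and closed under the rules $(App_r)$ $A\rhd B\Rightarrow AC\rhd BC$, $(App_l)$ $B\rhd C\Rightarrow AB\rhd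 AC$, $(App_R)$ $s\rhd t\Rightarrow\mathsf R^s\rhd\mathsf R^t$, $(\xi)$ $F\rhd G\Rightarrow\lambda X.F\rhd\lambda X.G$. **Ordinals.** For $\alpha=\omega^{\alpha_1}+\dots+\omega^{\alpha_n}<\varepsilon_0$ in Cantor normal form let $\mathrm{no}(\alpha)=n+\mathrm{no}(\alpha_1)+\dots+\mathrm{no}(\alpha_n)$. Let $F_0(x)=2^x$, $F_{n+1}(x)=F_n^{x+1}(x)$ (the $(x+1)$-fold iterate of $F_n$, applied to $x$), $\Phi(x)=F_5(x+100)$, and $\psi(\alpha)=\max(\{0\}\cup\{\psi(\beta)+1:\beta<\alpha,\ \mathrm{no}(\beta)\le\Phi(\mathrm{no}(\alpha))\})\in\mathbb N$ for $\alpha<\varepsilon_0$. **Ordinal terms and vectors.** To each variable $X^\sigma$ belong distinct ordinal variables $x_0,\dots,x_{\mathrm{lv}(\sigma)}$, forming the variable vector $\vec x$ of level $\mathrm{lv}(\vec x)=\mathrm{lv}(\sigma)$. Ordinal terms are built from ordinal variables and $0,1,\omega$ by $f+g$, $2^f\cdot g$, $\psi(\omega\cdot f+g)$; $n\cdot h$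 denotes the $n$-fold sum of $h$, and $n$ stands for $n\cdot 1$. Closed terms denote ordinals below $\varepsilon_0$, with $+,\cdot$ read as natural sum and product. A vector of level $n$ is a tuple $\vec h=\langle h_0,\dots,h_n\rangle$ of ordinal terms, $h_i:=0$ for $i>n$; $\vec f+\vec g$ is the componentwise sum, of level $\max\{\mathrm{lv}(\vec f),\mathrm{lv}(\vec g)\}$; here, and in sums $h+n$ with $n=0$, absent or zero summands are omitted. $\vec h\!\restriction_l=\langle h_0,\dots,h_l\rangle$, and $\vec 1$ is a vector with all components $1$. A term is $x$-free if no $x_i$ occurs in it. A closed vector $\vec f$ is of bounded norm if $\mathrm{no}(f_i)\le\mathrm{no}(f_0)$ for all $i$. The sets $\mathcal B_i$ of closed terms are the least sets such that $1\in\mathcal B_i$; $\omega\in\mathcal B_i$ for $i\ge1$; $\mathcal B_i$ is closed under $+$; $2^f\cdot g\in\mathcal B_i$ if $i\ge1$, $f\in\mathcal B_{i+1}$, $g\in\mathcal B_i$; $\psi(\omega\cdot f+g)\in\mathcal B_0$ if $f\in\mathcal B_1$, $g\in\mathcal B_0$, $\mathrm{no}(f)\le F_2(g)$; and $\mathcal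 B_0\subseteq\mathcal B_i$. For ordinal terms, $f\prec g$ (resp. $f\preceq g$) means $\chi(f)<\chi(g)$ (resp. $\le$) for every substitution $\chi$ that replaces each variable vector $\vec x$ by a closed vector $\vec b$ of level $\mathrm{lv}(\vec x)$ and of bounded norm with $b_i\in\mathcal B_i$ for all $i\le\mathrm{lv}(\vec x)$; comparisons of expressions with $\mathrm{no}$ and $F_2$ are read likewise. For vectors, $\vec f\prec\vec g$ (also written $\vec g\succ\vec f$) means $f_0\prec g_0$ and $f_i\preceq g_i$ for all $i>0$. For a variable vector $\vec x$ the sets $\mathcal C^{\vec x}_i$ are the least sets such that $1\in\mathcal C^{\vec x}_i$; $\omega\in\mathcal C^{\vec x}_i$ for $i\ge1$; $y_i\in\mathcal C^{\vec x}_i$ for every variable $Y$ and $i\le\mathrm{lv}(\vec y)$; $\mathcal C^{\vec x}_i$ is closed under $+$; $2^f\cdot g\in\mathcal C^{\vec x}_i$ if $i\ge1$, $f\in\mathcal C^{\vec x}_{i+1}$, $g\in\mathcal C^{\vec x}_i$; $\psi(\omega\cdot f+g)\in\mathcal C^{\vec x}_0$ if $f\in\mathcal C^{\vec x}_1$, $g\in\mathcal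 C^{\vec x}_0$, $\mathrm{no}(f)\preceq F_2(g)$; and every $x$-free $h\in\mathcal C^{\vec x}_0$ is in $\mathcal C^{\vec x}_i$. $\mathcal C^{\vec x}$ is the class of vectors $\vec h$ with $h_i\in\mathcal C^{\vec x}_i$ for all $i\le\mathrm{lv}(\vec h)$. *The operator $\Box$.* If $m=\mathrm{lv}(\vec f)>\mathrm{lv}(\vec g)=n$, then $\vec f\,\Box\,\vec g$ has level $m$ and components $\psi(\omega\cdot(\vec f\,\Box\,\vec g)_1+f_0+g_0+n)$ for $i=0$; $2^{(\vec f\,\Box\,\vec g)_{i+1}}\cdot(f_i+g_i)$ for $1\le i\le n$; $f_i$ for $n<i\le m$. *The operators $\delta^{\vec x}$.* Let $n=\mathrm{lv}(\vec x)+1$. For $h\in\mathcal C^{\vec x}_i$ the vector $\delta^{\vec x}_ih$ of level $n$ is defined as follows. If $h$ is $x$-free, its $i$-th component (if $i\le n$) is $h+1$ and all others are $1$. Otherwise $\delta^{\vec x}_ix_i=\vec1$; $\delta^{\vec x}_i(f+g)=\delta^{\vec x}_if+\delta^{\vec x}_ig+\vec1$; $\delta^{\vec x}_i(2^f\cdot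 g)=2\,\delta^{\vec x}_{i+1}f+\delta^{\vec x}_ig+\vec1$; and $\delta^{\vec x}_0\psi(\omega\cdot f+g)$ has $0$-th component $\psi(\omega\cdot f\{\vec x:=\vec1\}+(\delta^{\vec x}_0g)_0)$ and $j$-th component $(\delta^{\vec x}_1f)_j+(\delta^{\vec x}_0g)_j$ for $1\le j\le n$. Let $\mathrm{sz}^{\vec x}(h)=1$ if $h$ is $x$-free or some $x_i$; otherwise $\mathrm{sz}^{\vec x}(f+g)=\mathrm{sz}^{\vec x}(\psi(\omega\cdot f+g))=\mathrm{sz}^{\vec x}(f)+\mathrm{sz}^{\vec x}(g)+1$ and $\mathrm{sz}^{\vec x}(2^f\cdot g)=2\,\mathrm{sz}^{\vec x}(f)+\mathrm{sz}^{\vec x}(g)+1$. For $\vec h\in\mathcal C^{\vec x}$ of level $m$, $\delta^{\vec x}\vec h$ is the vector of level $\max\{n,m\}$ with components $\big(2^n\sum_{i\le m}\mathrm{sz}^{\vec x}(h_i)\big)\cdot(\delta^{\vec x}_0h_0)_0$ for $j=0$; $\sum_{i\le m}(\delta^{\vec x}_ih_i)_j$ for $0<j\le n$; $h_j$ for $j>n$.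 **Assignment derivations** for $A$ of type $\sigma$ are the trees given by the following clauses; each assigns to $A$ a vector $[\![A]\!]$ of level $\mathrm{lv}(\sigma)$. - Single nodes for variables and constants: $[\![X]\!]=\vec x$, $[\![\mathsf 0]\!]=\langle1\rangle$, $[\![\mathsf S]\!]=\langle1,1\rangle$, $[\![\mathsf D_\tau]\!]=\langle1,\dots,1\rangle$ of level $\mathrm{lv}(\tau)+1$, $[\![\mathsf R_\tau]\!]=\langle2,1,\dots,1,\omega\rangle$ of level $\mathrm{lv}(\tau)+2$. - From derivations for $B$ and $C$, one for $BC$ (of type $\tau$), with $[\![BC]\!]=([\![B]\!]\,\Box\,[\![C]\!])\!\restriction_{\mathrm{lv}(\tau)}$. - From a derivation for $t$, one for $\mathsf R^t_\tau$, with $[\![\mathsf R_\tau^t]\!]=\langle[\![t]\!]_0,1,\dots,1,[\![t]\!]_0\rangle$ of level $\mathrm{lv}(\tau)+2$. - From derivations for $G_0,\dots,G_m$ ($m\ge0$) with $G_0\rhd\dots\rhd G_m=G$ and $[\![G_0]\!]\succ\dots\succ[\![G_m]\!]$, where $X$ does not occur in any subterm of $G_0$ of the form $\mathsf R^t$ and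 $[\![G_0]\!]\in\mathcal C^{\vec x}$ (so that $\delta^{\vec x}[\![G_0]\!]$ is defined), a derivation for $\lambda X.G$, with $[\![\lambda X.G]\!]=\delta^{\vec x}[\![G_0]\!]+[\![G_m]\!]\{\vec x:=\vec1\}$. (Free variables in a derivation for $F$ are never captured when $F$ is substituted: bound variables are renamed as necessary.) **The algorithm.** Given $A\rhd B$ (with its working redex) and an assignment derivation for $A$, it builds a tree for $B$ by recursion on $A$: - for the $\mathsf D$-redexes, $(R)$, $(R^0)$ and $(R^{\mathsf S})$, the tree for the reduct is built up by the clauses above from the given derivations for $t,A,B$ occurring in the redex; - for $(\lambda X.G)H\rhd G\{X:=H\}$, with derivations for $G_0,\dots,G_m=G$ given at $\lambda X.G$, take the tree for $G_m\{X:=H\}$ obtained by substituting the derivation for $H$ for $X$ in the derivation for $G_m$, at each abstraction inside in all members of the associated sequence; - for $(App_r)$, $(App_l)$, $(App_R)$, replace the tree for the reduced direct subterm by the one the algorithm returns; - for $\lambda X.F\rhd\lambda X.G$ from $F\rhd G$, with derivations for $F_0,\dots,F_m=F$ given at $\lambda X.F$, append to this sequence the tree for $G$ which the algorithm returns from the derivation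 for $F_m$; thus $[\![\lambda X.G]\!]=\delta^{\vec x}[\![F_0]\!]+[\![G]\!]\{\vec x:=\vec1\}$. **Theorem.** Let $A,B\in\mathcal T'$ with $A\rhd B$, and let an assignment derivation for $A$, assigning $[\![A]\!]$ to $A$, be given. Then the tree for $B$ provided by the algorithm is an assignment derivation for $B$, and the vector $[\![B]\!]$ it assigns to $B$ satisfies $[\![A]\!]\succ[\![B]\!]$. -/

import Mathlib

/-! # Types, terms and one-step reduction of the calculus `λβR'`

Terms are taken up to renaming of bound variables: bound variables are represented by
de Bruijn indices, so that `α`-equivalent terms are equal, substitution never captures a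
variable, and `▷_α` coincides with `▷`. Variables are typed by a context (the list of the types
of the variables that may occur free). -/

namespace GodelT

/-- Finite types: `0` (here `nat`) and `(στ)` (here `arr σ τ`, functions from `σ` to `τ`). -/
inductive Ty : Type
  | nat : Ty
  | arr (σ τ : Ty) : Ty

/-- The level of a finite type. -/
def Ty.lv : Ty → ℕ
  | .nat => 0
  | .arr σ τ => max (σ.lv + 1) τ.lv

/-- Contexts: the types of the variables in scope. -/
abbrev Ctx := List Ty

/-- Typed variables in scope in a context. -/
inductive Var : Ctx → Ty → Type
  | zero {Γ : Ctx} {σ : Ty} : Var (σ :: Γ) σ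
  | succ {Γ : Ctx} {σ ρ : Ty} : Var Γ σ → Var (ρ :: Γ) σ

/-- The position of a variable in its context; two variables of a context are the same iff they
have the same position. -/
def Var.idx : {Γ : Ctx} → {σ : Ty} → Var Γ σ → ℕ
  | _, _, .zero => 0
  | _, _, .succ x => x.idx + 1

/-- The terms of `T'`: variables, the constants `0`, `S`, `D_τ`, `R_τ`, application,
abstraction, and the terms `R_τ^t` for `t` of type `0`. -/
inductive Tm : Ctx → Ty → Type
  | var {Γ : Ctx} {σ : Ty} (x : Var Γ σ) : Tm Γ σ
  | zero {Γ : Ctx} : Tm Γ .nat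
  | succ {Γ : Ctx} : Tm Γ (.arr .nat .nat)
  | D {Γ : Ctx} (τ : Ty) : Tm Γ (.arr .nat (.arr τ (.arr τ τ)))
  | R {Γ : Ctx} (τ : Ty) : Tm Γ (.arr .nat (.arr (.arr .nat (.arr τ τ)) (.arr τ τ)))
  | app {Γ : Ctx} {σ τ : Ty} (B : Tm Γ (.arr σ τ)) (C : Tm Γ σ) : Tm Γ τ
  | lam {Γ : Ctx} {σ τ : Ty} (G : Tm (σ :: Γ) τ) : Tm Γ (.arr σ τ)
  | Rsup {Γ : Ctx} (τ : Ty) (t : Tm Γ .nat) : Tm Γ (.arr (.arr .nat (.arr τ τ)) (.arr τ τ))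

/-- Renamings of variables. -/
abbrev Ren (Γ Δ : Ctx) := ∀ σ : Ty, Var Γ σ → Var Δ σ

/-- Extension of a renaming under a binder. -/
def Ren.lift {Γ Δ : Ctx} (r : Ren Γ Δ) (ρ : Ty) : Ren (ρ :: Γ) (ρ :: Δ)
  | _, .zero => .zero
  | _, .succ x => .succ (r _ x)

/-- The renaming that brings a term under an additional binder. -/
def Ren.shift (Γ : Ctx) (ρ : Ty) : Ren Γ (ρ :: Γ) := fun _ x => .succ x

def Tm.rename : {Γ Δ : Ctx} → {σ : Ty} → Ren Γ Δ → Tm Γ σ → Tm Δ σ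
  | _, _, _, r, .var x => .var (r _ x)
  | _, _, _, _, .zero => .zero
  | _, _, _, _, .succ => .succ
  | _, _, _, _, .D τ => .D τ
  | _, _, _, _, .R τ => .R τ
  | _, _, _, r, .app B C => .app (B.rename r) (C.rename r)
  | _, _, _, r, .lam G => .lam (G.rename (r.lift _))
  | _, _, _, r, .Rsup τ t => .Rsup τ (t.rename r)

/-- Simultaneous substitutions of terms for variables. -/
abbrev Sub (Γ Δ : Ctx) := ∀ σ : Ty, Var Γ σ → Tm Δ σ

/-- Extension of a substitution under a binder. -/
def Sub.lift {Γ Δ : Ctx} (s : Sub Γ Δ) (ρ : Ty) : Sub (ρ :: Γ) (ρ :: Δ)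
  | _, .zero => .var .zero
  | _, .succ x => (s _ x).rename (Ren.shift Δ ρ)

def Tm.subst : {Γ Δ : Ctx} → {σ : Ty} → Sub Γ Δ → Tm Γ σ → Tm Δ σ
  | _, _, _, s, .var x => s _ x
  | _, _, _, _, .zero => .zero
  | _, _, _, _, .succ => .succ
  | _, _, _, _, .D τ => .D τ
  | _, _, _, _, .R τ => .R τ
  | _, _, _, s, .app B C => .app (B.subst s) (C.subst s)
  | _, _, _, s, .lam G => .lam (G.subst (s.lift _))
  | _, _, _, s, .Rsup τ t => .Rsup τ (t.subst s)

/-- The substitution `{X := H}` for the variable `X` bound by the outermost binder. -/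
def Sub.single {Γ : Ctx} {ρ : Ty} (H : Tm Γ ρ) : Sub (ρ :: Γ) Γ
  | _, .zero => H
  | _, .succ x => .var x

/-- The term `G{X := H}`, where `X` is the variable bound in `λX.G`. -/
def Tm.inst {Γ : Ctx} {ρ σ : Ty} (G : Tm (ρ :: Γ) σ) (H : Tm Γ ρ) : Tm Γ σ :=
  G.subst (Sub.single H)

/-- The (free) variable at position `k` occurs in the term. -/
def Tm.Occurs : {Γ : Ctx} → {σ : Ty} → ℕ → Tm Γ σ → Prop
  | _, _, k, .var x => x.idx = k
  | _, _, k, .app B C => B.Occurs k ∨ C.Occurs k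
  | _, _, k, .lam G => G.Occurs (k + 1)
  | _, _, k, .Rsup _ t => t.Occurs k
  | _, _, _, .zero => False
  | _, _, _, .succ => False
  | _, _, _, .D _ => False
  | _, _, _, .R _ => False

/-- The (free) variable at position `k` occurs in some subterm of the form `R^t`. -/
def Tm.OccursInRsup : {Γ : Ctx} → {σ : Ty} → ℕ → Tm Γ σ → Prop
  | _, _, k, .app B C => B.OccursInRsup k ∨ C.OccursInRsup k
  | _, _, k, .lam G => G.OccursInRsup (k + 1)
  | _, _, k, .Rsup _ t => t.Occurs k
  | _, _, _, .var _ => False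
  | _, _, _, .zero => False
  | _, _, _, .succ => False
  | _, _, _, .D _ => False
  | _, _, _, .R _ => False

/-- `Step A B` is the type of derivations of the one-step reduction `A ▷ B` of `λβR'`. Such a
derivation amounts to the choice of the working redex in `A`. -/
inductive Step : {Γ : Ctx} → {σ : Ty} → Tm Γ σ → Tm Γ σ → Type
  | D0 {Γ : Ctx} {τ : Ty} (A B : Tm Γ τ) :
      Step (.app (.app (.app (.D τ) .zero) A) B) A
  | DS {Γ : Ctx} {τ : Ty} (t : Tm Γ .nat) (A B : Tm Γ τ) :
      Step (.app (.app (.app (.D τ) (.app .succ t)) A) B) B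
  | R {Γ : Ctx} {τ : Ty} (t : Tm Γ .nat) :
      Step (.app (.R τ) t) (.Rsup τ t)
  | R0 {Γ : Ctx} {τ : Ty} (A : Tm Γ (.arr .nat (.arr τ τ))) (B : Tm Γ τ) :
      Step (.app (.app (.Rsup τ .zero) A) B) B
  | RS {Γ : Ctx} {τ : Ty} (t : Tm Γ .nat) (A : Tm Γ (.arr .nat (.arr τ τ))) (B : Tm Γ τ) :
      Step (.app (.app (.Rsup τ (.app .succ t)) A) B)
        (.app (.app A t) (.app (.app (.Rsup τ t) A) B))
  | beta {Γ : Ctx} {σ τ : Ty} (G : Tm (σ :: Γ) τ) (H : Tm Γ σ) :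
      Step (.app (.lam G) H) (G.inst H)
  | appr {Γ : Ctx} {σ τ : Ty} {A B : Tm Γ (.arr σ τ)} (C : Tm Γ σ) :
      Step A B → Step (.app A C) (.app B C)
  | appl {Γ : Ctx} {σ τ : Ty} (A : Tm Γ (.arr σ τ)) {B C : Tm Γ σ} :
      Step B C → Step (.app A B) (.app A C)
  | appR {Γ : Ctx} (τ : Ty) {s t : Tm Γ .nat} :
      Step s t → Step (.Rsup τ s) (.Rsup τ t)
  | xi {Γ : Ctx} {σ τ : Ty} {F G : Tm (σ :: Γ) τ} :
      Step F G → Step (.lam F) (.lam G)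

/-- The one-step reduction relation `A ▷ B`. -/
def Reduces {Γ : Ctx} {σ : Ty} (A B : Tm Γ σ) : Prop := Nonempty (Step A B)

/-! # Ordinals: natural sum and product, norm, collapsing function -/

open Ordinal in
/-- The multiset of the exponents `γ₀ ≥ … ≥ γₘ` (with repetitions) in the Cantor normal form
`α = ω ^ γ₀ + … + ω ^ γₘ`. -/
noncomputable def exps (α : Ordinal.{0}) : Multiset Ordinal.{0} :=
  ((CNF ω α).flatMap fun p => List.replicate (Cardinal.toNat p.2.card) p.1 : List Ordinal.{0})

open Ordinal in
/-- The ordinal `ω ^ γ₀ + … + ω ^ γₘ`, where the `γᵢ` are the given exponents, arranged in weakly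
decreasing order. -/
noncomputable def ofExps (s : Multiset Ordinal.{0}) : Ordinal.{0} :=
  ((s.sort (· ≥ ·)).map fun γ => ω ^ γ).sum

/-- The natural (Hessenberg) sum of ordinals. -/
noncomputable def natSum (α β : Ordinal.{0}) : Ordinal.{0} := ofExps (exps α + exps β)

/-- The natural (Hessenberg) product of ordinals. -/
noncomputable def natProd (α β : Ordinal.{0}) : Ordinal.{0} :=
  ofExps ((exps α).bind fun γ => (exps β).map fun δ => natSum γ δ)

/-- The norm: `no α = n + no α₁ + … + no αₙ` for `α = ω ^ α₁ + … + ω ^ αₙ` in Cantor normal form.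
It is only used below `ε₀`, where `αᵢ < α` always holds. -/
noncomputable def no (α : Ordinal.{0}) : ℕ :=
  (exps α).card + ((exps α).map fun γ => if _h : γ < α then no γ else 0).sum
termination_by α

/-- The hierarchy `F₀ x = 2 ^ x`, `Fₙ₊₁ x = Fₙ^(x+1) x`. -/
def F : ℕ → ℕ → ℕ
  | 0, x => 2 ^ x
  | n + 1, x => (F n)^[x + 1] x

/-- The number-theoretic function controlling the collapsing function. -/
def Phi (x : ℕ) : ℕ := F 5 (x + 100)

/-- The collapsing function
`ψ α = max ({0} ∪ {ψ β + 1 | β < α, no β ≤ Φ (no α)})`. It is only used below `ε₀`, where the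
set is finite, so that the supremum is a maximum. -/
noncomputable def psi (α : Ordinal.{0}) : ℕ :=
  sSup ({0} ∪ {n | ∃ β, ∃ _h : β < α, no β ≤ Phi (no α) ∧ n = psi β + 1})
termination_by α

/-! # Ordinal terms and ordinal vectors -/

/-- Ordinal terms over the ordinal variables `x₀, …, x_{lv σ}` that belong to the typed variables
`X` of type `σ` in the context. -/
inductive OT (Γ : Ctx) : Type
  /-- the ordinal variable `xᵢ` -/
  | var {σ : Ty} (x : Var Γ σ) (i : Fin (σ.lv + 1)) : OT Γ
  | zero : OT Γ
  | one : OT Γ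
  | omega : OT Γ
  /-- `f + g` -/
  | add (f g : OT Γ) : OT Γ
  /-- `2 ^ f · g` -/
  | expMul (f g : OT Γ) : OT Γ
  /-- `ψ(ω · f + g)` -/
  | psi (f g : OT Γ) : OT Γ

/-- Substitutions of ordinal terms for ordinal variables. -/
abbrev OSub (Γ Δ : Ctx) := ∀ σ : Ty, Var Γ σ → Fin (σ.lv + 1) → OT Δ

def OT.subst {Γ Δ : Ctx} (s : OSub Γ Δ) : OT Γ → OT Δ
  | .var x i => s _ x i
  | .zero => .zero
  | .one => .one
  | .omega => .omega
  | .add f g => .add (f.subst s) (g.subst s)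
  | .expMul f g => .expMul (f.subst s) (g.subst s)
  | .psi f g => .psi (f.subst s) (g.subst s)

/-- The interpretation of closed ordinal terms, with natural sum and natural product. -/
noncomputable def OT.val : OT [] → Ordinal.{0}
  | .var x _ => nomatch x
  | .zero => 0
  | .one => 1
  | .omega => Ordinal.omega0
  | .add f g => natSum f.val g.val
  | .expMul f g => natProd (2 ^ f.val) g.val
  | .psi f g => (GodelT.psi (natSum (natProd Ordinal.omega0 f.val) g.val) : Ordinal.{0})

/-- Some component `xᵢ` of the variable vector of `X` occurs in the ordinal term; the term is
`x`-free if this is `false`. -/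
def OT.hasVar {Γ : Ctx} {σ : Ty} (x : Var Γ σ) : OT Γ → Bool
  | .var y _ => y.idx == x.idx
  | .zero => false
  | .one => false
  | .omega => false
  | .add f g => f.hasVar x || g.hasVar x
  | .expMul f g => f.hasVar x || g.hasVar x
  | .psi f g => f.hasVar x || g.hasVar x

/-- The term `h{x := 1}`, as a term over the same context. -/
def OT.setOne {Γ : Ctx} {σ : Ty} (x : Var Γ σ) (h : OT Γ) : OT Γ :=
  h.subst fun _ y i => if y.idx = x.idx then .one else .var y i

/-- The `n`-fold sum `h + … + h`. -/
def OT.nsmul {Γ : Ctx} : ℕ → OT Γ → OT Γ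
  | 0, _ => .zero
  | 1, h => h
  | n + 2, h => .add (OT.nsmul (n + 1) h) h

/-- The term `h + n` for a natural number `n`; it is `h` itself if `n = 0`, so that no occurrence
of `0` is introduced. -/
def OT.addNat {Γ : Ctx} (h : OT Γ) : ℕ → OT Γ
  | 0 => h
  | n + 1 => .add h (OT.nsmul (n + 1) .one)

/-- The sum `c 0 + … + c m`. -/
def OT.sumUpTo {Γ : Ctx} (c : ℕ → OT Γ) : ℕ → OT Γ
  | 0 => c 0
  | m + 1 => .add (OT.sumUpTo c m) (c (m + 1))

/-- Ordinal vectors `⟨h₀, …, hₙ⟩` of level `n = lv`. -/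
structure OVec (Γ : Ctx) where
  lv : ℕ
  coord : Fin (lv + 1) → OT Γ

/-- The component `hᵢ` of a vector, where `hᵢ = 0` beyond the level. -/
def OVec.get {Γ : Ctx} (h : OVec Γ) (i : ℕ) : OT Γ :=
  if hi : i < h.lv + 1 then h.coord ⟨i, hi⟩ else .zero

/-- The variable vector `⟨x₀, …, x_{lv σ}⟩`. -/
def OVec.var {Γ : Ctx} {σ : Ty} (x : Var Γ σ) : OVec Γ := ⟨σ.lv, fun i => .var x i⟩

def OVec.subst {Γ Δ : Ctx} (s : OSub Γ Δ) (h : OVec Γ) : OVec Δ :=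
  ⟨h.lv, fun i => (h.coord i).subst s⟩

/-- The sum of vectors. Components beyond the level of a summand are omitted from the sum, so that
no occurrence of `0` is introduced. -/
def OVec.add {Γ : Ctx} (f g : OVec Γ) : OVec Γ :=
  ⟨max f.lv g.lv, fun i =>
    if g.lv < (i : ℕ) then f.get i
    else if f.lv < (i : ℕ) then g.get i
    else .add (f.get i) (g.get i)⟩

/-- `h↾ₗ = ⟨h₀, …, hₗ⟩`. -/
def OVec.restrict {Γ : Ctx} (h : OVec Γ) (l : ℕ) : OVec Γ := ⟨l, fun i => h.get i⟩

/-! ## Bounded norm, the class `B`, comparison -/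

/-- A closed vector is of bounded norm if `no(fᵢ) ≤ no(f₀)` for every `i`. -/
def OVec.BoundedNorm (f : OVec []) : Prop := ∀ i : ℕ, no (f.get i).val ≤ no (f.get 0).val

/-- The sets `Bᵢ` of closed ordinal terms. -/
inductive InB : ℕ → OT [] → Prop
  | one (i : ℕ) : InB i .one
  | omega (i : ℕ) : 1 ≤ i → InB i .omega
  | add (i : ℕ) (f g : OT []) : InB i f → InB i g → InB i (.add f g)
  | expMul (i : ℕ) (f g : OT []) : 1 ≤ i → InB (i + 1) f → InB i g → InB i (.expMul f g)
  | psi (f g : OT []) (k : ℕ) : InB 1 f → InB 0 g → g.val = (k : Ordinal.{0}) →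
      no f.val ≤ F 2 k → InB 0 (.psi f g)
  | ofZero (i : ℕ) (h : OT []) : 1 ≤ i → InB 0 h → InB i h

/-- The class `B` of closed vectors. -/
def OVec.IsB (h : OVec []) : Prop := ∀ i : ℕ, i ≤ h.lv → InB i (h.get i)

/-- The substitutions over which the comparison of ordinal terms ranges: every variable vector is
replaced by a vector in `B` of the same level and of bounded norm. -/
def Admissible {Γ : Ctx} (χ : OSub Γ []) : Prop :=
  ∀ (σ : Ty) (x : Var Γ σ),
    (OVec.mk σ.lv (χ σ x)).IsB ∧ (OVec.mk σ.lv (χ σ x)).BoundedNorm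

/-- `f ≺ g` for ordinal terms. -/
def OT.Lt {Γ : Ctx} (f g : OT Γ) : Prop :=
  ∀ χ : OSub Γ [], Admissible χ → (f.subst χ).val < (g.subst χ).val

/-- `f ≼ g` for ordinal terms. -/
def OT.Le {Γ : Ctx} (f g : OT Γ) : Prop :=
  ∀ χ : OSub Γ [], Admissible χ → (f.subst χ).val ≤ (g.subst χ).val

/-- `f ≺ g` for vectors: `f₀ ≺ g₀`, and `fᵢ ≼ gᵢ` for all `i > 0`. -/
def OVec.Lt {Γ : Ctx} (f g : OVec Γ) : Prop :=
  (f.get 0).Lt (g.get 0) ∧ ∀ i : ℕ, 0 < i → (f.get i).Le (g.get i)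

/-! ## The classes `Cˣ` -/

/-- `no(f) ≼ F₂(g)` for ordinal terms, which includes `g ≺ ω`. -/
def OT.NormLeF2 {Γ : Ctx} (f g : OT Γ) : Prop :=
  ∀ χ : OSub Γ [], Admissible χ →
    ∃ k : ℕ, (g.subst χ).val = (k : Ordinal.{0}) ∧ no (f.subst χ).val ≤ F 2 k

/-- The sets `Cˣᵢ` of ordinal terms. -/
inductive InC {Γ : Ctx} {σ : Ty} (x : Var Γ σ) : ℕ → OT Γ → Prop
  | one (i : ℕ) : InC x i .one
  | omega (i : ℕ) : 1 ≤ i → InC x i .omega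
  | var {ρ : Ty} (y : Var Γ ρ) (i : Fin (ρ.lv + 1)) : InC x i (.var y i)
  | add (i : ℕ) (f g : OT Γ) : InC x i f → InC x i g → InC x i (.add f g)
  | expMul (i : ℕ) (f g : OT Γ) : 1 ≤ i → InC x (i + 1) f → InC x i g → InC x i (.expMul f g)
  | psi (f g : OT Γ) : InC x 1 f → InC x 0 g → f.NormLeF2 g → InC x 0 (.psi f g)
  | ofZero (i : ℕ) (h : OT Γ) : 1 ≤ i → InC x 0 h → h.hasVar x = false → InC x i h

/-- The class `Cˣ` of vectors. -/
def OVec.IsC {Γ : Ctx} {σ : Ty} (x : Var Γ σ) (h : OVec Γ) : Prop :=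
  ∀ i : ℕ, i ≤ h.lv → InC x i (h.get i)

/-! ## The operator `□` -/

/-- Auxiliary: `boxAux f g k i` is `(f □ g)ᵢ` for `i ≥ 1`, where `k = n + 1 - i` (truncated) is
the number of exponentiations involved, `n = lv g`. -/
def boxAux {Γ : Ctx} (f g : OVec Γ) : ℕ → ℕ → OT Γ
  | 0, i => f.get i
  | k + 1, i => .expMul (boxAux f g k (i + 1)) (.add (f.get i) (g.get i))

/-- The vector `f □ g` (used for `lv f > lv g =: n` only), of the same level as `f`:
`(f □ g)₀ = ψ(ω · (f □ g)₁ + f₀ + g₀ + n)`, `(f □ g)ᵢ = 2 ^ (f □ g)ᵢ₊₁ · (fᵢ + gᵢ)` for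
`1 ≤ i ≤ n`, and `(f □ g)ᵢ = fᵢ` for `i > n`. -/
def OVec.box {Γ : Ctx} (f g : OVec Γ) : OVec Γ :=
  ⟨f.lv, fun i =>
    if (i : ℕ) = 0 then
      .psi (boxAux f g g.lv 1) (OT.addNat (.add (f.get 0) (g.get 0)) g.lv)
    else boxAux f g (g.lv + 1 - i) i⟩

/-! ## The operators `δˣ` -/

/-- `dopAux x i h j` is the component `(δˣᵢ h)ⱼ` of the vector `δˣᵢ h` of level `lv x + 1`, for
`h ∈ Cˣᵢ`. -/
def dopAux {Γ : Ctx} {σ : Ty} (x : Var Γ σ) : ℕ → OT Γ → ℕ → OT Γ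
  | i, .add f g, j =>
      if (OT.add f g).hasVar x then
        .add (.add (dopAux x i f j) (dopAux x i g j)) .one
      else if i = j then .add (.add f g) .one else .one
  | i, .expMul f g, j =>
      if (OT.expMul f g).hasVar x then
        .add (.add (OT.nsmul 2 (dopAux x (i + 1) f j)) (dopAux x i g j)) .one
      else if i = j then .add (.expMul f g) .one else .one
  | i, .psi f g, j =>
      if (OT.psi f g).hasVar x then
        if j = 0 then .psi (f.setOne x) (dopAux x 0 g 0)
        else .add (dopAux x 1 f j) (dopAux x 0 g j)
      else if i = j then .add (.psi f g) .one else .one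
  | i, .var y k, j =>
      if (OT.var y k).hasVar x then .one
      else if i = j then .add (.var y k) .one else .one
  | i, .zero, j => if i = j then .add .zero .one else .one
  | i, .one, j => if i = j then .add .one .one else .one
  | i, .omega, j => if i = j then .add .omega .one else .one

/-- The auxiliary size `szˣ(h)`. -/
def OT.sz {Γ : Ctx} {σ : Ty} (x : Var Γ σ) : OT Γ → ℕ
  | .add f g => if (OT.add f g).hasVar x then f.sz x + g.sz x + 1 else 1
  | .expMul f g => if (OT.expMul f g).hasVar x then 2 * f.sz x + g.sz x + 1 else 1
  | .psi f g => if (OT.psi f g).hasVar x then f.sz x + g.sz x + 1 else 1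
  | .var _ _ => 1
  | .zero => 1
  | .one => 1
  | .omega => 1

/-- The norm controlling factor `Sˣ(h) = 2 ^ n · ∑_{i ≤ m} szˣ(hᵢ)`, `n = lv x + 1`, `m = lv h`. -/
def OVec.S {Γ : Ctx} {σ : Ty} (x : Var Γ σ) (h : OVec Γ) : ℕ :=
  2 ^ (σ.lv + 1) * ∑ i ∈ Finset.range (h.lv + 1), (h.get i).sz x

/-- The operator `δˣ`, which is meant to be applied to vectors in `Cˣ` only. -/
def OVec.dop {Γ : Ctx} {σ : Ty} (x : Var Γ σ) (h : OVec Γ) : OVec Γ :=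
  ⟨max (σ.lv + 1) h.lv, fun j =>
    if (j : ℕ) = 0 then OT.nsmul (h.S x) (dopAux x 0 (h.get 0) 0)
    else if (j : ℕ) ≤ σ.lv + 1 then OT.sumUpTo (fun i => dopAux x i (h.get i) j) h.lv
    else h.get j⟩

/-- The substitution `{x := 1}` for the variable `X` bound by the outermost binder, as a map from
the terms over the context extended by `X` to the terms over the original context. -/
def oneSub (Γ : Ctx) (ρ : Ty) : OSub (ρ :: Γ) Γ
  | _, .zero, _ => .one
  | _, .succ y, i => .var y i

/-! # Assignment derivations

An assignment derivation is a tree with a node for every variable, constant, application,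
`R^t` and abstraction; at an abstraction `λX.G` it has subtrees for a sequence `G₀, …, Gₘ = G` of
terms. `PD A` is the type of such trees for the term `A`, without any condition on these
sequences; `PD.vec` is the vector assigned by the tree, and `PD.IsDerivation` expresses the
conditions on the sequences. -/

mutual
  /-- Trees with the shape of an assignment derivation for the given term. -/
  inductive PD : {Γ : Ctx} → {σ : Ty} → Tm Γ σ → Type
    | var {Γ : Ctx} {σ : Ty} (x : Var Γ σ) : PD (Tm.var x)
    | zero {Γ : Ctx} : PD (Tm.zero (Γ := Γ))
    | succ {Γ : Ctx} : PD (Tm.succ (Γ := Γ))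
    | D {Γ : Ctx} (τ : Ty) : PD (Tm.D (Γ := Γ) τ)
    | R {Γ : Ctx} (τ : Ty) : PD (Tm.R (Γ := Γ) τ)
    | app {Γ : Ctx} {σ τ : Ty} {B : Tm Γ (.arr σ τ)} {C : Tm Γ σ} :
        PD B → PD C → PD (Tm.app B C)
    | Rsup {Γ : Ctx} (τ : Ty) {t : Tm Γ .nat} : PD t → PD (Tm.Rsup τ t)
    | lam {Γ : Ctx} {σ τ : Ty} {G : Tm (σ :: Γ) τ} : PDSeq G → PD (Tm.lam G)
  /-- Nonempty finite sequences of trees for terms `G₀, …, Gₘ`, where `Gₘ` is the given term. -/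
  inductive PDSeq : {Γ : Ctx} → {σ : Ty} → Tm Γ σ → Type
    | single {Γ : Ctx} {σ : Ty} {G : Tm Γ σ} : PD G → PDSeq G
    | snoc {Γ : Ctx} {σ : Ty} {F G : Tm Γ σ} : PDSeq F → PD G → PDSeq G
end

/-- The last tree of a sequence. -/
def PDSeq.last : {Γ : Ctx} → {σ : Ty} → {G : Tm Γ σ} → PDSeq G → PD G
  | _, _, _, .single d => d
  | _, _, _, .snoc _ d => d

/-- The first term `G₀` of a sequence. -/
def PDSeq.firstTm : {Γ : Ctx} → {σ : Ty} → {G : Tm Γ σ} → PDSeq G → Tm Γ σ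
  | _, _, G, .single _ => G
  | _, _, _, .snoc s _ => s.firstTm

mutual
  /-- The vector `[[A]]` assigned to `A` by a tree. -/
  def PD.vec : {Γ : Ctx} → {σ : Ty} → {A : Tm Γ σ} → PD A → OVec Γ
    | _, _, _, .var x => OVec.var x
    | _, _, _, .zero => ⟨0, fun _ => .one⟩
    | _, _, _, .succ => ⟨1, fun _ => .one⟩
    | _, _, _, .D τ => ⟨τ.lv + 1, fun _ => .one⟩
    | _, _, _, .R τ => ⟨τ.lv + 2, fun i =>
        if (i : ℕ) = 0 then .add .one .one
        else if (i : ℕ) = τ.lv + 2 then .omega else .one⟩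
    | _, τ, _, .app d e => (d.vec.box e.vec).restrict τ.lv
    | _, _, _, .Rsup τ d => ⟨τ.lv + 2, fun i =>
        if (i : ℕ) = 0 ∨ (i : ℕ) = τ.lv + 2 then d.vec.get 0 else .one⟩
    | Γ, .arr σ _, _, .lam s =>
        -- `δˣ [[G₀]]` is `x`-free, so that `oneSub` merely adapts it to the smaller context
        ((s.firstVec.dop Var.zero).subst (oneSub Γ σ)).add (s.lastVec.subst (oneSub Γ σ))
  /-- The vector `[[G₀]]`. -/
  def PDSeq.firstVec : {Γ : Ctx} → {σ : Ty} → {G : Tm Γ σ} → PDSeq G → OVec Γ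
    | _, _, _, .single d => d.vec
    | _, _, _, .snoc s _ => s.firstVec
  /-- The vector `[[Gₘ]]`. -/
  def PDSeq.lastVec : {Γ : Ctx} → {σ : Ty} → {G : Tm Γ σ} → PDSeq G → OVec Γ
    | _, _, _, .single d => d.vec
    | _, _, _, .snoc _ d => d.vec
end

mutual
  /-- The tree is an assignment derivation: at every node for an abstraction `λX.G` with subtrees
  for `G₀, …, Gₘ = G`
  * the subtrees are assignment derivations, `G₀ ▷ … ▷ Gₘ` and `[[G₀]] ≻ … ≻ [[Gₘ]]`,
  * `X` does not occur in any subterm of `G₀` of the form `R^t`,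
  * `δˣ [[G₀]]` is defined, that is, `[[G₀]]` is in the domain `Cˣ` of `δˣ`. -/
  def PD.IsDerivation : {Γ : Ctx} → {σ : Ty} → {A : Tm Γ σ} → PD A → Prop
    | _, _, _, .var _ => True
    | _, _, _, .zero => True
    | _, _, _, .succ => True
    | _, _, _, .D _ => True
    | _, _, _, .R _ => True
    | _, _, _, .app d e => d.IsDerivation ∧ e.IsDerivation
    | _, _, _, .Rsup _ d => d.IsDerivation
    | _, _, _, .lam s =>
        s.IsDerivationSeq ∧ ¬ s.firstTm.OccursInRsup 0 ∧ s.firstVec.IsC Var.zero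
  /-- All trees of the sequence are assignment derivations, `G₀ ▷ … ▷ Gₘ`, and
  `[[G₀]] ≻ … ≻ [[Gₘ]]`. -/
  def PDSeq.IsDerivationSeq : {Γ : Ctx} → {σ : Ty} → {G : Tm Γ σ} → PDSeq G → Prop
    | _, _, _, .single d => d.IsDerivation
    | _, _, _, .snoc (F := F) (G := G) s d =>
        s.IsDerivationSeq ∧ d.IsDerivation ∧ Reduces F G ∧ d.vec.Lt s.lastVec
end

/-! ## The canonical derivation for a substitution instance -/

mutual
  /-- Renaming of variables in a tree. -/
  def PD.rename : {Γ Δ : Ctx} → {σ : Ty} → {A : Tm Γ σ} → (r : Ren Γ Δ) → PD A →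
      PD (A.rename r)
    | _, _, _, _, r, .var x => .var (r _ x)
    | _, _, _, _, _, .zero => .zero
    | _, _, _, _, _, .succ => .succ
    | _, _, _, _, _, .D τ => .D τ
    | _, _, _, _, _, .R τ => .R τ
    | _, _, _, _, r, .app d e => .app (d.rename r) (e.rename r)
    | _, _, _, _, r, .Rsup τ d => .Rsup τ (d.rename r)
    | _, _, _, _, r, .lam s => .lam (s.rename (r.lift _))
  def PDSeq.rename : {Γ Δ : Ctx} → {σ : Ty} → {G : Tm Γ σ} → (r : Ren Γ Δ) → PDSeq G →
      PDSeq (G.rename r)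
    | _, _, _, _, r, .single d => .single (d.rename r)
    | _, _, _, _, r, .snoc s d => .snoc (s.rename r) (d.rename r)
end

/-- Trees for all terms of a substitution. -/
abbrev PDSub {Γ Δ : Ctx} (s : Sub Γ Δ) := ∀ (σ : Ty) (x : Var Γ σ), PD (s σ x)

/-- Extension under a binder. -/
def PDSub.lift {Γ Δ : Ctx} {s : Sub Γ Δ} (p : PDSub s) (ρ : Ty) : PDSub (s.lift ρ)
  | _, .zero => .var .zero
  | _, .succ x => (p _ x).rename (Ren.shift Δ ρ)

mutual
  /-- The canonical tree for a substitution instance of `A`: in the tree for `A`, the nodes for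
  variables are replaced by the trees for the substituted terms, at abstractions in all members of
  the sequence. -/
  def PD.subst : {Γ Δ : Ctx} → {σ : Ty} → {A : Tm Γ σ} → {s : Sub Γ Δ} → PDSub s → PD A →
      PD (A.subst s)
    | _, _, _, _, _, p, .var x => p _ x
    | _, _, _, _, _, _, .zero => .zero
    | _, _, _, _, _, _, .succ => .succ
    | _, _, _, _, _, _, .D τ => .D τ
    | _, _, _, _, _, _, .R τ => .R τ
    | _, _, _, _, _, p, .app d e => .app (d.subst p) (e.subst p)
    | _, _, _, _, _, p, .Rsup τ d => .Rsup τ (d.subst p)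
    | _, _, _, _, _, p, .lam q => .lam (q.subst (p.lift _))
  def PDSeq.subst : {Γ Δ : Ctx} → {σ : Ty} → {G : Tm Γ σ} → {s : Sub Γ Δ} → PDSub s → PDSeq G →
      PDSeq (G.subst s)
    | _, _, _, _, _, p, .single d => .single (d.subst p)
    | _, _, _, _, _, p, .snoc q d => .snoc (q.subst p) (d.subst p)
end

/-- The trees for the substitution `{X := H}`, given a tree for `H`. -/
def PDSub.single {Γ : Ctx} {ρ : Ty} {H : Tm Γ ρ} (e : PD H) : PDSub (Sub.single H)
  | _, .zero => e
  | _, .succ x => .var x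

/-- The canonical tree for `G{X := H}`, given trees for `G` and `H`. -/
def PD.inst {Γ : Ctx} {ρ σ : Ty} {G : Tm (ρ :: Γ) σ} {H : Tm Γ ρ} (d : PD G) (e : PD H) :
    PD (G.inst H) :=
  d.subst (PDSub.single e)

/-! ## The algorithm -/

/-- The algorithm which, given `A ▷ B` and an assignment derivation for `A`, returns an assignment
derivation for `B`. In the case of the `ξ`-rule, the derivation for `G` is appended to the sequence
of derivations for `F₀, …, Fₘ = F`. -/
def algorithm : {Γ : Ctx} → {σ : Ty} → {A B : Tm Γ σ} → Step A B → PD A → PD B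
  | _, _, _, _, .D0 _ _, .app (.app (.app (.D _) .zero) a) _ => a
  | _, _, _, _, .DS _ _ _, .app (.app (.app (.D _) (.app .succ _)) _) b => b
  | _, _, _, _, .R _, .app (.R τ) t => .Rsup τ t
  | _, _, _, _, .R0 _ _, .app (.app (.Rsup _ .zero) _) b => b
  | _, _, _, _, .RS _ _ _, .app (.app (.Rsup τ (.app .succ t)) a) b =>
      .app (.app a t) (.app (.app (.Rsup τ t) a) b)
  | _, _, _, _, .beta _ _, .app (.lam s) h => s.last.inst h
  | _, _, _, _, .appr _ r, .app a c => .app (algorithm r a) c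
  | _, _, _, _, .appl _ r, .app a b => .app a (algorithm r b)
  | _, _, _, _, .appR τ r, .Rsup _ s => .Rsup τ (algorithm r s)
  | _, _, _, _, .xi r, .lam s => .lam (.snoc s (algorithm r s.last))

end GodelT

namespace GodelT

open Ordinal

/-! # Cantor normal forms as multisets of exponents -/

-- Comparison of vectors is defined through admissible closed instances, so everything is tested on
-- values. Under an admissible substitution a vector becomes a sequence of ordinals below ε₀,
-- computed in the ordered semiring `NatOrd` of ordinals with natural sum and product, where 2^(a+b)
-- = 2^a · 2^b still holds (`two_opow_natSum`). The theorem becomes a family of inequalities between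
-- towers of exponentials in the positive components and values of ψ in component 0.
--
-- The collapsing function is monotone only under norm control: ψ(a) < ψ(b) requires a < b and no(a)
-- ≤ Φ(no(b)). Hence the invariant `Good` (for terms: `OVec.Regular`): component 0 is finite and
-- bounds the norm of every component. The operator □ preserves it (`Good.vbox`), because the norm
-- of a tower of height at most n is bounded by F₂ of a bound for n and its entries, while ψ(ω·a+m)
-- with a ≥ 1 exceeds every number up to Φ(m). Under the invariant □ is strictly monotone in both
-- arguments and dominates both of them. This settles the rules for application, the redexes of D
-- and R⁰, and, since ω exceeds the finite value of t, the redex of R.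
--
-- For the redex of Rˢ the value s of St exceeds that t of t by at least 2. This yields a factor 4
-- at the top of the tower, and a surplus of 1 survives at each exponentiation on the way down
-- (`tower_rec_le`). In component 0 the nested values of ψ are merged by ψ(a+ψ(b)) ≤ ψ(a+b)
-- (`psi_add_psi_le`).
--
-- For β the decisive inequality is h ≺ (δˣh + k) □ x for every h in Cˣ and every `Good` k
-- (`OVec.Regular.vlt_vbox_dop`), proved by induction on the components of h from the
-- superadditivity of towers and of ψ. Since δˣh is x-free, x may be instantiated by the vector of
-- H, and the last member of the sequence lies below the first. For ξ the summand δˣ of the first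
-- member is kept and only the last member decreases, so no monotonicity of δˣ is needed.
--
-- That the reduct of a β-redex again carries a derivation rests on stability under substitution: □,
-- δˣ and the classes Cˣ commute with substitution of regular vectors (`PD.vec_subst`,
-- `PD.IsDerivation.subst`).

theorem pairwise_sum_eq_ofExps {l : List Ordinal.{0}} (hl : l.Pairwise (· ≥ ·)) :
    ofExps (l : Multiset Ordinal.{0}) = (l.map fun γ => ω ^ γ).sum := by
  unfold ofExps
  rw [Multiset.coe_sort, List.mergeSort_eq_self _ hl]

@[simp] theorem ofExps_zero : ofExps 0 = 0 := by
  simp [ofExps]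

theorem ofExps_add {s t : Multiset Ordinal.{0}} (h : ∀ a ∈ s, ∀ b ∈ t, b ≤ a) :
    ofExps (s + t) = ofExps s + ofExps t := by
  have hp : (s.sort (· ≥ ·) ++ t.sort (· ≥ ·)).Pairwise (· ≥ ·) := by
    rw [List.pairwise_append]
    refine ⟨Multiset.pairwise_sort _ _, Multiset.pairwise_sort _ _, ?_⟩
    intro a ha b hb
    exact h a ((Multiset.mem_sort _).1 ha) b ((Multiset.mem_sort _).1 hb)
  have := pairwise_sum_eq_ofExps hp
  rw [← Multiset.coe_add, Multiset.sort_eq, Multiset.sort_eq] at this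
  rw [this, List.map_append, List.sum_append]
  rfl

@[simp] theorem ofExps_singleton (a : Ordinal.{0}) : ofExps {a} = ω ^ a := by
  simp [ofExps]

theorem ofExps_replicate (n : ℕ) (a : Ordinal.{0}) :
    ofExps (Multiset.replicate n a) = ω ^ a * n := by
  induction n with
  | zero => simp
  | succ n ih =>
    rw [Multiset.replicate_succ, ← Multiset.singleton_add, ofExps_add, ih, ofExps_singleton,
      Nat.cast_succ, ← Nat.cast_one, ← Nat.cast_add, Nat.add_comm n 1, Nat.cast_add, mul_add]
    · simp
    · intro x hx y hy
      rw [Multiset.mem_singleton.1 hx, Multiset.eq_of_mem_replicate hy]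

theorem ofExps_lt_opow {s : Multiset Ordinal.{0}} {c : Ordinal.{0}} (h : ∀ a ∈ s, a < c) :
    ofExps s < ω ^ c := by
  have key : ∀ l : List Ordinal.{0}, (∀ a ∈ l, a < c) → (l.map fun γ => ω ^ γ).sum < ω ^ c := by
    intro l
    induction l with
    | nil => intro _; simpa using opow_pos c omega0_pos
    | cons a l ih =>
      intro hl
      rw [List.map_cons, List.sum_cons]
      refine isPrincipal_add_omega0_opow c ?_ (ih fun x hx => hl x (List.mem_cons_of_mem _ hx))
      exact (opow_lt_opow_iff_right one_lt_omega0).2 (hl a List.mem_cons_self)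
  exact key _ fun a ha => h a ((Multiset.mem_sort _).1 ha)

theorem opow_le_ofExps {s : Multiset Ordinal.{0}} {c : Ordinal.{0}} (h : c ∈ s) :
    ω ^ c ≤ ofExps s := by
  have key : ∀ l : List Ordinal.{0}, c ∈ l → ω ^ c ≤ (l.map fun γ => ω ^ γ).sum := by
    intro l
    induction l with
    | nil => intro h; simp at h
    | cons a l ih =>
      intro hl
      rw [List.map_cons, List.sum_cons]
      rcases List.mem_cons.1 hl with rfl | hl
      · exact le_self_add
      · exact (ih hl).trans le_add_self
  exact key _ ((Multiset.mem_sort _).2 h)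

/-- The lexicographic comparison of multisets of ordinals, starting from the largest elements. -/
def ExpsLt (s t : Multiset Ordinal.{0}) : Prop :=
  ∃ c, s.count c < t.count c ∧ ∀ d, c < d → s.count d = t.count d

/-- At the largest exponent c where the multiplicities differ, s contributes fewer copies. Its
exponents ≥ c form a common initial part of both normal forms. What remains of s is below ω^c
because ω^c is additively principal, while what remains of t still contains ω^c. -/
theorem ofExps_lt_of_expsLt {s t : Multiset Ordinal.{0}} (h : ExpsLt s t) :
    ofExps s < ofExps t := by
  obtain ⟨c, hc, hd⟩ := h
  set u := s.filter (c ≤ ·) with hu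
  have hs : s = u + s.filter (fun x => ¬ c ≤ x) := (Multiset.filter_add_not _ s).symm
  have hut : u ≤ t := by
    rw [Multiset.le_iff_count]
    intro a
    rw [hu, Multiset.count_filter]
    split_ifs with ha
    · rcases ha.eq_or_lt with rfl | ha
      · exact hc.le
      · exact (hd a ha).le
    · exact Nat.zero_le _
  obtain ⟨v, rfl⟩ := Multiset.le_iff_exists_add.1 hut
  have hcv : c ∈ v := by
    rw [Multiset.count_add, hu, Multiset.count_filter, if_pos le_rfl] at hc
    exact Multiset.count_pos.1 (by omega)
  have hv : ∀ b ∈ v, b ≤ c := by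
    intro b hb
    by_contra hbc
    rw [not_le] at hbc
    have := hd b hbc
    rw [Multiset.count_add, hu, Multiset.count_filter, if_pos hbc.le] at this
    have := Multiset.count_pos.2 hb
    omega
  have huc : ∀ a ∈ u, c ≤ a := fun a ha => (Multiset.mem_filter.1 ha).2
  rw [hs, ofExps_add, ofExps_add, add_lt_add_iff_left]
  · exact (ofExps_lt_opow fun a ha => not_le.1 (Multiset.mem_filter.1 ha).2).trans_le
      (opow_le_ofExps hcv)
  · exact fun a ha b hb => (hv b hb).trans (huc a ha)
  · exact fun a ha b hb => (not_le.1 (Multiset.mem_filter.1 hb).2).le.trans (huc a ha)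

/-- Only finitely many exponents have different multiplicities, so unequal multisets have a largest
one, which decides. -/
theorem expsLt_trichotomy (s t : Multiset Ordinal.{0}) : ExpsLt s t ∨ s = t ∨ ExpsLt t s := by
  by_cases h : s = t
  · exact Or.inr (Or.inl h)
  have hne : ((s + t).toFinset.filter fun c => s.count c ≠ t.count c).Nonempty := by
    by_contra hn
    rw [Finset.not_nonempty_iff_eq_empty] at hn
    refine h (Multiset.ext.2 fun a => ?_)
    by_contra ha
    have : a ∈ ((s + t).toFinset.filter fun c => s.count c ≠ t.count c) := by
      rw [Finset.mem_filter, Multiset.mem_toFinset, Multiset.mem_add]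
      refine ⟨?_, ha⟩
      by_contra hst
      rw [not_or] at hst
      rw [Multiset.count_eq_zero.2 hst.1, Multiset.count_eq_zero.2 hst.2] at ha
      exact ha rfl
    rw [hn] at this
    exact absurd this (Finset.notMem_empty _)
  obtain ⟨c, hc, hmax⟩ := Finset.exists_max_image _ id hne
  have hup : ∀ d, c < d → s.count d = t.count d := by
    intro d hd
    by_contra hdd
    have hmem : d ∈ ((s + t).toFinset.filter fun c => s.count c ≠ t.count c) := by
      rw [Finset.mem_filter, Multiset.mem_toFinset, Multiset.mem_add]
      refine ⟨?_, hdd⟩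
      by_contra hst
      rw [not_or] at hst
      rw [Multiset.count_eq_zero.2 hst.1, Multiset.count_eq_zero.2 hst.2] at hdd
      exact hdd rfl
    exact absurd (hmax d hmem) (not_le.2 hd)
  rcases lt_or_gt_of_ne (Finset.mem_filter.1 hc).2 with hlt | hlt
  · exact Or.inl ⟨c, hlt, hup⟩
  · exact Or.inr (Or.inr ⟨c, hlt, fun d hd => (hup d hd).symm⟩)

theorem ofExps_lt_iff {s t : Multiset Ordinal.{0}} : ofExps s < ofExps t ↔ ExpsLt s t := by
  refine ⟨fun h => ?_, ofExps_lt_of_expsLt⟩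
  rcases expsLt_trichotomy s t with h' | rfl | h'
  · exact h'
  · exact absurd h (lt_irrefl _)
  · exact absurd (ofExps_lt_of_expsLt h') h.asymm

theorem ofExps_injective : Function.Injective ofExps := by
  intro s t h
  rcases expsLt_trichotomy s t with h' | h' | h'
  · exact absurd h (ofExps_lt_of_expsLt h').ne
  · exact h'
  · exact absurd h (ofExps_lt_of_expsLt h').ne'

theorem ofExps_exps (α : Ordinal.{0}) : ofExps (exps α) = α := by
  unfold exps
  rw [pairwise_sum_eq_ofExps]
  · conv_rhs => rw [← CNF.foldr ω α]
    have key : ∀ l : List (Ordinal.{0} × Ordinal.{0}), (∀ p ∈ l, p.2 < ω) →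
        ((l.flatMap fun p => List.replicate (Cardinal.toNat p.2.card) p.1).map
          fun γ => ω ^ γ).sum = l.foldr (fun p r ↦ ω ^ p.1 * p.2 + r) 0 := by
      intro l
      induction l with
      | nil => simp
      | cons p l ih =>
        intro hl
        obtain ⟨n, hn⟩ := lt_omega0.1 (hl p List.mem_cons_self)
        rw [List.flatMap_cons, List.map_append, List.sum_append,
          ih fun q hq => hl q (List.mem_cons_of_mem _ hq), List.foldr_cons, List.map_replicate,
          List.sum_replicate, hn, Ordinal.nsmul_eq_mul, card_nat, Cardinal.toNat_natCast]
    exact key _ fun p hp => CNF.snd_lt one_lt_omega0 hp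
  · have hs : (CNF ω α).Pairwise fun p q => q.1 < p.1 := by
      have := (CNF.sortedGT ω α).pairwise
      rw [List.pairwise_map] at this
      exact this
    revert hs
    generalize CNF ω α = l
    induction l with
    | nil => simp
    | cons p l ih =>
      intro hs
      rw [List.pairwise_cons] at hs
      rw [List.flatMap_cons, List.pairwise_append]
      refine ⟨?_, ih hs.2, ?_⟩
      · exact List.pairwise_replicate.2 (Or.inr le_rfl)
      · intro a ha b hb
        rw [List.mem_flatMap] at hb
        obtain ⟨q, hq, hb⟩ := hb
        rw [(List.mem_replicate.1 ha).2, (List.mem_replicate.1 hb).2]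
        exact (hs.1 q hq).le

theorem exps_ofExps (s : Multiset Ordinal.{0}) : exps (ofExps s) = s :=
  ofExps_injective (ofExps_exps _)

theorem lt_iff_expsLt {α β : Ordinal.{0}} : α < β ↔ ExpsLt (exps α) (exps β) := by
  rw [← ofExps_lt_iff, ofExps_exps, ofExps_exps]

theorem exps_injective : Function.Injective exps :=
  Function.LeftInverse.injective ofExps_exps

theorem lt_opow_iff {α c : Ordinal.{0}} : α < ω ^ c ↔ ∀ a ∈ exps α, a < c := by
  refine ⟨fun h a ha => ?_, fun h => ?_⟩
  · have := (opow_le_ofExps ha).trans_lt ((ofExps_exps α).trans_lt h)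
    exact (opow_lt_opow_iff_right one_lt_omega0).1 this
  · rw [← ofExps_exps α]
    exact ofExps_lt_opow h

theorem opow_le_of_mem_exps {α a : Ordinal.{0}} (h : a ∈ exps α) : ω ^ a ≤ α :=
  (opow_le_ofExps h).trans (ofExps_exps α).le

theorem exps_natSum (α β : Ordinal.{0}) : exps (natSum α β) = exps α + exps β :=
  exps_ofExps _

theorem exps_natProd (α β : Ordinal.{0}) :
    exps (natProd α β) = (exps α).bind fun γ => (exps β).map fun δ => natSum γ δ :=
  exps_ofExps _

theorem exps_natCast (n : ℕ) : exps (n : Ordinal.{0}) = Multiset.replicate n 0 := by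
  apply ofExps_injective
  rw [ofExps_exps, ofExps_replicate, opow_zero, one_mul]

theorem exps_zero : exps 0 = 0 := by
  simpa using exps_natCast 0

theorem exps_one : exps 1 = {0} := by
  simpa using exps_natCast 1

theorem exps_omega0 : exps ω = {1} := by
  apply ofExps_injective
  rw [ofExps_exps, ofExps_singleton, opow_one]

end GodelT

namespace GodelT

open Ordinal

/-! # The ordered semiring of ordinals with natural sum and product -/

theorem natSum_comm (α β : Ordinal.{0}) : natSum α β = natSum β α :=
  exps_injective (by rw [exps_natSum, exps_natSum, add_comm])

theorem natSum_assoc (α β γ : Ordinal.{0}) :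
    natSum (natSum α β) γ = natSum α (natSum β γ) :=
  exps_injective (by simp only [exps_natSum, add_assoc])

theorem natSum_zero (α : Ordinal.{0}) : natSum α 0 = α :=
  exps_injective (by rw [exps_natSum, exps_zero, add_zero])

/-- Natural sum is union of the multisets of exponents, which raises all multiplicities on both
sides equally and leaves the deciding exponent unchanged. -/
theorem natSum_lt_natSum_left {α β : Ordinal.{0}} (h : α < β) (γ : Ordinal.{0}) :
    natSum α γ < natSum β γ := by
  rw [lt_iff_expsLt] at h ⊢
  obtain ⟨c, hc, hd⟩ := h
  refine ⟨c, ?_, fun d hcd => ?_⟩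
  · simp only [exps_natSum, Multiset.count_add]
    omega
  · simp only [exps_natSum, Multiset.count_add, hd d hcd]

theorem natSum_left_injective (γ : Ordinal.{0}) : Function.Injective fun α => natSum α γ := by
  intro α β h
  rcases lt_trichotomy α β with h' | h' | h'
  · exact absurd h (natSum_lt_natSum_left h' γ).ne
  · exact h'
  · exact absurd h (natSum_lt_natSum_left h' γ).ne'

theorem natProd_comm (α β : Ordinal.{0}) : natProd α β = natProd β α := by
  apply exps_injective
  rw [exps_natProd, exps_natProd, Multiset.bind_map_comm]
  simp only [natSum_comm]

theorem natProd_natSum_left (α β γ : Ordinal.{0}) :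
    natProd (natSum α β) γ = natSum (natProd α γ) (natProd β γ) := by
  apply exps_injective
  simp only [exps_natProd, exps_natSum, Multiset.add_bind]

theorem natProd_assoc (α β γ : Ordinal.{0}) :
    natProd (natProd α β) γ = natProd α (natProd β γ) := by
  apply exps_injective
  simp only [exps_natProd, Multiset.bind_assoc, Multiset.map_bind, Multiset.bind_map,
    Multiset.map_map, Function.comp_def, natSum_assoc]

theorem natProd_one (α : Ordinal.{0}) : natProd α 1 = α := by
  apply exps_injective
  rw [exps_natProd, exps_one]
  simp only [Multiset.map_singleton, natSum_zero]
  exact (Multiset.bind_singleton (exps α) id).trans (Multiset.map_id _)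

theorem natProd_zero (α : Ordinal.{0}) : natProd α 0 = 0 := by
  apply exps_injective
  rw [exps_natProd, exps_zero]
  simp

theorem natSum_natCast_one (n : ℕ) : ((n + 1 : ℕ) : Ordinal.{0}) = natSum n 1 := by
  apply exps_injective
  rw [exps_natSum, exps_natCast, exps_natCast, exps_one, Multiset.replicate_succ,
    ← Multiset.singleton_add, add_comm]

/-- Multiplication by ω^c shifts all exponents by the injective, strictly increasing map δ ↦ δ ⊕ c.
Multiplicities are transported along it, and so is the largest exponent at which they differ. -/
theorem natProd_opow_lt {α β : Ordinal.{0}} (h : α < β) (c : Ordinal.{0}) :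
    natProd α (ω ^ c) < natProd β (ω ^ c) := by
  have hm : ∀ γ : Ordinal.{0}, exps (natProd γ (ω ^ c)) = (exps γ).map fun δ => natSum δ c := by
    intro γ
    rw [← ofExps_singleton c, exps_natProd, exps_ofExps]
    simp [Multiset.bind_singleton]
  rw [lt_iff_expsLt] at h ⊢
  obtain ⟨d, hd, hu⟩ := h
  refine ⟨natSum d c, ?_, fun e he => ?_⟩
  · rw [hm, hm, Multiset.count_map_eq_count' _ _ (natSum_left_injective c),
      Multiset.count_map_eq_count' _ _ (natSum_left_injective c)]
    exact hd
  · rw [hm, hm]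
    by_cases hex : ∃ e', natSum e' c = e
    · obtain ⟨e', rfl⟩ := hex
      rw [Multiset.count_map_eq_count' _ _ (natSum_left_injective c),
        Multiset.count_map_eq_count' _ _ (natSum_left_injective c)]
      refine hu e' ?_
      by_contra hle
      rcases (not_lt.1 hle).eq_or_lt with rfl | hlt
      · exact lt_irrefl _ he
      · exact he.asymm (natSum_lt_natSum_left hlt c)
    · rw [Multiset.count_eq_zero.2, Multiset.count_eq_zero.2]
      · exact fun hmem => hex (by obtain ⟨x, _, hx⟩ := Multiset.mem_map.1 hmem; exact ⟨x, hx⟩)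
      · exact fun hmem => hex (by obtain ⟨x, _, hx⟩ := Multiset.mem_map.1 hmem; exact ⟨x, hx⟩)

theorem exps_ne_zero {α : Ordinal.{0}} (h : α ≠ 0) : exps α ≠ 0 :=
  fun h0 => h (exps_injective (h0.trans exps_zero.symm))

/-- Distributivity splits γ into its powers of ω, for each of which `natProd_opow_lt` applies. -/
theorem natProd_lt_natProd_left {α β : Ordinal.{0}} (h : α < β) {γ : Ordinal.{0}} (hγ : γ ≠ 0) :
    natProd α γ < natProd β γ := by
  have key : ∀ s : Multiset Ordinal.{0}, s ≠ 0 →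
      natProd α (ofExps s) < natProd β (ofExps s) := by
    intro s
    induction s using Multiset.induction_on with
    | empty => intro h; exact absurd rfl h
    | cons x s ih =>
      intro _
      have hsum : ofExps (x ::ₘ s) = natSum (ω ^ x) (ofExps s) := by
        apply exps_injective
        rw [exps_natSum, exps_ofExps, exps_ofExps, ← ofExps_singleton, exps_ofExps,
          Multiset.singleton_add]
      rw [hsum, natProd_comm α, natProd_natSum_left, natProd_comm β, natProd_natSum_left,
        natProd_comm _ α, natProd_comm _ α, natProd_comm _ β, natProd_comm _ β]
      by_cases hs : s = 0
      · subst hs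
        rw [ofExps_zero, natProd_zero, natProd_zero, natSum_zero, natSum_zero]
        exact natProd_opow_lt h x
      · refine (natSum_lt_natSum_left (natProd_opow_lt h x) _).trans ?_
        rw [natSum_comm, natSum_comm (natProd β _)]
        exact natSum_lt_natSum_left (ih hs) _
  have := key (exps γ) (exps_ne_zero hγ)
  rwa [ofExps_exps] at this

/-- The ordinals as an ordered semiring under natural sum and natural product. -/
@[ext] structure NatOrd : Type 1 where
  ord : Ordinal.{0}

namespace NatOrd

noncomputable instance : LinearOrder NatOrd :=
  LinearOrder.lift' ord fun _ _ h => NatOrd.ext h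

theorem lt_def {a b : NatOrd} : a < b ↔ a.ord < b.ord := Iff.rfl


instance : WellFoundedLT NatOrd := ⟨InvImage.wf ord Ordinal.lt_wf⟩

noncomputable instance : Zero NatOrd := ⟨⟨0⟩⟩
noncomputable instance : One NatOrd := ⟨⟨1⟩⟩
noncomputable instance : Add NatOrd := ⟨fun a b => ⟨natSum a.ord b.ord⟩⟩
noncomputable instance : Mul NatOrd := ⟨fun a b => ⟨natProd a.ord b.ord⟩⟩
noncomputable instance : NatCast NatOrd := ⟨fun n => ⟨n⟩⟩

@[simp] theorem ord_one : (1 : NatOrd).ord = 1 := rfl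
@[simp] theorem ord_add (a b : NatOrd) : (a + b).ord = natSum a.ord b.ord := rfl

noncomputable instance : CommSemiring NatOrd where
  natCast_zero := NatOrd.ext Nat.cast_zero
  natCast_succ n := NatOrd.ext (natSum_natCast_one n)
  add_assoc _ _ _ := NatOrd.ext (natSum_assoc _ _ _)
  add_comm _ _ := NatOrd.ext (natSum_comm _ _)
  add_zero _ := NatOrd.ext (natSum_zero _)
  zero_add _ := NatOrd.ext ((natSum_comm _ _).trans (natSum_zero _))
  mul_assoc _ _ _ := NatOrd.ext (natProd_assoc _ _ _)
  mul_comm _ _ := NatOrd.ext (natProd_comm _ _)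
  mul_one _ := NatOrd.ext (natProd_one _)
  one_mul _ := NatOrd.ext ((natProd_comm _ _).trans (natProd_one _))
  mul_zero _ := NatOrd.ext (natProd_zero _)
  zero_mul _ := NatOrd.ext ((natProd_comm _ _).trans (natProd_zero _))
  right_distrib _ _ _ := NatOrd.ext (natProd_natSum_left _ _ _)
  left_distrib _ _ _ := NatOrd.ext ((natProd_comm _ _).trans ((natProd_natSum_left _ _ _).trans
    (congrArg₂ natSum (natProd_comm _ _) (natProd_comm _ _))))
  nsmul := nsmulRec

/-- The ordinal `ω`. -/
noncomputable def omega : NatOrd := ⟨Ordinal.omega0⟩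

/-- The exponential `2 ^ α`. -/
noncomputable def exp (a : NatOrd) : NatOrd := ⟨2 ^ a.ord⟩

protected theorem zero_le (a : NatOrd) : 0 ≤ a := bot_le (α := Ordinal.{0})

theorem add_lt_add_left_aux {a b : NatOrd} (h : a < b) (c : NatOrd) : a + c < b + c :=
  natSum_lt_natSum_left h c.ord

instance : IsOrderedCancelAddMonoid NatOrd where
  add_le_add_left a b h c := by
    rcases h.eq_or_lt with rfl | h
    · exact le_rfl
    · exact (add_lt_add_left_aux h c).le
  le_of_add_le_add_left a b c h := by
    by_contra hlt
    rw [not_le] at hlt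
    have := add_lt_add_left_aux hlt a
    rw [add_comm c, add_comm b] at this
    exact absurd h (not_le.2 this)

theorem mul_lt_mul_right_aux {a b : NatOrd} (h : a < b) {c : NatOrd} (hc : 0 < c) :
    a * c < b * c :=
  natProd_lt_natProd_left h (fun h0 => hc.ne' (NatOrd.ext h0))

instance : IsStrictOrderedRing NatOrd where
  zero_le_one := NatOrd.zero_le 1
  exists_pair_ne := ⟨0, 1, fun h => zero_ne_one (congrArg ord h)⟩
  mul_lt_mul_of_pos_left a ha b c h := by
    have := mul_lt_mul_right_aux h ha
    rwa [mul_comm b, mul_comm c] at this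
  mul_lt_mul_of_pos_right a ha b c h := mul_lt_mul_right_aux h ha

theorem one_le_iff {a : NatOrd} : 1 ≤ a ↔ 0 < a := Order.one_le_iff_pos (α := Ordinal.{0})

/-- The added exponent 0 is minimal, so it is already in last place and the natural sum is the
ordinary one. -/
theorem add_one_eq (a : NatOrd) : a + 1 = ⟨a.ord + 1⟩ := by
  apply NatOrd.ext
  apply GodelT.exps_injective
  rw [ord_add, ord_one, exps_natSum, exps_one]
  apply ofExps_injective
  rw [ofExps_exps, ofExps_add, ofExps_exps, ofExps_singleton, opow_zero]
  intro x _ b hb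
  rw [Multiset.mem_singleton.1 hb]
  exact bot_le

theorem add_one_le_iff {a b : NatOrd} : a + 1 ≤ b ↔ a < b := by
  rw [add_one_eq]
  exact Order.add_one_le_iff (α := Ordinal.{0})

theorem lt_add_one_iff {a b : NatOrd} : a < b + 1 ↔ a ≤ b := by
  rw [add_one_eq]
  exact Order.lt_add_one_iff (α := Ordinal.{0})

theorem natCast_lt_omega (n : ℕ) : (n : NatOrd) < omega := natCast_lt_omega0 n

theorem one_le_omega : 1 ≤ omega := one_lt_omega0.le

theorem lt_omega_iff {a : NatOrd} : a < omega ↔ ∃ n : ℕ, a = n :=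
  (lt_omega0 (o := a.ord)).trans ⟨fun ⟨n, h⟩ => ⟨n, NatOrd.ext h⟩, fun ⟨n, h⟩ =>
    ⟨n, congrArg ord h⟩⟩

/-! ## Exponentiation -/

theorem exp_zero : exp 0 = 1 := NatOrd.ext (opow_zero 2)

theorem exp_one : exp 1 = 2 := by
  apply NatOrd.ext
  change (2 : Ordinal.{0}) ^ (1 : Ordinal.{0}) = _
  rw [opow_one]
  rw [← Nat.cast_ofNat (R := NatOrd)]
  rfl

theorem exp_strictMono : StrictMono exp := fun _ _ h =>
  (opow_lt_opow_iff_right (a := (2 : Ordinal.{0})) one_lt_two).2 h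

end NatOrd

/-! ## Powers of two -/

/-- The exponent `γ` in `2 ^ α = ω ^ γ · 2 ^ k`, where `α = ω · γ + k`. -/
noncomputable def leftHalf (α : Ordinal.{0}) : Ordinal.{0} :=
  ofExps (((exps α).filter (· ≠ 0)).map fun γ => γ - 1)

/-- Ordinary multiplication distributes over sums on its right, and γ ↦ 1 + γ keeps the exponents
weakly decreasing. -/
theorem omega0_mul_ofExps (s : Multiset Ordinal.{0}) :
    ω * ofExps s = ofExps (s.map fun γ => 1 + γ) := by
  have hl : ∀ l : List Ordinal.{0}, ω * (l.map fun γ => ω ^ γ).sum =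
      ((l.map fun γ => 1 + γ).map fun γ => ω ^ γ).sum := by
    intro l
    induction l with
    | nil => simp
    | cons a l ih =>
      simp only [List.map_cons, List.sum_cons, mul_add, ih, opow_add, opow_one]
  conv_rhs => rw [← Multiset.sort_eq s (· ≥ ·), Multiset.map_coe]
  rw [pairwise_sum_eq_ofExps, ← hl]
  · rfl
  · rw [List.pairwise_map]
    exact (Multiset.pairwise_sort s _).imp fun h => add_le_add_right h 1

/-- The nonzero exponents satisfy 1 + (γ - 1) = γ, so their part of the normal form is divisible by
ω on the left. The exponents equal to 0 make up the finite remainder. -/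
theorem eq_omega0_mul_leftHalf_add (α : Ordinal.{0}) :
    α = ω * leftHalf α + ((exps α).count 0 : ℕ) := by
  rw [leftHalf, omega0_mul_ofExps, Multiset.map_map]
  have h1 : ((exps α).filter (· ≠ 0)).map ((fun γ => 1 + γ) ∘ fun γ => γ - 1) =
      (exps α).filter (· ≠ 0) := by
    conv_rhs => rw [← Multiset.map_id ((exps α).filter (· ≠ 0))]
    refine Multiset.map_congr rfl fun x hx => ?_
    have hx0 : x ≠ 0 := (Multiset.mem_filter.1 hx).2
    exact Ordinal.add_sub_cancel_of_le (Order.one_le_iff_pos.2 (pos_iff_ne_zero.2 hx0))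
  have h2 : exps α = (exps α).filter (· ≠ 0) + Multiset.replicate ((exps α).count 0) 0 := by
    conv_lhs => rw [← Multiset.filter_add_not (· ≠ 0) (exps α)]
    congr 1
    simp only [ne_eq, not_not]
    exact Multiset.filter_eq' _ _
  rw [h1]
  conv_lhs => rw [← ofExps_exps α, h2, ofExps_add (fun a _ b hb => by
    rw [Multiset.eq_of_mem_replicate hb]; exact bot_le), ofExps_replicate, opow_zero, one_mul]

/-- Since 2^ω = ω, one has 2^(ω·γ+k) = ω^γ · 2^k. The normal form of a power of 2 thus consists of
equal terms. -/
theorem exps_two_opow (α : Ordinal.{0}) :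
    exps (2 ^ α) = Multiset.replicate (2 ^ (exps α).count 0) (leftHalf α) := by
  apply ofExps_injective
  rw [ofExps_exps, ofExps_replicate]
  conv_lhs => rw [eq_omega0_mul_leftHalf_add α]
  rw [opow_add, opow_mul, opow_natCast]
  have : (2 : Ordinal.{0}) ^ ω = ω := by
    simpa using natCast_opow_omega0 (n := 2) (by norm_num)
  rw [this]
  push_cast
  rfl

theorem leftHalf_natSum (α β : Ordinal.{0}) :
    leftHalf (natSum α β) = natSum (leftHalf α) (leftHalf β) := by
  apply exps_injective
  simp only [leftHalf, exps_natSum, exps_ofExps, Multiset.filter_add, Multiset.map_add]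

/-- Both data describing a power of 2, the left half and the finite remainder, are additive for the
natural sum. The product of two blocks of equal terms is again such a block, with multiplicities
multiplied and exponents added. -/
theorem two_opow_natSum (α β : Ordinal.{0}) :
    (2 : Ordinal.{0}) ^ natSum α β = natProd (2 ^ α) (2 ^ β) := by
  apply exps_injective
  rw [exps_natProd, exps_two_opow, exps_two_opow, exps_two_opow, leftHalf_natSum, exps_natSum,
    Multiset.count_add, pow_add]
  simp only [Multiset.map_replicate, Multiset.bind, Multiset.join, Multiset.sum_replicate,
    Multiset.nsmul_replicate]

namespace NatOrd

theorem exp_add (a b : NatOrd) : exp (a + b) = exp a * exp b :=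
  NatOrd.ext (two_opow_natSum _ _)

end NatOrd

end GodelT

namespace GodelT

open Ordinal

/-! # The norm below `ε₀` -/

theorem lt_epsilon_zero_iff {α : Ordinal.{0}} : α < ε₀ ↔ ∀ a ∈ exps α, a < ε₀ := by
  rw [← lt_opow_iff, omega0_opow_epsilon]

/-- An exponent a with ω^a ≤ a would be at least ε₀. Consequently the default value 0 in the
recursion for `no` is never taken below ε₀. -/
theorem lt_of_mem_exps {α a : Ordinal.{0}} (hα : α < ε₀) (h : a ∈ exps α) : a < α := by
  have ha := lt_epsilon_zero_iff.1 hα a h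
  refine lt_of_lt_of_le ?_ (opow_le_of_mem_exps h)
  by_contra hle
  exact absurd (epsilon_zero_le_of_omega0_opow_le (not_lt.1 hle)) (not_le.2 ha)

/-- The sum of the norms of the exponentials with the given exponents. -/
noncomputable def noExps (s : Multiset Ordinal.{0}) : ℕ := (s.map fun γ => no γ + 1).sum

theorem noExps_add (s t : Multiset Ordinal.{0}) : noExps (s + t) = noExps s + noExps t := by
  simp [noExps]

@[simp] theorem noExps_zero : noExps 0 = 0 := by simp [noExps]

@[simp] theorem noExps_cons (a : Ordinal.{0}) (s : Multiset Ordinal.{0}) :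
    noExps (a ::ₘ s) = no a + 1 + noExps s := by
  simp [noExps]

theorem noExps_replicate (n : ℕ) (a : Ordinal.{0}) :
    noExps (Multiset.replicate n a) = n * (no a + 1) := by
  simp [noExps]

theorem card_le_noExps (s : Multiset Ordinal.{0}) : s.card ≤ noExps s := by
  induction s using Multiset.induction_on with
  | empty => simp
  | cons a s ih => simp; omega

theorem no_lt_noExps {s : Multiset Ordinal.{0}} {a : Ordinal.{0}} (h : a ∈ s) :
    no a < noExps s := by
  obtain ⟨t, rfl⟩ := Multiset.exists_cons_of_mem h
  simp
  omega

theorem no_eq_noExps {α : Ordinal.{0}} (hα : α < ε₀) : no α = noExps (exps α) := by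
  rw [no]
  have : ((exps α).map fun γ => if _h : γ < α then no γ else 0) = (exps α).map no :=
    Multiset.map_congr rfl fun γ hγ => dif_pos (lt_of_mem_exps hα hγ)
  rw [this, noExps, Multiset.sum_map_add]
  simp [add_comm]

theorem natCast_lt_epsilon (n : ℕ) : (n : Ordinal.{0}) < ε₀ :=
  Ordinal.natCast_lt_epsilon n 0

theorem no_natCast (n : ℕ) : no n = n := by
  have h0 : no 0 = 0 := by
    rw [no, exps_zero]
    simp
  rw [no_eq_noExps (natCast_lt_epsilon n), exps_natCast, noExps_replicate, h0]
  omega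

theorem natSum_lt_epsilon {α β : Ordinal.{0}} (hα : α < ε₀) (hβ : β < ε₀) :
    natSum α β < ε₀ := by
  rw [lt_epsilon_zero_iff, exps_natSum]
  intro a ha
  rcases Multiset.mem_add.1 ha with h | h
  · exact lt_epsilon_zero_iff.1 hα a h
  · exact lt_epsilon_zero_iff.1 hβ a h

theorem no_natSum {α β : Ordinal.{0}} (hα : α < ε₀) (hβ : β < ε₀) :
    no (natSum α β) = no α + no β := by
  rw [no_eq_noExps (natSum_lt_epsilon hα hβ), exps_natSum, noExps_add, no_eq_noExps hα,
    no_eq_noExps hβ]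

theorem natProd_lt_epsilon {α β : Ordinal.{0}} (hα : α < ε₀) (hβ : β < ε₀) :
    natProd α β < ε₀ := by
  rw [lt_epsilon_zero_iff, exps_natProd]
  intro a ha
  obtain ⟨γ, hγ, ha⟩ := Multiset.mem_bind.1 ha
  obtain ⟨δ, hδ, rfl⟩ := Multiset.mem_map.1 ha
  exact natSum_lt_epsilon (lt_epsilon_zero_iff.1 hα γ hγ) (lt_epsilon_zero_iff.1 hβ δ hδ)

theorem noExps_map_natSum {s : Multiset Ordinal.{0}} {γ : Ordinal.{0}} (hγ : γ < ε₀)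
    (hs : ∀ a ∈ s, a < ε₀) :
    noExps (s.map fun δ => natSum γ δ) = s.card * no γ + noExps s := by
  induction s using Multiset.induction_on with
  | empty => simp
  | cons a s ih =>
    rw [Multiset.map_cons, noExps_cons, noExps_cons, Multiset.card_cons,
      ih fun b hb => hs b (Multiset.mem_cons_of_mem hb),
      no_natSum hγ (hs a (Multiset.mem_cons_self a s))]
    ring

/-- A pair (γ, δ) contributes no(γ) + no(δ) + 1, whereas the right-hand side counts (no(γ) + 1) +
(no(δ) + 1). The excess is 1 per pair. -/
theorem noExps_bind {s t : Multiset Ordinal.{0}} (hs : ∀ a ∈ s, a < ε₀) (ht : ∀ a ∈ t, a < ε₀) :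
    noExps (s.bind fun γ => t.map fun δ => natSum γ δ) + s.card * t.card =
      t.card * noExps s + s.card * noExps t := by
  induction s using Multiset.induction_on with
  | empty => simp
  | cons a s ih =>
    have := ih fun b hb => hs b (Multiset.mem_cons_of_mem hb)
    rw [Multiset.cons_bind, noExps_add, noExps_map_natSum (hs a (Multiset.mem_cons_self a s)) ht,
      Multiset.card_cons, noExps_cons]
    nlinarith

/-- If the two norms exceed the numbers of terms by x and y, then `noExps_bind` leaves exactly xy as
the slack in this inequality. -/
theorem no_natProd_le {α β : Ordinal.{0}} (hα : α < ε₀) (hβ : β < ε₀) :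
    no (natProd α β) ≤ no α * no β := by
  rw [no_eq_noExps (natProd_lt_epsilon hα hβ), exps_natProd, no_eq_noExps hα, no_eq_noExps hβ]
  have := noExps_bind (lt_epsilon_zero_iff.1 hα) (lt_epsilon_zero_iff.1 hβ)
  obtain ⟨x, hx⟩ := Nat.exists_eq_add_of_le (card_le_noExps (exps α))
  obtain ⟨y, hy⟩ := Nat.exists_eq_add_of_le (card_le_noExps (exps β))
  rw [hx, hy] at this ⊢
  nlinarith [Nat.zero_le (x * y)]

theorem le_no_natProd {α β : Ordinal.{0}} (hα : α < ε₀) (hβ : β < ε₀) (h0 : β ≠ 0) :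
    no α ≤ no (natProd α β) := by
  rw [no_eq_noExps (natProd_lt_epsilon hα hβ), exps_natProd, no_eq_noExps hα]
  have := noExps_bind (lt_epsilon_zero_iff.1 hα) (lt_epsilon_zero_iff.1 hβ)
  obtain ⟨y, hy⟩ := Nat.exists_eq_add_of_le (card_le_noExps (exps β))
  have h1 : 1 ≤ (exps β).card := Multiset.card_pos.2 (exps_ne_zero h0)
  rw [hy] at this
  obtain ⟨z, hz⟩ := Nat.exists_eq_add_of_le h1
  rw [hz] at this
  nlinarith [Nat.zero_le (z * noExps (exps α)), Nat.zero_le ((exps α).card * y)]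

theorem no_sub_one {γ : Ordinal.{0}} (h : γ ≠ 0) :
    no (γ - 1) ≤ no γ ∧ no γ ≤ no (γ - 1) + 1 := by
  rcases lt_or_ge γ ω with hlt | hge
  · obtain ⟨n, rfl⟩ := lt_omega0.1 hlt
    obtain ⟨m, rfl⟩ := Nat.exists_eq_succ_of_ne_zero (n := n) (fun h0 => h (by rw [h0]; simp))
    have : ((m.succ : ℕ) : Ordinal.{0}) - 1 = (m : ℕ) := by
      rw [Nat.succ_eq_one_add, Nat.cast_add, Nat.cast_one, Ordinal.add_sub_cancel]
    rw [this, no_natCast, no_natCast]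
    omega
  · have : γ - 1 = γ := by
      conv_lhs => rw [← one_add_of_omega0_le hge]
      rw [Ordinal.add_sub_cancel]
    rw [this]
    omega

theorem leftHalf_lt_epsilon {α : Ordinal.{0}} (hα : α < ε₀) : leftHalf α < ε₀ := by
  rw [lt_epsilon_zero_iff, leftHalf, exps_ofExps]
  intro a ha
  obtain ⟨γ, hγ, rfl⟩ := Multiset.mem_map.1 ha
  exact (Ordinal.sub_le_self γ 1).trans_lt
    (lt_epsilon_zero_iff.1 hα γ (Multiset.mem_filter.1 hγ).1)

/-- Lowering a nonzero exponent by 1 on the left loses at most one unit of norm, so the contribution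
no(γ) + 1 is at most halved. The exponents 0 contribute one unit each. -/
theorem no_leftHalf {α : Ordinal.{0}} (hα : α < ε₀) :
    no (leftHalf α) + (exps α).count 0 ≤ no α ∧
      no α ≤ 2 * no (leftHalf α) + (exps α).count 0 := by
  have h0 : no 0 = 0 := by simpa using no_natCast 0
  rw [no_eq_noExps (leftHalf_lt_epsilon hα), no_eq_noExps hα, leftHalf, exps_ofExps]
  generalize exps α = s
  induction s using Multiset.induction_on with
  | empty => simp
  | cons a s ih =>
    by_cases ha : a = 0
    · subst ha
      rw [Multiset.filter_cons_of_neg (p := (· ≠ 0)) _ (by simp), Multiset.count_cons_self,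
        noExps_cons, h0]
      omega
    · rw [Multiset.filter_cons_of_pos (p := (· ≠ 0)) _ ha,
        Multiset.count_cons_of_ne (Ne.symm ha), noExps_cons, Multiset.map_cons, noExps_cons]
      have := no_sub_one ha
      omega

theorem no_two_opow {α : Ordinal.{0}} (hα : α < ε₀) :
    no (2 ^ α) = 2 ^ (exps α).count 0 * (no (leftHalf α) + 1) ∧ (2 : Ordinal.{0}) ^ α < ε₀ := by
  have h : (2 : Ordinal.{0}) ^ α < ε₀ := by
    rw [lt_epsilon_zero_iff, exps_two_opow]
    intro a ha
    rw [Multiset.eq_of_mem_replicate ha]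
    exact leftHalf_lt_epsilon hα
  exact ⟨by rw [no_eq_noExps h, exps_two_opow, noExps_replicate], h⟩

/-- An ordinal of norm at most k + 1 has at most k + 1 exponents, each of norm at most k. Its
multiset of exponents therefore lies below the (k+1)-fold multiple of one finite set, and only
finitely many multisets do. The finiteness makes the supremum defining ψ a maximum. -/
theorem finite_no_le (k : ℕ) : {α : Ordinal.{0} | α < ε₀ ∧ no α ≤ k}.Finite := by
  classical
  induction k with
  | zero =>
    refine (Set.finite_singleton (0 : Ordinal.{0})).subset fun α hα => ?_
    have h := hα.2
    rw [no_eq_noExps hα.1] at h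
    have := card_le_noExps (exps α)
    exact exps_injective ((Multiset.card_eq_zero.1 (by omega)).trans exps_zero.symm)
  | succ k ih =>
    refine Set.Finite.of_finite_image
      ((Set.finite_Iic ((k + 1) • ih.toFinset.val)).subset ?_) exps_injective.injOn
    rintro _ ⟨α, ⟨hα, hk⟩, rfl⟩
    rw [no_eq_noExps hα] at hk
    rw [Set.mem_Iic, Multiset.le_iff_count]
    intro a
    by_cases ha : a ∈ exps α
    · have hmem : a ∈ ih.toFinset := by
        rw [Set.Finite.mem_toFinset]
        exact ⟨lt_epsilon_zero_iff.1 hα a ha, by have := no_lt_noExps ha; omega⟩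
      rw [Multiset.count_nsmul, Multiset.count_eq_one_of_mem ih.toFinset.nodup hmem]
      have := Multiset.count_le_card a (exps α)
      have := card_le_noExps (exps α)
      omega
    · rw [Multiset.count_eq_zero.2 ha]
      exact Nat.zero_le _

namespace NatOrd

/-- The ordinals below `ε₀`. -/
def Below (a : NatOrd) : Prop := a.ord < ε₀

/-- The norm. -/
noncomputable def no (a : NatOrd) : ℕ := GodelT.no a.ord

theorem Below.add {a b : NatOrd} (ha : Below a) (hb : Below b) : Below (a + b) :=
  natSum_lt_epsilon ha hb

theorem Below.mul {a b : NatOrd} (ha : Below a) (hb : Below b) : Below (a * b) :=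
  natProd_lt_epsilon ha hb

theorem Below.exp {a : NatOrd} (ha : Below a) : Below (exp a) := (no_two_opow ha).2

theorem below_natCast (n : ℕ) : Below n := natCast_lt_epsilon n

theorem below_omega : Below omega := by
  refine lt_epsilon_zero_iff.2 ?_
  rw [omega, exps_omega0]
  intro a ha
  rw [Multiset.mem_singleton.1 ha]
  simpa using natCast_lt_epsilon 1

theorem below_zero : Below 0 := by simpa using below_natCast 0

theorem below_one : Below 1 := by simpa using below_natCast 1

theorem Below.of_le {a b : NatOrd} (h : a ≤ b) (hb : Below b) : Below a := lt_of_le_of_lt h hb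

@[simp] theorem no_nat (n : ℕ) : no n = n := no_natCast n

@[simp] theorem no_zero : no 0 = 0 := by simpa using no_nat 0

@[simp] theorem no_one : no 1 = 1 := by simpa using no_nat 1

theorem no_omega : no omega = 2 := by
  unfold no
  rw [no_eq_noExps below_omega, omega, exps_omega0]
  have := no_natCast 1
  rw [Nat.cast_one] at this
  simp [noExps, this]

theorem no_add {a b : NatOrd} (ha : Below a) (hb : Below b) : no (a + b) = no a + no b :=
  no_natSum ha hb

theorem no_mul_le {a b : NatOrd} (ha : Below a) (hb : Below b) : no (a * b) ≤ no a * no b :=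
  no_natProd_le ha hb

theorem le_no_mul {a b : NatOrd} (ha : Below a) (hb : Below b) (h : 1 ≤ b) :
    no a ≤ no (a * b) :=
  le_no_natProd ha hb fun h0 => by
    rw [one_le_iff, lt_def, h0] at h
    exact lt_irrefl _ h

theorem no_exp_le {a : NatOrd} (ha : Below a) : no (exp a) ≤ 4 ^ no a := by
  have h1 := (no_two_opow ha).1
  have h2 := (no_leftHalf ha).1
  change GodelT.no (2 ^ a.ord) ≤ 4 ^ GodelT.no a.ord
  rw [h1, show 4 = 2 * 2 by rfl, mul_pow]
  refine Nat.mul_le_mul (Nat.pow_le_pow_right two_pos (by omega)) ?_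
  have := Nat.lt_two_pow_self (n := GodelT.no (leftHalf a.ord))
  have := Nat.pow_le_pow_right two_pos (show GodelT.no (leftHalf a.ord) ≤ GodelT.no a.ord by omega)
  omega

theorem no_le_two_mul_no_exp {a : NatOrd} (ha : Below a) : no a ≤ 2 * no (exp a) := by
  have h1 := (no_two_opow ha).1
  have h2 := (no_leftHalf ha).2
  change GodelT.no a.ord ≤ 2 * GodelT.no (2 ^ a.ord)
  rw [h1]
  have := Nat.lt_two_pow_self (n := (exps a.ord).count 0)
  nlinarith [Nat.zero_le (GodelT.no (leftHalf a.ord))]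

theorem one_le_no {a : NatOrd} (ha : Below a) (h : 1 ≤ a) : 1 ≤ no a := by
  change 1 ≤ GodelT.no a.ord
  rw [no_eq_noExps ha]
  refine (Multiset.card_pos.2 (exps_ne_zero fun h0 => ?_)).trans_le (card_le_noExps _)
  rw [one_le_iff, lt_def, h0] at h
  exact lt_irrefl _ h

end NatOrd

end GodelT

namespace GodelT

/-! # Growth of the hierarchy `F` -/

theorem lt_F (n x : ℕ) : x < F n x := by
  induction n generalizing x with
  | zero => exact Nat.lt_two_pow_self
  | succ n ih =>
    have : ∀ k y, y < (F n)^[k + 1] y := by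
      intro k
      induction k with
      | zero => exact ih
      | succ k ihk =>
        intro y
        rw [Function.iterate_succ_apply']
        exact (ihk y).trans (ih _)
    exact this x x

theorem F_iterate_mono {n : ℕ} {k l x : ℕ} (h : k ≤ l) : (F n)^[k] x ≤ (F n)^[l] x :=
  Function.monotone_iterate_of_id_le (fun y => (lt_F n y).le) h x

theorem F_mono (n : ℕ) : Monotone (F n) := by
  induction n with
  | zero => exact fun x y h => Nat.pow_le_pow_right two_pos h
  | succ n ih =>
    intro x y h
    exact (F_iterate_mono (by omega)).trans (ih.iterate (y + 1) h)

theorem F_iterate_le {n k x : ℕ} (h : k ≤ x + 1) : (F n)^[k] x ≤ F (n + 1) x :=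
  F_iterate_mono h

theorem F_le_F {m n : ℕ} (h : m ≤ n) (x : ℕ) : F m x ≤ F n x := by
  induction n, h using Nat.le_induction with
  | base => exact le_rfl
  | succ n _ ih => exact ih.trans (F_iterate_le (k := 1) (by omega))

theorem two_pow_le_F (n x : ℕ) : 2 ^ x ≤ F n x := F_le_F (Nat.zero_le n) x

theorem F_succ_add_two_le (n x : ℕ) (h : 1 ≤ x) : F (n + 1) x + 2 ≤ F (n + 1) (x + 1) := by
  have h1 : F (n + 1) (x + 1) = F n ((F n)^[x + 1] (x + 1)) :=
    Function.iterate_succ_apply' (F n) (x + 1) (x + 1)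
  have h2 : F (n + 1) x ≤ (F n)^[x + 1] (x + 1) := (F_mono n).iterate (x + 1) (Nat.le_succ x)
  have h3 := (two_pow_le_F n _).trans (F_mono n h2)
  have h4 : ∀ y, 2 ≤ y → y + 2 ≤ 2 ^ y := by
    intro y hy
    induction y, hy using Nat.le_induction with
    | base => norm_num
    | succ y _ ih => rw [pow_succ]; omega
  have h5 := lt_F (n + 1) x
  rw [h1]
  exact (h4 _ (by omega)).trans h3

/-- Slope 2, rather than 1, is what `psi_add_psi_le` needs. -/
theorem Phi_add (x y : ℕ) : Phi x + 2 * y ≤ Phi (x + y) := by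
  induction y with
  | zero => simp
  | succ y ih =>
    have : F 5 (x + y + 100) + 2 ≤ F 5 (x + y + 100 + 1) :=
      F_succ_add_two_le 4 (x + y + 100) (by omega)
    rw [show x + y + 100 + 1 = x + (y + 1) + 100 by ring] at this
    unfold Phi at *
    omega

theorem Phi_mono : Monotone Phi := fun x y h => by
  obtain ⟨z, rfl⟩ := Nat.exists_eq_add_of_le h
  have := Phi_add x z
  omega

theorem lt_Phi (x : ℕ) : x + 100 < Phi x := lt_F 5 (x + 100)

theorem F_two_iterate_le_Phi {x y : ℕ} (h : x ≤ y + 100) : (F 2)^[9] x ≤ Phi y :=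
  ((F_mono 2).iterate 9 h).trans
    ((F_iterate_le (by omega)).trans (F_le_F (by norm_num) _))

namespace NatOrd

/-! # The collapsing function -/

/-- The collapsing function. -/
noncomputable def collapse (a : NatOrd) : ℕ := GodelT.psi a.ord

theorem psi_set_finite {b : NatOrd} (hb : Below b) :
    ({0} ∪ {n | ∃ β, ∃ _h : β < b.ord, GodelT.no β ≤ Phi (GodelT.no b.ord) ∧
      n = GodelT.psi β + 1}).Finite := by
  refine (Set.finite_singleton 0).union
    (((GodelT.finite_no_le (Phi (GodelT.no b.ord))).image fun β => GodelT.psi β + 1).subset ?_)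
  rintro n ⟨β, hβ, hn, rfl⟩
  exact ⟨β, ⟨lt_trans hβ hb, hn⟩, rfl⟩

theorem psi_lt {a b : NatOrd} (hb : Below b) (h : a < b) (hn : no a ≤ Phi (no b)) :
    collapse a < collapse b := by
  rw [collapse, collapse, GodelT.psi.eq_1 b.ord]
  exact Nat.lt_of_succ_le
    (le_csSup (psi_set_finite hb).bddAbove (Or.inr ⟨a.ord, h, hn, rfl⟩))

theorem psi_le {a b : NatOrd} (hb : Below b) (h : a ≤ b) (hn : no a ≤ Phi (no b)) :
    collapse a ≤ collapse b := by
  rcases h.eq_or_lt with rfl | h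
  · exact le_rfl
  · exact (psi_lt hb h hn).le

/-- The defining set is finite and nonempty, so its supremum belongs to it. -/
theorem psi_eq_zero_or {b : NatOrd} (hb : Below b) :
    collapse b = 0 ∨ ∃ a < b, no a ≤ Phi (no b) ∧ collapse b = collapse a + 1 := by
  have := Nat.sSup_mem (Set.singleton_nonempty 0 |>.inl) (psi_set_finite hb).bddAbove
  rw [← GodelT.psi.eq_1] at this
  rcases this with h | ⟨β, hβ, hn, h⟩
  · exact Or.inl h
  · exact Or.inr ⟨⟨β⟩, hβ, hn, h⟩

theorem psi_add_nat_le {a : NatOrd} (ha : Below a) (k : ℕ) : collapse a + k ≤ collapse (a + k) := by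
  induction k with
  | zero => simp
  | succ k ih =>
    have hk := ha.add (below_natCast k)
    have hk' := ha.add (below_natCast (k + 1))
    have : collapse (a + k) < collapse (a + (k + 1 : ℕ)) := by
      refine psi_lt hk' ?_ ?_
      · rw [Nat.cast_succ, ← add_assoc]
        exact lt_add_one_iff.2 le_rfl
      · rw [no_add ha (below_natCast k), no_add ha (below_natCast (k + 1))]
        have := lt_Phi (no a + no ((k + 1 : ℕ) : NatOrd))
        simp only [no_nat] at *
        omega
    omega

theorem psi_nat (n : ℕ) : collapse n = n := by
  induction n using Nat.strong_induction_on with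
  | _ n ih =>
    apply le_antisymm
    · rcases psi_eq_zero_or (below_natCast n) with h | ⟨a, ha, _, h⟩
      · omega
      · obtain ⟨m, rfl⟩ := lt_omega_iff.1 (ha.trans (natCast_lt_omega n))
        have hm := Nat.cast_lt.1 ha
        rw [h, ih m hm]
        omega
    · have := psi_add_nat_le below_zero n
      rw [zero_add] at this
      omega

/-- Unfold ψ(b) as ψ(c) + 1 with c < b. Then a + ψ(b) = (a + 1) + ψ(c), and the induction hypothesis
for c, with a + 1 in place of a, bounds its collapse by ψ(a + 1 + c), where a + 1 + c ≤ a + b. -/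
theorem psi_add_psi_le {a b : NatOrd} (ha : Below a) (hb : Below b) :
    collapse (a + collapse b) ≤ collapse (a + b) := by
  induction b using WellFoundedLT.induction generalizing a with
  | _ b ih =>
    have hab := ha.add hb
    rcases psi_eq_zero_or hb with h | ⟨c, hc, hn, h⟩
    · rw [h, Nat.cast_zero, add_zero]
      refine psi_le hab (le_add_of_nonneg_right (NatOrd.zero_le b)) ?_
      rw [no_add ha hb]
      have := lt_Phi (no a + no b)
      omega
    · rcases (NatOrd.zero_le a).eq_or_lt with rfl | h0
      · rw [zero_add, zero_add, psi_nat]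
      · have hc' : Below c := hb.of_le hc.le
        have ha1 := ha.add below_one
        have h1 := ih c hc ha1 hc'
        have h2 : a + (collapse b : NatOrd) = a + 1 + collapse c := by
          rw [h, Nat.cast_succ]
          ring
        rw [h2]
        refine h1.trans (psi_le hab ?_ ?_)
        · calc a + 1 + c = a + (c + 1) := by ring
            _ ≤ a + b := by gcongr; exact add_one_le_iff.2 hc
        -- The norm no(a) + 1 + no(c) is at most 2 · no(a) + Φ(no(b)), because a ≠ 0 has norm at
        -- least 1. The slope of Φ absorbs the term 2 · no(a).
        · rw [no_add ha1 hc', no_add ha below_one, no_add ha hb, no_one]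
          have := one_le_no ha (one_le_iff.2 h0)
          have := Phi_add (no b) (no a)
          rw [add_comm (no b)] at this
          omega

theorem psi_add_le {a b : NatOrd} (ha : Below a) (hb : Below b) :
    collapse a + collapse b ≤ collapse (a + b) :=
  (psi_add_nat_le ha _).trans (psi_add_psi_le ha hb)

theorem omega_mul_add_lt {a b : NatOrd} (h : a < b) (m : ℕ) (c : NatOrd) :
    omega * a + m < omega * b + c :=
  calc omega * a + m < omega * a + omega := by gcongr; exact natCast_lt_omega m
    _ = omega * (a + 1) := by ring
    _ ≤ omega * b :=
      mul_le_mul_of_nonneg_left (add_one_le_iff.2 h) (NatOrd.zero_le _)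
    _ ≤ omega * b + c := le_add_of_nonneg_right (NatOrd.zero_le c)

theorem no_omega_mul_le {a : NatOrd} (ha : Below a) : no (omega * a) ≤ 2 * no a := by
  have := no_mul_le below_omega ha
  rwa [no_omega] at this

theorem le_no_omega_mul {a : NatOrd} (ha : Below a) : no a ≤ no (omega * a) := by
  rw [mul_comm]
  exact le_no_mul ha below_omega one_le_omega

theorem below_collapse {a : NatOrd} (ha : Below a) (m : ℕ) : Below (omega * a + m) :=
  (below_omega.mul ha).add (below_natCast m)

theorem no_collapse_le {a : NatOrd} (ha : Below a) (m : ℕ) :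
    no (omega * a + m) ≤ 2 * no a + m := by
  rw [no_add (below_omega.mul ha) (below_natCast m), no_nat]
  have := no_omega_mul_le ha
  omega

theorem le_no_collapse {a : NatOrd} (ha : Below a) (m : ℕ) :
    no a + m ≤ no (omega * a + m) := by
  rw [no_add (below_omega.mul ha) (below_natCast m), no_nat]
  have := le_no_omega_mul ha
  omega

/-- The number k is fixed by ψ, is its own norm, and lies below ω ≤ ω·a + m. This is how component 0
of a vector comes to dominate the norms of the other components. -/
theorem lt_psi_of_le_Phi {a : NatOrd} (ha : Below a) (h1 : 1 ≤ a) {k m : ℕ} (hk : k ≤ Phi m) :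
    k < collapse (omega * a + m) := by
  have hlt : (k : NatOrd) < omega * a + m := by
    have := omega_mul_add_lt (one_le_iff.1 h1) k m
    rwa [mul_zero, zero_add] at this
  have := psi_lt (below_collapse ha m) hlt (by
    rw [no_nat]
    exact hk.trans (Phi_mono (by have := le_no_collapse ha m; omega)))
  rwa [psi_nat] at this

end NatOrd

end GodelT

namespace GodelT

/-! # Towers of exponentials -/

/-- Exponential functions on ordered semirings. -/
structure IsExp {K : Type*} [CommSemiring K] [LinearOrder K] (e : K → K) : Prop where
  nonneg : ∀ a : K, 0 ≤ a
  mono : Monotone e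
  add : ∀ a b, e (a + b) = e a * e b
  zero : e 0 = 1
  one : 2 ≤ e 1

/-- `tower e f g k i` is `e (e (⋯) · (fᵢ₊₁ + gᵢ₊₁)) · (fᵢ + gᵢ)` with `k` nested exponentials. -/
def tower {K : Type*} [CommSemiring K] (e : K → K) (f g : ℕ → K) : ℕ → ℕ → K
  | 0, i => f i
  | k + 1, i => e (tower e f g k (i + 1)) * (f i + g i)

section Tower

variable {K : Type*} [CommSemiring K] [LinearOrder K] {e : K → K}

theorem IsExp.one_le (he : IsExp e) (a : K) : 1 ≤ e a := by
  rw [← he.zero]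
  exact he.mono (he.nonneg a)

theorem IsExp.two_le (he : IsExp e) {a : K} (h : 1 ≤ a) : 2 ≤ e a :=
  he.one.trans (he.mono h)

variable [IsStrictOrderedRing K]

theorem add_le_mul_of_two_le {a b : K} (h0 : ∀ a : K, 0 ≤ a) (ha : 2 ≤ a) (hb : 2 ≤ b) :
    a + b ≤ a * b := by
  rcases le_total a b with h | h
  · calc a + b ≤ b + b := by gcongr
      _ = 2 * b := by ring
      _ ≤ a * b := mul_le_mul_of_nonneg_right ha (h0 b)
  · calc a + b ≤ a + a := by gcongr
      _ = a * 2 := by ring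
      _ ≤ a * b := mul_le_mul_of_nonneg_left hb (h0 a)

theorem IsExp.add_le (he : IsExp e) {a b : K} (ha : 1 ≤ a) (hb : 1 ≤ b) :
    e a + e b ≤ e (a + b) := by
  rw [he.add]
  exact add_le_mul_of_two_le he.nonneg (he.two_le ha) (he.two_le hb)

theorem mul_le_mul_of_nn (h0 : ∀ a : K, 0 ≤ a) {a b c d : K} (h : a ≤ b) (h' : c ≤ d) :
    a * c ≤ b * d :=
  mul_le_mul h h' (h0 c) (h0 b)

theorem tower_mono (he : IsExp e) {f f' g g' : ℕ → K} {k i : ℕ}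
    (hf : ∀ j, i ≤ j → j ≤ i + k → f j ≤ f' j) (hg : ∀ j, i ≤ j → j < i + k → g j ≤ g' j) :
    tower e f g k i ≤ tower e f' g' k i := by
  induction k generalizing i with
  | zero => exact hf i le_rfl le_rfl
  | succ k ih =>
    refine mul_le_mul_of_nn he.nonneg (he.mono (ih ?_ ?_))
      (add_le_add (hf i le_rfl (by omega)) (hg i le_rfl (by omega)))
    · exact fun j h1 h2 => hf j (by omega) (by omega)
    · exact fun j h1 h2 => hg j (by omega) (by omega)

theorem le_tower (he : IsExp e) (f g : ℕ → K) (k i : ℕ) : f i ≤ tower e f g k i := by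
  cases k with
  | zero => exact le_rfl
  | succ k =>
    calc f i ≤ f i + g i := le_add_of_nonneg_right (he.nonneg _)
      _ = 1 * (f i + g i) := (one_mul _).symm
      _ ≤ _ := mul_le_mul_of_nn he.nonneg (he.one_le _) le_rfl

theorem add_le_tower_succ (he : IsExp e) (f g : ℕ → K) (k i : ℕ) :
    f i + g i ≤ tower e f g (k + 1) i := by
  calc f i + g i = 1 * (f i + g i) := (one_mul _).symm
    _ ≤ _ := mul_le_mul_of_nn he.nonneg (he.one_le _) le_rfl

theorem two_mul_le_tower_succ (he : IsExp e) {f g : ℕ → K} {k i : ℕ} (hf : 1 ≤ f (i + 1)) :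
    2 * (f i + g i) ≤ tower e f g (k + 1) i :=
  mul_le_mul_of_nn he.nonneg (he.two_le (hf.trans (le_tower he f g k (i + 1)))) le_rfl

theorem lt_tower_of_lt (he : IsExp e) {f g : ℕ → K} {k i : ℕ} {a : K} (h : a < f i) :
    a < tower e f g k i :=
  h.trans_le (le_tower he f g k i)

/-- For exponents at least 1 one has e(a) + e(b) ≤ 2-fold products e(a) · e(b) = e(a + b), as both
factors are at least 2. So a sum of towers over the same g is absorbed by adding up f alone. This
superadditivity drives the estimates for δˣ. -/
theorem tower_add (he : IsExp e) {f f' g : ℕ → K} {i : ℕ} (hf : ∀ j, i ≤ j → 1 ≤ f j)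
    (hf' : ∀ j, i ≤ j → 1 ≤ f' j) (k : ℕ) :
    tower e f g k i + tower e f' g k i ≤ tower e (fun j => f j + f' j) g k i := by
  induction k generalizing i with
  | zero => exact le_rfl
  | succ k ih =>
    set P := tower e f g k (i + 1)
    set P' := tower e f' g k (i + 1)
    have hP : 1 ≤ P := (hf _ (by omega)).trans (le_tower he _ _ _ _)
    have hP' : 1 ≤ P' := (hf' _ (by omega)).trans (le_tower he _ _ _ _)
    change e P * (f i + g i) + e P' * (f' i + g i) ≤ e _ * (f i + f' i + g i)
    calc e P * (f i + g i) + e P' * (f' i + g i)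
        ≤ e P * (f i + f' i + g i) + e P' * (f i + f' i + g i) := by
          refine add_le_add (mul_le_mul_of_nn he.nonneg le_rfl ?_)
            (mul_le_mul_of_nn he.nonneg le_rfl ?_)
          · gcongr
            exact le_add_of_nonneg_right (he.nonneg _)
          · gcongr
            exact le_add_of_nonneg_left (he.nonneg _)
      _ = (e P + e P') * (f i + f' i + g i) := by ring
      _ ≤ _ := mul_le_mul_of_nn he.nonneg ((he.add_le hP hP').trans (he.mono
        (ih (fun j hj => hf j (by omega)) (fun j hj => hf' j (by omega))))) le_rfl

end Tower

theorem isExp_four_pow : IsExp (fun n : ℕ => 4 ^ n) where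
  nonneg := Nat.zero_le
  mono := fun _ _ h => Nat.pow_le_pow_right (by norm_num) h
  add := pow_add 4
  zero := pow_zero 4
  one := by norm_num

theorem NatOrd.isExp_exp : IsExp NatOrd.exp where
  nonneg := NatOrd.zero_le
  mono := NatOrd.exp_strictMono.monotone
  add := NatOrd.exp_add
  zero := NatOrd.exp_zero
  one := NatOrd.exp_one.ge

/-! ## Norms of towers -/

namespace NatOrd

theorem below_tower {f g : ℕ → NatOrd} (hf : ∀ j, Below (f j)) (hg : ∀ j, Below (g j))
    (k i : ℕ) : Below (tower NatOrd.exp f g k i) := by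
  induction k generalizing i with
  | zero => exact hf i
  | succ k ih => exact (ih (i + 1)).exp.mul ((hf i).add (hg i))

theorem no_tower_le {f g : ℕ → NatOrd} (hf : ∀ j, Below (f j)) (hg : ∀ j, Below (g j))
    (k i : ℕ) : no (tower NatOrd.exp f g k i) ≤
      tower (fun n : ℕ => 4 ^ n) (fun j => no (f j)) (fun j => no (g j)) k i := by
  induction k generalizing i with
  | zero => exact le_rfl
  | succ k ih =>
    have hb := below_tower hf hg k (i + 1)
    refine (no_mul_le hb.exp ((hf i).add (hg i))).trans ?_
    rw [no_add (hf i) (hg i)]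
    exact Nat.mul_le_mul_right _
      ((no_exp_le hb).trans (Nat.pow_le_pow_right (by norm_num) (ih (i + 1))))

end NatOrd

theorem F_zero_iterate_eq (k x : ℕ) : (F 0)^[k + 1] x = 2 ^ ((F 0)^[k] x) :=
  Function.iterate_succ_apply' (F 0) k x

theorem three_mul_le (q : ℕ) (h : 2 ≤ q) : 3 * q ≤ 2 ^ 2 ^ q := by
  have h1 : ∀ q, 2 ≤ q → 3 * q ≤ 2 ^ (q + 1) := by
    intro q hq
    induction q, hq using Nat.le_induction with
    | base => norm_num
    | succ q _ ih => rw [pow_succ]; omega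
  exact (h1 q h).trans (Nat.pow_le_pow_right two_pos Nat.lt_two_pow_self)

/-- Each level costs three exponentials: 4^Q · (f + g) ≤ 2^(2Q) · 2^Q = 2^(3Q), and 3Q ≤ 2^(2^Q) for
Q ≥ 2. -/
theorem tower_four_le_iterate {f g : ℕ → ℕ} {M k i : ℕ} (hM : 2 ≤ M)
    (hf : ∀ j, i ≤ j → j ≤ i + k → f j ≤ M)
    (hg : ∀ j, i ≤ j → j < i + k → f j + g j ≤ M) :
    tower (fun n : ℕ => 4 ^ n) f g k i ≤ (F 0)^[3 * k] M := by
  induction k generalizing i with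
  | zero => exact hf i le_rfl le_rfl
  | succ k ih =>
    set Q := (F 0)^[3 * k] M with hQ
    have hMQ : M ≤ Q := F_iterate_mono (Nat.zero_le (3 * k))
    have h1 : tower (fun n : ℕ => 4 ^ n) f g k (i + 1) ≤ Q :=
      ih (fun j h1 h2 => hf j (by omega) (by omega)) (fun j h1 h2 => hg j (by omega) (by omega))
    have h2 : (F 0)^[3 * (k + 1)] M = 2 ^ 2 ^ 2 ^ Q := by
      rw [show 3 * (k + 1) = 3 * k + 1 + 1 + 1 by ring]
      simp only [F_zero_iterate_eq]
      rfl
    rw [h2]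
    calc 4 ^ tower (fun n : ℕ => 4 ^ n) f g k (i + 1) * (f i + g i)
        ≤ 4 ^ Q * 2 ^ Q :=
          Nat.mul_le_mul (Nat.pow_le_pow_right (by norm_num) h1)
            ((hg i le_rfl (by omega)).trans (hMQ.trans Nat.lt_two_pow_self.le))
      _ = 2 ^ (3 * Q) := by
          rw [show 4 = 2 ^ 2 by rfl, ← pow_mul, ← pow_add]
          congr 1
          ring
      _ ≤ 2 ^ 2 ^ 2 ^ Q := Nat.pow_le_pow_right two_pos (three_mul_le Q (hM.trans hMQ))

/-- As the height is at most M, the 3k exponentials fit into three blocks of M + 1. Each block is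
one application of F₁ to an argument at least M, and three applications of F₁ fit into F₂(M) since M
≥ 2. -/
theorem tower_four_le {f g : ℕ → ℕ} {M k i : ℕ} (hM : 2 ≤ M) (hk : k ≤ M)
    (hf : ∀ j, i ≤ j → j ≤ i + k → f j ≤ M)
    (hg : ∀ j, i ≤ j → j < i + k → f j + g j ≤ M) :
    tower (fun n : ℕ => 4 ^ n) f g k i ≤ F 2 M := by
  have h1 : ∀ n y, (F 0)^[n * (M + 1)] y ≤ (F 1)^[n] (max M y) := by
    intro n
    induction n with
    | zero => intro y; simp
    | succ n ih =>
      intro y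
      rw [Nat.succ_mul, Nat.add_comm, Function.iterate_add_apply,
        Function.iterate_succ_apply' (F 1)]
      refine ((F_mono 0).iterate _ (ih y)).trans (F_iterate_le (n := 0) (k := M + 1) ?_)
      · have : max M y ≤ (F 1)^[n] (max M y) := F_iterate_mono (Nat.zero_le n)
        omega
  calc _ ≤ (F 0)^[3 * k] M := tower_four_le_iterate hM hf hg
    _ ≤ (F 0)^[3 * (M + 1)] M := F_iterate_mono (by omega)
    _ ≤ (F 1)^[3] M := by simpa using h1 3 M
    _ ≤ F 2 M := F_iterate_le (by omega)

namespace NatOrd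

/-- The norm of a tower is controlled by bounds for the norms of its entries. -/
theorem no_tower_le_F {f g : ℕ → NatOrd} (hf : ∀ j, Below (f j)) (hg : ∀ j, Below (g j))
    {M k i : ℕ} (hM : 2 ≤ M) (hk : k ≤ M)
    (hfM : ∀ j, i ≤ j → j ≤ i + k → no (f j) ≤ M)
    (hgM : ∀ j, i ≤ j → j < i + k → no (f j) + no (g j) ≤ M) :
    no (tower NatOrd.exp f g k i) ≤ F 2 M :=
  (no_tower_le hf hg k i).trans (tower_four_le hM hk hfM hgM)

/-- The norm of a tower controls the norms of its entries. -/
theorem no_le_two_pow_mul_no_tower {f g : ℕ → NatOrd} (hf : ∀ j, Below (f j))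
    (hg : ∀ j, Below (g j)) (k i j : ℕ) (h1 : ∀ j, i ≤ j → 1 ≤ f j) (hij : i ≤ j) (hj : j ≤ i + k) :
    no (f j) + (if j < i + k then no (g j) else 0) ≤ 2 ^ k * no (tower NatOrd.exp f g k i) := by
  induction k generalizing i with
  | zero =>
    obtain rfl : j = i := by omega
    simp [tower]
  | succ k ih =>
    have hb := below_tower hf hg k (i + 1)
    have hfg := (hf i).add (hg i)
    have hpos : 1 ≤ f i + g i := (h1 i le_rfl).trans (le_add_of_nonneg_right (NatOrd.zero_le _))
    change _ ≤ 2 ^ (k + 1) * no (NatOrd.exp (tower NatOrd.exp f g k (i + 1)) * (f i + g i))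
    rcases hij.eq_or_lt with rfl | hij
    · rw [if_pos (by omega), ← no_add (hf i) (hg i)]
      have h2 := le_no_mul hfg hb.exp (isExp_exp.one_le _)
      rw [mul_comm] at h2
      exact h2.trans (Nat.le_mul_of_pos_left _ (by positivity))
    -- For an entry higher up, passing from an exponent to its exponential loses at most a factor 2,
    -- which accounts for the 2^k. The multiplier f i + g i loses nothing because it is at least 1.
    · have h2 := ih (i + 1) (fun j hj => h1 j (by omega)) hij (by omega)
      rw [show i + 1 + k = i + (k + 1) by ring] at h2
      have h3 := no_le_two_mul_no_exp hb
      have h4 := le_no_mul hb.exp hfg hpos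
      calc _ ≤ 2 ^ k * no (tower NatOrd.exp f g k (i + 1)) := h2
        _ ≤ 2 ^ k * (2 * no (NatOrd.exp (tower NatOrd.exp f g k (i + 1)) * (f i + g i))) := by
            gcongr
            omega
        _ = _ := by ring

end NatOrd

end GodelT

namespace GodelT

open NatOrd (Below collapse psi_lt omega below_collapse no_collapse_le le_no_collapse
  omega_mul_add_lt lt_psi_of_le_Phi psi_add_nat_le psi_add_psi_le
  below_natCast below_tower no_tower_le_F
  isExp_exp)

-- Numerical margins between F₂ and Φ.

theorem F_two_le_Phi {x y : ℕ} (h : x ≤ y) : F 2 x ≤ Phi y :=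
  (F_iterate_mono (k := 1) (l := 9) (by norm_num)).trans (F_two_iterate_le_Phi (by omega))

/-- A bound for iterated applications of `F₂`, still far below `Φ`. -/
def normBound (x : ℕ) : ℕ := (F 2)^[8] (x + 100)

theorem add_le_normBound (x : ℕ) : x + 100 ≤ normBound x := F_iterate_mono (Nat.zero_le 8)

theorem F_two_le_normBound (x : ℕ) : F 2 x ≤ normBound x := by
  have h : (F 2)^[1] (x + 100) ≤ normBound x := F_iterate_mono (by norm_num)
  rw [Function.iterate_one] at h
  exact (F_mono 2 (Nat.le_add_right x 100)).trans h

theorem mul_le_two_pow {z : ℕ} (h : 100 ≤ z) : 20 * z ≤ 2 ^ z := by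
  induction z, h using Nat.le_induction with
  | base => norm_num
  | succ z _ ih => rw [pow_succ]; omega

/-- Needed for a tower whose entries are themselves towers, as in the reduct of an Rˢ-redex. -/
theorem F_two_add_F_two_le_normBound (x : ℕ) : F 2 (x + F 2 x) ≤ normBound x := by
  have h3 : (F 2)^[3] (x + 100) = F 2 (F 2 (F 2 (x + 100))) := by
    simp only [Function.iterate_succ_apply', Function.iterate_zero_apply]
  have h4 : (F 2)^[3] (x + 100) ≤ normBound x := F_iterate_mono (by norm_num)
  rw [h3] at h4
  refine le_trans (F_mono 2 (le_trans ?_ (two_pow_le_F 2 _))) h4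
  have h5 := lt_F 2 x
  have h6 := F_mono 2 (Nat.le_add_right x 100)
  have h7 := lt_F 2 (x + 100)
  have h8 := mul_le_two_pow (z := F 2 (x + 100)) (by omega)
  omega

/-- Needed when the entries of a tower are known only through the norm of another tower, which costs
the factor 2^x of `no_le_two_pow_mul_no_tower`. -/
theorem F_two_two_pow_mul_le_normBound (x : ℕ) : F 2 (2 ^ x * x + x + 2) ≤ normBound x := by
  have h3 : (F 2)^[4] (x + 100) = F 2 (F 2 (F 2 (F 2 (x + 100)))) := by
    simp only [Function.iterate_succ_apply', Function.iterate_zero_apply]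
  have h4 : (F 2)^[4] (x + 100) ≤ normBound x := F_iterate_mono (by norm_num)
  rw [h3] at h4
  refine (F_mono 2 (le_trans ?_ (two_pow_le_F 2 _))).trans h4
  have h5 : 2 ^ x ≤ 2 ^ (x + 100) := Nat.pow_le_pow_right two_pos (by omega)
  have h6 := two_pow_le_F 2 (x + 100)
  have h7 := lt_F 2 (x + 100)
  have h8 := (lt_F 2 (F 2 (x + 100))).le
  generalize F 2 (x + 100) = z at *
  calc 2 ^ x * x + x + 2 ≤ z * z + z + z := by
        have := Nat.mul_le_mul (h5.trans h6) (show x ≤ z by omega)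
        omega
    _ ≤ z * (20 * z) := by nlinarith
    _ ≤ 2 ^ z * 2 ^ z := Nat.mul_le_mul Nat.lt_two_pow_self.le (mul_le_two_pow (by omega))
    _ = 2 ^ (2 * z) := by rw [← pow_add]; ring_nf
    _ ≤ 2 ^ (2 ^ z) := by
        have := mul_le_two_pow (z := z) (by omega)
        exact Nat.pow_le_pow_right two_pos (by omega)
    _ ≤ 2 ^ F 2 z := Nat.pow_le_pow_right two_pos (two_pow_le_F 2 z)

/-- Φ has room for nine applications of F₂ and `normBound` uses eight of them. The spare one exceeds
multiplication by 20. -/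
theorem normBound_le_Phi {x y : ℕ} (h : x ≤ y) : 20 * normBound x ≤ Phi y := by
  have h1 : (F 2)^[9] (x + 100) = F 2 (normBound x) := Function.iterate_succ_apply' _ _ _
  have h2 := add_le_normBound x
  have h3 := F_two_iterate_le_Phi (show x + 100 ≤ y + 100 by omega)
  rw [h1] at h3
  exact (mul_le_two_pow (by omega)).trans ((two_pow_le_F 2 _).trans h3)

/-- Here strictness comes from the finite summand. This is the form used when component 0 of a
vector decreases and the tower does not grow. -/
theorem collapse_lt_of_le {a b : NatOrd} {m n : ℕ} (ha : Below a) (hb : Below b) (h : a ≤ b)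
    (hmn : m < n) (hn : a.no ≤ F 2 n) : collapse (omega * a + m) < collapse (omega * b + n) := by
  refine psi_lt (below_collapse hb n) ?_ ?_
  · exact add_lt_add_of_le_of_lt (mul_le_mul_of_nonneg_left h (NatOrd.zero_le _))
      (Nat.cast_lt.2 hmn)
  · have h1 := no_collapse_le ha m
    have h2 := le_no_collapse hb n
    have h3 := normBound_le_Phi (show n ≤ (omega * b + n).no by omega)
    have h4 := F_two_le_normBound n
    have h5 := add_le_normBound n
    omega

/-- Here strictness comes from the coefficient of ω, so the finite summand may even grow. The
constants fit because 2 · 3 + 14 = 20. -/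
theorem collapse_lt_of_lt {a b : NatOrd} {m n x : ℕ} (ha : Below a) (hb : Below b) (h : a < b)
    (hx : x ≤ b.no + n) (hm : m ≤ 14 * normBound x) (hn : a.no ≤ 3 * normBound x) :
    collapse (omega * a + m) < collapse (omega * b + n) := by
  refine psi_lt (below_collapse hb n) (omega_mul_add_lt h m n) ?_
  have h1 := no_collapse_le ha m
  have h2 := le_no_collapse hb n
  have h3 := normBound_le_Phi (show x ≤ (omega * b + n).no by omega)
  omega

theorem le_collapse {a : NatOrd} (ha : Below a) (m : ℕ) : m ≤ collapse (omega * a + m) := by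
  have := psi_add_nat_le (NatOrd.below_omega.mul ha) m
  omega

theorem add_lt_collapse {a : NatOrd} (ha : Below a) (h1 : 1 ≤ a) (m : ℕ) :
    m + 100 < collapse (omega * a + m) :=
  lt_psi_of_le_Phi ha h1 (lt_Phi m).le

/-! # Vectors of ordinals -/

/-- Vectors of ordinals below `ε₀` of the given level, which are positive and of bounded norm, and
the `0`-th component of which is finite. -/
structure Good (l : ℕ) (f : ℕ → NatOrd) : Prop where
  pos : ∀ i ≤ l, 1 ≤ f i
  below : ∀ i, Below (f i)
  nat : ∃ k : ℕ, f 0 = k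
  norm : ∀ i, (f i).no ≤ (f 0).no

/-- Comparison of vectors of ordinals. -/
def VLt (f g : ℕ → NatOrd) : Prop := f 0 < g 0 ∧ ∀ i, 0 < i → f i ≤ g i

/-- The operator `□` on vectors of ordinals, where `n` is the level of `g`. -/
noncomputable def vbox (f g : ℕ → NatOrd) (n : ℕ) (i : ℕ) : NatOrd :=
  if i = 0 then collapse (omega * tower NatOrd.exp f g n 1 + (f 0 + g 0 + n))
  else tower NatOrd.exp f g (n + 1 - i) i

/-- Truncation of vectors of ordinals. -/
noncomputable def vres (l : ℕ) (f : ℕ → NatOrd) (i : ℕ) : NatOrd := if i ≤ l then f i else 0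

theorem Good.no_zero_eq {l : ℕ} {f : ℕ → NatOrd} (hf : Good l f) :
    (((f 0).no : ℕ) : NatOrd) = f 0 := by
  obtain ⟨k, hk⟩ := hf.nat
  rw [hk, NatOrd.no_nat]

theorem Good.one_le_no_zero {l : ℕ} {f : ℕ → NatOrd} (hf : Good l f) : 1 ≤ (f 0).no :=
  NatOrd.one_le_no (hf.below 0) (hf.pos 0 (Nat.zero_le l))

theorem Good.vres {l m : ℕ} {f : ℕ → NatOrd} (hf : Good m f) (h : l ≤ m) : Good l (vres l f) where
  pos i hi := by
    rw [GodelT.vres, if_pos hi]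
    exact hf.pos i (hi.trans h)
  below i := by
    unfold GodelT.vres
    split_ifs
    · exact hf.below i
    · exact NatOrd.below_zero
  nat := hf.nat
  norm i := by
    unfold GodelT.vres
    rw [if_pos (Nat.zero_le l)]
    split_ifs
    · exact hf.norm i
    · simp

theorem vbox_zero {l m : ℕ} {f g : ℕ → NatOrd} (hf : Good l f) (hg : Good m g) (n : ℕ) :
    vbox f g n 0 =
      collapse (omega * tower NatOrd.exp f g n 1 + ((f 0).no + (g 0).no + n : ℕ)) := by
  rw [vbox, if_pos rfl]
  push_cast
  rw [hf.no_zero_eq, hg.no_zero_eq]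

theorem vbox_of_pos (f g : ℕ → NatOrd) (n : ℕ) {i : ℕ} (h : 0 < i) :
    vbox f g n i = tower NatOrd.exp f g (n + 1 - i) i :=
  if_neg h.ne'

theorem Good.no_tower_le {l n : ℕ} {f g : ℕ → NatOrd} (hf : Good l f) (hg : Good n g) (k i : ℕ)
    {M : ℕ} (hM : (f 0).no + (g 0).no ≤ M) (hk : k ≤ M) :
    (tower NatOrd.exp f g k i).no ≤ F 2 M := by
  have h1 := hf.one_le_no_zero
  have h2 := hg.one_le_no_zero
  refine no_tower_le_F hf.below hg.below (by omega) hk (fun j _ _ => ?_) (fun j _ _ => ?_)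
  · have := hf.norm j
    omega
  · have := hf.norm j
    have := hg.norm j
    omega

theorem Good.one_le_tower {l : ℕ} {f : ℕ → NatOrd} (hf : Good l f) (g : ℕ → NatOrd) (k : ℕ)
    {i : ℕ} (h : i ≤ l) : 1 ≤ tower NatOrd.exp f g k i :=
  (hf.pos i h).trans (le_tower isExp_exp f g k i)

/-- A tower occurring in a positive component has height at most n, hence norm at most F₂(f₀ + g₀ +
n) ≤ Φ(f₀ + g₀ + n), which ψ exceeds. The summand n in the definition of □ accounts for the height.
-/
theorem Good.vbox {m n : ℕ} {f g : ℕ → NatOrd} (hf : Good m f) (hg : Good n g) (h : n < m) :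
    Good m (vbox f g n) where
  pos i hi := by
    rcases Nat.eq_zero_or_pos i with rfl | h0
    · rw [vbox_zero hf hg]
      have := le_collapse (below_tower hf.below hg.below n 1) ((f 0).no + (g 0).no + n)
      have := hf.one_le_no_zero
      exact_mod_cast (by omega : 1 ≤ collapse _)
    · rw [vbox_of_pos _ _ _ h0]
      exact hf.one_le_tower g _ hi
  below i := by
    rcases Nat.eq_zero_or_pos i with rfl | h0
    · rw [vbox_zero hf hg]
      exact below_natCast _
    · rw [vbox_of_pos _ _ _ h0]
      exact below_tower hf.below hg.below _ _
  nat := ⟨_, vbox_zero hf hg n⟩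
  norm i := by
    rcases Nat.eq_zero_or_pos i with rfl | h0
    · exact le_rfl
    · rw [vbox_of_pos _ _ _ h0, vbox_zero hf hg, NatOrd.no_nat]
      refine le_of_lt (lt_of_le_of_lt
        (hf.no_tower_le hg (n + 1 - i) i (M := (f 0).no + (g 0).no + n) (by omega) ?_)
        (lt_psi_of_le_Phi (below_tower hf.below hg.below n 1) (hf.one_le_tower g n (by omega))
          (F_two_le_Phi le_rfl)))
      omega

-- Monotonicity of □ and domination of its arguments.

theorem Good.no_lt {l m : ℕ} {f g : ℕ → NatOrd} (hf : Good l f) (hg : Good m g)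
    (h : f 0 < g 0) : (f 0).no < (g 0).no := by
  rw [← hf.no_zero_eq, ← hg.no_zero_eq] at h
  exact Nat.cast_lt.1 h

theorem VLt.vres {f g : ℕ → NatOrd} (h : VLt f g) (l : ℕ) : VLt (vres l f) (vres l g) := by
  refine ⟨h.1, fun i hi => ?_⟩
  unfold GodelT.vres
  split_ifs
  · exact h.2 i hi
  · exact le_rfl

/-- The towers grow weakly with their entries; in component 0 the strict increase of f₀ in the
finite summand makes the collapse increase, the norm of the smaller tower being under control. -/
theorem vbox_lt_vbox_left {m n : ℕ} {f f' g : ℕ → NatOrd} (hf : Good m f) (hf' : Good m f')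
    (hg : Good n g) (h : VLt f' f) : VLt (vbox f' g n) (vbox f g n) := by
  have hT : ∀ k i, 0 < i → tower NatOrd.exp f' g k i ≤ tower NatOrd.exp f g k i := fun k i hi =>
    tower_mono isExp_exp (fun j h1 _ => h.2 j (by omega)) (fun j _ _ => le_rfl)
  refine ⟨?_, fun i hi => ?_⟩
  · rw [vbox_zero hf hg, vbox_zero hf' hg, Nat.cast_lt]
    have := hf'.no_lt hf h.1
    refine collapse_lt_of_le (below_tower hf'.below hg.below n 1)
      (below_tower hf.below hg.below n 1)
      (hT n 1 one_pos) (by omega) (hf'.no_tower_le hg n 1 (by omega) (by omega))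
  · rw [vbox_of_pos _ _ _ hi, vbox_of_pos _ _ _ hi]
    exact hT _ i hi

theorem vbox_lt_vbox_right {m n : ℕ} {f g g' : ℕ → NatOrd} (hf : Good m f) (hg : Good n g)
    (hg' : Good n g') (h : VLt g' g) : VLt (vbox f g' n) (vbox f g n) := by
  have hT : ∀ k i, 0 < i → tower NatOrd.exp f g' k i ≤ tower NatOrd.exp f g k i := fun k i hi =>
    tower_mono isExp_exp (fun j _ _ => le_rfl) (fun j h1 _ => h.2 j (by omega))
  refine ⟨?_, fun i hi => ?_⟩
  · rw [vbox_zero hf hg, vbox_zero hf hg', Nat.cast_lt]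
    have := hg'.no_lt hg h.1
    refine collapse_lt_of_le (below_tower hf.below hg'.below n 1)
      (below_tower hf.below hg.below n 1)
      (hT n 1 one_pos) (by omega) (hf.no_tower_le hg' n 1 (by omega) (by omega))
  · rw [vbox_of_pos _ _ _ hi, vbox_of_pos _ _ _ hi]
    exact hT _ i hi

theorem lt_no_vbox_zero {m n : ℕ} {f g : ℕ → NatOrd} (hf : Good m f) (hg : Good n g)
    (h : n < m) : (f 0).no + (g 0).no + n + 100 < (vbox f g n 0).no := by
  rw [vbox_zero hf hg, NatOrd.no_nat]
  exact add_lt_collapse (below_tower hf.below hg.below n 1) (hf.one_le_tower g n (by omega)) _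

theorem Good.lt_of_no_lt {l m : ℕ} {f g : ℕ → NatOrd} (hf : Good l f) (hg : Good m g)
    (h : (f 0).no < (g 0).no) : f 0 < g 0 := by
  rw [← hf.no_zero_eq, ← hg.no_zero_eq]
  exact Nat.cast_lt.2 h

theorem vlt_vbox_left {m n : ℕ} {f g : ℕ → NatOrd} (hf : Good m f) (hg : Good n g) (h : n < m) :
    VLt f (vbox f g n) := by
  refine ⟨hf.lt_of_no_lt (hf.vbox hg h) ?_, fun i hi => ?_⟩
  · have := lt_no_vbox_zero hf hg h
    omega
  · rw [vbox_of_pos _ _ _ hi]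
    exact le_tower isExp_exp f g _ i

/-- Above n the components of □ no longer involve g, so g has to vanish there. -/
theorem vlt_vbox_right {m n : ℕ} {f g : ℕ → NatOrd} (hf : Good m f) (hg : Good n g) (h : n < m)
    (h0 : ∀ i, n < i → g i = 0) : VLt g (vbox f g n) := by
  refine ⟨hg.lt_of_no_lt (hf.vbox hg h) ?_, fun i hi => ?_⟩
  · have := lt_no_vbox_zero hf hg h
    omega
  · rcases lt_or_ge n i with hn | hn
    · rw [h0 i hn]
      exact NatOrd.zero_le _
    · rw [vbox_of_pos _ _ _ hi, show n + 1 - i = n - i + 1 by omega]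
      exact (le_add_of_nonneg_left (NatOrd.zero_le _)).trans
        (add_le_tower_succ isExp_exp f g (n - i) i)

theorem VLt.trans {f g h : ℕ → NatOrd} (h1 : VLt f g) (h2 : VLt g h) : VLt f h :=
  ⟨h1.1.trans h2.1, fun i hi => (h1.2 i hi).trans (h2.2 i hi)⟩

/-! ## The vectors of recursors -/

/-- The vector `⟨t, 1, …, 1, t⟩` of level `l + 2`. -/
noncomputable def recVec (l : ℕ) (t : NatOrd) (i : ℕ) : NatOrd :=
  if i = 0 ∨ i = l + 2 then t else if i < l + 2 then 1 else 0

theorem good_recVec (l : ℕ) {t : ℕ} (ht : 1 ≤ t) : Good (l + 2) (recVec l t) where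
  pos i hi := by
    unfold recVec
    split_ifs
    · exact_mod_cast ht
    · exact le_rfl
    · omega
  below i := by
    unfold recVec
    split_ifs
    · exact below_natCast t
    · exact NatOrd.below_one
    · exact NatOrd.below_zero
  nat := ⟨t, if_pos (Or.inl rfl)⟩
  norm i := by
    rw [show recVec l t 0 = t from if_pos (Or.inl rfl)]
    unfold recVec
    split_ifs
    · exact le_rfl
    · simpa using ht
    · simp

theorem recVec_lt (l : ℕ) {s t : NatOrd} (h : t < s) : VLt (recVec l t) (recVec l s) := by
  refine ⟨h, fun i _ => ?_⟩
  unfold recVec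
  split_ifs
  · exact h.le
  · exact le_rfl
  · exact le_rfl

-- Estimates for the redex of Rˢ.

section Recursor

variable {l : ℕ} {a b tv : ℕ → NatOrd} {s t : ℕ}

/-- The vector of `R^t A`. -/
noncomputable def recVec₁ (l : ℕ) (a : ℕ → NatOrd) (t : ℕ) : ℕ → NatOrd :=
  vres (l + 1) (vbox (recVec l t) a (l + 1))

/-- The vector of `R^t A B`. -/
noncomputable def recVec₂ (l : ℕ) (a b : ℕ → NatOrd) (t : ℕ) : ℕ → NatOrd :=
  vres l (vbox (recVec₁ l a t) b l)

theorem good_recVec₁ (ha : Good (l + 1) a) (ht : 1 ≤ t) : Good (l + 1) (recVec₁ l a t) :=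
  ((good_recVec l ht).vbox ha (by omega)).vres (by omega)

theorem good_recVec₂ (ha : Good (l + 1) a) (hb : Good l b) (ht : 1 ≤ t) :
    Good l (recVec₂ l a b t) :=
  ((good_recVec₁ ha ht).vbox hb (by omega)).vres (by omega)

theorem recVec₁_of_pos {i : ℕ} (hi : 0 < i) (hl : i ≤ l + 1) :
    recVec₁ l a t i = tower NatOrd.exp (recVec l t) a (l + 1 - i + 1) i := by
  rw [recVec₁, vres, if_pos hl, vbox_of_pos _ _ _ hi]
  congr 1
  omega

theorem two_mul_le_recVec₁ (ht : 1 ≤ t) {i : ℕ} (hi : 0 < i) (hl : i ≤ l + 1) :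
    2 * (1 + a i) ≤ recVec₁ l a t i := by
  rw [recVec₁_of_pos hi hl]
  have h1 : recVec l t i = 1 := by
    rw [recVec, if_neg (by omega), if_pos (by omega)]
  have := two_mul_le_tower_succ isExp_exp (f := recVec l t) (g := a) (k := l + 1 - i) (i := i)
    ((good_recVec l ht).pos (i + 1) (by omega))
  rwa [h1] at this

theorem recVec₁_mono (ha : Good (l + 1) a) (ht : 1 ≤ t) (hs : t < s) :
    VLt (recVec₁ l a t) (recVec₁ l a s) :=
  (vbox_lt_vbox_left (good_recVec l (by omega)) (good_recVec l ht) ha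
    (recVec_lt l (Nat.cast_lt.2 hs))).vres _

/-- Downward induction on the position i. Write P, Q, T for the three towers one level up. At level
i the entry of RᵗAB is e(Q) · c, so the reduct contains e(P) · e(Q) · c = e(P+Q) · c, and P + Q + 1
≤ T suffices to double this product. The tower Q is therefore carried along in the claim, and the
further summand a i + 1 leaves room for the vector of At in component 0. -/
theorem tower_rec_le (ha : Good (l + 1) a) (ht : 1 ≤ t) (hs : t + 2 ≤ s)
    {at' : ℕ → NatOrd} (hat : ∀ i, 0 < i → i ≤ l + 1 → at' i = a i) (k i : ℕ) (hi : 0 < i)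
    (hk : i + k = l + 1) :
    tower NatOrd.exp at' (recVec₂ l a b t) k i + tower NatOrd.exp (recVec₁ l a t) b k i + a i + 1
      ≤ tower NatOrd.exp (recVec₁ l a s) b k i := by
  have he := isExp_exp
  induction k generalizing i with
  | zero =>
    obtain rfl : i = l + 1 := by omega
    change at' (l + 1) + recVec₁ l a t (l + 1) + a (l + 1) + 1 ≤ recVec₁ l a s (l + 1)
    have hr : ∀ t, recVec₁ l a t (l + 1) = NatOrd.exp t * (1 + a (l + 1)) := by
      intro t
      rw [recVec₁_of_pos hi le_rfl, Nat.sub_self]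
      change NatOrd.exp (recVec l t (l + 2)) * (recVec l t (l + 1) + _) = _
      have h1 : recVec l t (l + 1) = 1 := by
        rw [recVec, if_neg (by omega), if_pos (by omega)]
      have h2 : recVec l t (l + 2) = t := if_pos (Or.inr rfl)
      rw [h1, h2]
    rw [hat _ hi le_rfl, hr, hr]
    set x := 1 + a (l + 1)
    have h1 : (1 : NatOrd) ≤ NatOrd.exp t := he.one_le _
    -- The gap of 2 between t and s provides a factor 4 at the top. One copy of 2^t · x is the entry
    -- for t, two more cover 2 · x, and the fourth is left over.
    have h2 : NatOrd.exp (t + 1 + 1) ≤ NatOrd.exp s := he.mono (by exact_mod_cast hs)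
    rw [he.add, he.add, NatOrd.exp_one] at h2
    calc a (l + 1) + NatOrd.exp t * x + a (l + 1) + 1
        ≤ a (l + 1) + NatOrd.exp t * x + a (l + 1) + 1 + 1 :=
          le_add_of_nonneg_right (NatOrd.zero_le 1)
      _ = 1 * x + 1 * x + NatOrd.exp t * x := by ring
      _ ≤ NatOrd.exp t * x + NatOrd.exp t * x + NatOrd.exp t * x := by
          refine add_le_add (add_le_add ?_ ?_) le_rfl <;>
            exact mul_le_mul_of_nn he.nonneg h1 le_rfl
      _ ≤ NatOrd.exp t * x + NatOrd.exp t * x + NatOrd.exp t * x + NatOrd.exp t * x :=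
          le_add_of_nonneg_right (NatOrd.zero_le _)
      _ = NatOrd.exp t * 2 * 2 * x := by ring
      _ ≤ NatOrd.exp s * x := mul_le_mul_of_nn he.nonneg h2 le_rfl
  | succ k ih =>
    have ih := ih (i + 1) (by omega) (by omega)
    have hP : 1 ≤ tower NatOrd.exp at' (recVec₂ l a b t) k (i + 1) := by
      refine le_trans ?_ (le_tower he _ _ _ _)
      rw [hat _ (by omega) (by omega)]
      exact ha.pos _ (by omega)
    have hQ : 1 ≤ tower NatOrd.exp (recVec₁ l a t) b k (i + 1) :=
      (good_recVec₁ ha ht).one_le_tower b k (by omega)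
    have hr2 : recVec₂ l a b t i = NatOrd.exp (tower NatOrd.exp (recVec₁ l a t) b k (i + 1)) *
        (recVec₁ l a t i + b i) := by
      rw [recVec₂, vres, if_pos (by omega), vbox_of_pos _ _ _ hi,
        show l + 1 - i = k + 1 by omega]
      rfl
    change NatOrd.exp (tower NatOrd.exp at' (recVec₂ l a b t) k (i + 1)) *
        (at' i + recVec₂ l a b t i) +
        NatOrd.exp (tower NatOrd.exp (recVec₁ l a t) b k (i + 1)) * (recVec₁ l a t i + b i) +
        a i + 1 ≤
      NatOrd.exp (tower NatOrd.exp (recVec₁ l a s) b k (i + 1)) * (recVec₁ l a s i + b i)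
    rw [hr2, hat i hi (by omega)]
    generalize tower NatOrd.exp at' (recVec₂ l a b t) k (i + 1) = P at *
    generalize tower NatOrd.exp (recVec₁ l a t) b k (i + 1) = Q at *
    generalize tower NatOrd.exp (recVec₁ l a s) b k (i + 1) = T at *
    have hT : P + Q + 1 ≤ T := by
      exact (add_le_add (le_add_of_nonneg_right (NatOrd.zero_le _)) le_rfl).trans ih
    -- This factor 2 absorbs both occurrences of a i, the one inside e(P) · (a i + …) and the one in
    -- the surplus of the claim.
    have hc : 2 * (1 + a i) ≤ recVec₁ l a t i + b i :=
      (two_mul_le_recVec₁ ht hi (by omega)).trans (le_add_of_nonneg_right (NatOrd.zero_le _))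
    have hc' : recVec₁ l a t i + b i ≤ recVec₁ l a s i + b i := by
      gcongr
      exact (recVec₁_mono ha ht (by omega)).2 i hi
    generalize recVec₁ l a t i + b i = c at *
    generalize recVec₁ l a s i + b i = c' at *
    generalize a i = x at *
    calc NatOrd.exp P * (x + NatOrd.exp Q * c) + NatOrd.exp Q * c + x + 1
        = NatOrd.exp P * x + 1 * (1 + x) + NatOrd.exp Q * c +
            NatOrd.exp P * NatOrd.exp Q * c := by ring
      _ ≤ NatOrd.exp P * (1 + x) + NatOrd.exp P * (1 + x) + NatOrd.exp Q * c +
            NatOrd.exp P * NatOrd.exp Q * c := by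
          refine add_le_add (add_le_add (add_le_add ?_ ?_) le_rfl) le_rfl
          · exact mul_le_mul_of_nn he.nonneg le_rfl (le_add_of_nonneg_left (NatOrd.zero_le 1))
          · exact mul_le_mul_of_nn he.nonneg (he.one_le P) le_rfl
      _ = NatOrd.exp P * (2 * (1 + x)) + NatOrd.exp Q * c + NatOrd.exp P * NatOrd.exp Q * c := by
          ring
      _ ≤ NatOrd.exp P * c + NatOrd.exp Q * c + NatOrd.exp P * NatOrd.exp Q * c := by
          refine add_le_add (add_le_add ?_ le_rfl) le_rfl
          exact mul_le_mul_of_nn he.nonneg le_rfl hc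
      _ = (NatOrd.exp P + NatOrd.exp Q) * c + NatOrd.exp (P + Q) * c := by
          rw [he.add]
          ring
      _ ≤ NatOrd.exp (P + Q) * c + NatOrd.exp (P + Q) * c := by
          refine add_le_add ?_ le_rfl
          exact mul_le_mul_of_nn he.nonneg (he.add_le hP hQ) le_rfl
      _ = NatOrd.exp (P + Q + 1) * c := by
          rw [he.add (P + Q), NatOrd.exp_one]
          ring
      _ ≤ NatOrd.exp T * c' := mul_le_mul_of_nn he.nonneg (he.mono hT) hc'

/-- The positive components are `tower_rec_le` itself. In component 0 the reduct is ψ(ω·P + ψ(α) +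
ψ(β) + l), where ψ(α) and ψ(β) belong to At and RᵗAB. Pulling both arguments out of their collapses
gives the coefficient P + Q + a₁ of ω, which is below T. -/
theorem vlt_recursor (ha : Good (l + 1) a) (hb : Good l b) (htv : Good 0 tv) (ht : tv 0 = t)
    (hs : t + 2 ≤ s) :
    VLt (vres l (vbox (vres (l + 1) (vbox a tv 0)) (recVec₂ l a b t) l)) (recVec₂ l a b s) := by
  have ht1 : 1 ≤ t := by
    have := htv.one_le_no_zero
    rwa [ht, NatOrd.no_nat] at this
  set at' := vres (l + 1) (vbox a tv 0) with hat_def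
  -- The argument t has level 0, so applying A to it changes component 0 only.
  have hat : ∀ i, 0 < i → i ≤ l + 1 → at' i = a i := by
    intro i hi hil
    rw [hat_def, vres, if_pos hil, vbox_of_pos _ _ _ hi, show 0 + 1 - i = 0 by omega]
    rfl
  have hat_good : Good (l + 1) at' := (ha.vbox htv (by omega)).vres le_rfl
  have hr1 := good_recVec₁ ha ht1
  have hr1s : Good (l + 1) (recVec₁ l a s) := good_recVec₁ ha (by omega)
  have hr2 := good_recVec₂ ha hb ht1
  have key := tower_rec_le (b := b) ha ht1 hs hat
  refine ⟨?_, fun i hi => ?_⟩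
  · change vbox at' (recVec₂ l a b t) l 0 < vbox (recVec₁ l a s) b l 0
    have hα : at' 0 = _ := vbox_zero ha htv 0
    have hβ : recVec₂ l a b t 0 = _ := vbox_zero hr1 hb l
    rw [vbox_zero hat_good hr2, vbox_zero hr1s hb, Nat.cast_lt]
    have h1 := key l 1 one_pos (by omega)
    have hno1 : (at' 0).no = _ := (congrArg NatOrd.no hα).trans (NatOrd.no_nat _)
    have hno2 : (recVec₂ l a b t 0).no = _ := (congrArg NatOrd.no hβ).trans (NatOrd.no_nat _)
    rw [hno1, hno2]
    have ha1 : tower NatOrd.exp a tv 0 1 = a 1 := rfl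
    rw [ha1]
    have hPb := below_tower hat_good.below hr2.below l 1
    have hQb := below_tower hr1.below hb.below l 1
    have hTb := below_tower hr1s.below hb.below l 1
    have hab := ha.below 1
    have hlt : (recVec₁ l a t 0).no < (recVec₁ l a s 0).no :=
      hr1.no_lt hr1s (recVec₁_mono ha ht1 (by omega)).1
    have hbig : s + (a 0).no + (l + 1) + 100 < (recVec₁ l a s 0).no := by
      have := lt_no_vbox_zero (good_recVec l (show 1 ≤ s by omega)) ha (by omega)
      rw [show recVec l s 0 = s from if_pos (Or.inl rfl), NatOrd.no_nat] at this
      exact this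
    have hb0 := hb.one_le_no_zero
    have htn : (tv 0).no = t := by rw [ht, NatOrd.no_nat]
    rw [htn]
    set N := (recVec₁ l a s 0).no + (b 0).no + l with hN
    set T := tower NatOrd.exp (recVec₁ l a s) b l 1
    have hQno : (tower NatOrd.exp (recVec₁ l a t) b l 1).no ≤ F 2 N :=
      hr1.no_tower_le hb l 1 (by omega) (by omega)
    -- The entries of this tower include those of RᵗAB, which are towers of norm up to F₂(N); hence
    -- the nested bound.
    have hPno : (tower NatOrd.exp at' (recVec₂ l a b t) l 1).no ≤ F 2 (N + F 2 N) := by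
      refine no_tower_le_F hat_good.below hr2.below (by omega) (by omega) ?_ ?_
      · intro j hj hjl
        rw [hat j hj (by omega)]
        have := ha.norm j
        omega
      · intro j hj hjl
        rw [hat j hj (by omega)]
        have h2 := ha.norm j
        have h3 : (recVec₂ l a b t j).no ≤ F 2 N := by
          rw [recVec₂, vres, if_pos (by omega), vbox_of_pos _ _ _ hj]
          exact hr1.no_tower_le hb _ j (by omega) (by omega)
        omega
    generalize tower NatOrd.exp at' (recVec₂ l a b t) l 1 = P at *
    generalize tower NatOrd.exp (recVec₁ l a t) b l 1 = Q at *
    have hPl : Below (omega * P + l) := below_collapse hPb l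
    have hαb := below_collapse hab ((a 0).no + t + 0)
    have hβb := below_collapse hQb ((recVec₁ l a t 0).no + (b 0).no + l)
    set α := omega * a 1 + ((a 0).no + t + 0 : ℕ)
    set β := omega * Q + ((recVec₁ l a t 0).no + (b 0).no + l : ℕ)
    calc collapse (omega * P + (collapse α + collapse β + l : ℕ))
        = collapse (omega * P + l + collapse α + collapse β) := by
          congr 1
          push_cast
          ring
      -- The collapses are resolved one at a time, the other one being treated as part of the left
      -- summand.
      _ ≤ collapse (omega * P + l + collapse α + β) :=
        psi_add_psi_le (hPl.add (below_natCast _)) hβb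
      _ = collapse (omega * P + l + β + collapse α) := by
          congr 1
          ring
      _ ≤ collapse (omega * P + l + β + α) := psi_add_psi_le (hPl.add hβb) hαb
      _ = collapse (omega * (P + Q + a 1) +
            (l + ((recVec₁ l a t 0).no + (b 0).no + l) + ((a 0).no + t + 0) : ℕ)) := by
          congr 1
          simp only [α, β]
          push_cast
          ring
      _ < collapse (omega * T + (N : ℕ)) := by
          have hF1 := add_le_normBound N
          have hF2 := F_two_le_normBound N
          have hF3 := F_two_add_F_two_le_normBound N
          have han := ha.norm 1
          refine collapse_lt_of_lt ((hPb.add hQb).add hab) hTb ?_ (x := N) (by omega) (by omega) ?_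
          · exact NatOrd.add_one_le_iff.1 h1
          · rw [NatOrd.no_add (hPb.add hQb) hab, NatOrd.no_add hPb hQb]
            omega
  · unfold recVec₂
    unfold vres
    split_ifs with hil
    · rw [vbox_of_pos _ _ _ hi, vbox_of_pos _ _ _ hi]
      refine le_trans ?_ (key (l + 1 - i) i hi (by omega))
      rw [add_assoc, add_assoc]
      exact le_add_of_nonneg_right (NatOrd.zero_le _)
    · exact le_rfl

end Recursor

end GodelT

namespace GodelT

open NatOrd (Below collapse psi_lt psi_le omega below_collapse no_collapse_le le_no_collapse
  omega_mul_add_lt lt_psi_of_le_Phi psi_add_nat_le psi_add_psi_le psi_add_le below_natCast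
  below_tower no_tower_le no_tower_le_F isExp_exp)

/-! # Values of ordinal terms -/

/-- The value of an ordinal term under a substitution of closed terms. -/
noncomputable def ev {Γ : Ctx} (χ : OSub Γ []) (h : OT Γ) : NatOrd := ⟨(h.subst χ).val⟩

section Ev

variable {Γ Δ : Ctx} (χ : OSub Γ [])

@[simp] theorem ev_zero : ev χ .zero = 0 := rfl

@[simp] theorem ev_one : ev χ .one = 1 := rfl

@[simp] theorem ev_omega : ev χ .omega = omega := rfl

@[simp] theorem ev_add (f g : OT Γ) : ev χ (.add f g) = ev χ f + ev χ g := rfl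

@[simp] theorem ev_expMul (f g : OT Γ) : ev χ (.expMul f g) = NatOrd.exp (ev χ f) * ev χ g := rfl

@[simp] theorem ev_psi (f g : OT Γ) :
    ev χ (.psi f g) = (collapse (omega * ev χ f + ev χ g) : NatOrd) := rfl

theorem ev_nsmul (n : ℕ) (h : OT Γ) : ev χ (OT.nsmul n h) = n * ev χ h := by
  induction n with
  | zero => simp [OT.nsmul]
  | succ n ih =>
    cases n with
    | zero => simp [OT.nsmul]
    | succ n =>
      rw [OT.nsmul, ev_add, ih]
      push_cast
      ring

theorem ev_addNat (h : OT Γ) (n : ℕ) : ev χ (OT.addNat h n) = ev χ h + n := by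
  cases n with
  | zero => simp [OT.addNat]
  | succ n => rw [OT.addNat, ev_add, ev_nsmul, ev_one, mul_one]

theorem ev_sumUpTo (c : ℕ → OT Γ) (m : ℕ) :
    ev χ (OT.sumUpTo c m) = ∑ i ∈ Finset.range (m + 1), ev χ (c i) := by
  induction m with
  | zero => simp [OT.sumUpTo]
  | succ m ih => rw [OT.sumUpTo, ev_add, ih, Finset.sum_range_succ _ (m + 1)]

/-- Composition of substitutions of ordinal terms. -/
def OSub.comp {Γ Δ Θ : Ctx} (t : OSub Δ Θ) (s : OSub Γ Δ) : OSub Γ Θ :=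
  fun σ x i => (s σ x i).subst t

theorem OT.subst_subst {Γ Δ Θ : Ctx} (s : OSub Γ Δ) (t : OSub Δ Θ) (h : OT Γ) :
    (h.subst s).subst t = h.subst (t.comp s) := by
  induction h with
  | var x i => rfl
  | zero => rfl
  | one => rfl
  | omega => rfl
  | add f g hf hg => simp only [OT.subst, hf, hg]
  | expMul f g hf hg => simp only [OT.subst, hf, hg]
  | psi f g hf hg => simp only [OT.subst, hf, hg]

theorem ev_subst (χ : OSub Δ []) (s : OSub Γ Δ) (h : OT Γ) :
    ev χ (h.subst s) = ev (χ.comp s) h := by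
  unfold ev
  rw [OT.subst_subst]

/-- The values of the components of a vector. -/
noncomputable def evv (v : OVec Γ) (i : ℕ) : NatOrd := ev χ (v.get i)

theorem OVec.get_of_le {v : OVec Γ} {i : ℕ} (h : i ≤ v.lv) :
    v.get i = v.coord ⟨i, Nat.lt_succ_of_le h⟩ :=
  dif_pos (Nat.lt_succ_of_le h)

theorem OVec.get_of_lt {v : OVec Γ} {i : ℕ} (h : v.lv < i) : v.get i = .zero :=
  dif_neg (by omega)

theorem evv_of_lt {v : OVec Γ} {i : ℕ} (h : v.lv < i) : evv χ v i = 0 := by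
  rw [evv, OVec.get_of_lt h, ev_zero]

theorem evv_restrict (v : OVec Γ) (l : ℕ) : evv χ (v.restrict l) = vres l (evv χ v) := by
  funext i
  unfold vres
  split_ifs with h
  · rw [evv, OVec.get_of_le (v := v.restrict l) h]
    rfl
  · exact evv_of_lt χ (v := v.restrict l) (not_le.1 h)

theorem evv_add (v w : OVec Γ) (i : ℕ) : evv χ (v.add w) i = evv χ v i + evv χ w i := by
  by_cases h : i ≤ max v.lv w.lv
  · rw [evv, OVec.get_of_le (v := v.add w) h]
    simp only [OVec.add]
    split_ifs with h1 h2
    · rw [evv_of_lt χ h1, add_zero]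
      rfl
    · rw [evv_of_lt χ h2, zero_add]
      rfl
    · rfl
  · rw [evv_of_lt χ (v := v.add w) (not_le.1 h), evv_of_lt, evv_of_lt, add_zero] <;> omega

theorem ev_boxAux (f g : OVec Γ) (k i : ℕ) :
    ev χ (boxAux f g k i) = tower NatOrd.exp (evv χ f) (evv χ g) k i := by
  induction k generalizing i with
  | zero => rfl
  | succ k ih => rw [boxAux, ev_expMul, ih, tower]; rfl

theorem evv_box {f g : OVec Γ} (h : g.lv < f.lv) :
    evv χ (f.box g) = vbox (evv χ f) (evv χ g) g.lv := by
  funext i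
  by_cases hi : i ≤ f.lv
  · rw [evv, OVec.get_of_le (v := f.box g) hi]
    simp only [OVec.box]
    unfold vbox
    split_ifs
    · rw [ev_psi, ev_boxAux, ev_addNat]
      rfl
    · rw [ev_boxAux]
  · rw [evv_of_lt χ (v := f.box g) (not_le.1 hi), vbox_of_pos _ _ _ (by omega),
      show g.lv + 1 - i = 0 by omega]
    exact (evv_of_lt χ (not_le.1 hi)).symm

end Ev

/-! # The classes of ordinal terms -/

theorem InB.spec {i : ℕ} {h : OT []} (hh : InB i h) :
    1 ≤ (⟨h.val⟩ : NatOrd) ∧ Below ⟨h.val⟩ ∧ (i = 0 → ∃ k : ℕ, (⟨h.val⟩ : NatOrd) = k) := by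
  induction hh with
  | one i => exact ⟨le_rfl, NatOrd.below_one, fun _ => ⟨1, Nat.cast_one.symm⟩⟩
  | omega i hi =>
    exact ⟨NatOrd.one_le_omega, NatOrd.below_omega, fun h => by omega⟩
  | add i f g _ _ hf hg =>
    refine ⟨hf.1.trans (le_add_of_nonneg_right (NatOrd.zero_le _)), hf.2.1.add hg.2.1, fun h => ?_⟩
    obtain ⟨k, hk⟩ := hf.2.2 h
    obtain ⟨m, hm⟩ := hg.2.2 h
    refine ⟨k + m, ?_⟩
    rw [Nat.cast_add, ← hk, ← hm]
    rfl
  | expMul i f g hi _ _ hf hg =>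
    refine ⟨?_, hf.2.1.exp.mul hg.2.1, fun h => by omega⟩
    have := mul_le_mul_of_nn NatOrd.zero_le (isExp_exp.one_le ⟨f.val⟩) hg.1
    rwa [one_mul] at this
  | psi f g k _ _ _ _ hf hg =>
    have e : (⟨(OT.psi f g).val⟩ : NatOrd) =
        ((collapse (NatOrd.omega * ⟨f.val⟩ + ⟨g.val⟩) : ℕ) : NatOrd) := by
      apply NatOrd.ext
      rw [OT.val]
      rfl
    rw [e]
    refine ⟨?_, below_natCast _, fun _ => ⟨_, rfl⟩⟩
    obtain ⟨m, hm⟩ := hg.2.2 rfl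
    have h1 := hg.1
    rw [hm] at h1 ⊢
    exact h1.trans (Nat.cast_le.2 (le_collapse hf.2.1 m))
  | ofZero i h _ _ hh => exact ⟨hh.1, hh.2.1, fun _ => hh.2.2 rfl⟩

/-- The ordinal terms the closed instances of which belong to the sets `Bᵢ`. -/
inductive InCf {Γ : Ctx} : ℕ → OT Γ → Prop
  | one (i : ℕ) : InCf i .one
  | omega (i : ℕ) : 1 ≤ i → InCf i .omega
  | var {ρ : Ty} (y : Var Γ ρ) (i : Fin (ρ.lv + 1)) : InCf i (.var y i)
  | add (i : ℕ) (f g : OT Γ) : InCf i f → InCf i g → InCf i (.add f g)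
  | expMul (i : ℕ) (f g : OT Γ) : 1 ≤ i → InCf (i + 1) f → InCf i g → InCf i (.expMul f g)
  | psi (f g : OT Γ) : InCf 1 f → InCf 0 g → f.NormLeF2 g → InCf 0 (.psi f g)
  | ofZero (i : ℕ) (h : OT Γ) : 1 ≤ i → InCf 0 h → InCf i h

theorem InC.inCf {Γ : Ctx} {σ : Ty} {x : Var Γ σ} {i : ℕ} {h : OT Γ} (hh : InC x i h) :
    InCf i h := by
  induction hh with
  | one i => exact .one i
  | omega i hi => exact .omega i hi
  | var y i => exact .var y i
  | add i f g _ _ hf hg => exact .add i f g hf hg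
  | expMul i f g hi _ _ hf hg => exact .expMul i f g hi hf hg
  | psi f g _ _ hn hf hg => exact .psi f g hf hg hn
  | ofZero i h hi _ _ hh => exact .ofZero i h hi hh

theorem Admissible.inB {Γ : Ctx} {χ : OSub Γ []} (hχ : Admissible χ) {σ : Ty} (x : Var Γ σ)
    (i : Fin (σ.lv + 1)) : InB i (χ σ x i) := by
  have := (hχ σ x).1 i (Nat.le_of_lt_succ i.2)
  rwa [OVec.get_of_le (v := OVec.mk σ.lv (χ σ x)) (Nat.le_of_lt_succ i.2)] at this

theorem NormLeF2.spec {Γ : Ctx} {χ : OSub Γ []} (hχ : Admissible χ) {f g : OT Γ}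
    (h : f.NormLeF2 g) : ∃ k : ℕ, ev χ g = k ∧ (ev χ f).no ≤ F 2 k := by
  obtain ⟨k, hk, hn⟩ := h χ hχ
  exact ⟨k, NatOrd.ext hk, hn⟩

theorem InCf.inB {Γ : Ctx} {χ : OSub Γ []} (hχ : Admissible χ) {i : ℕ} {h : OT Γ}
    (hh : InCf i h) : InB i (h.subst χ) := by
  induction hh with
  | one i => exact .one i
  | omega i hi => exact .omega i hi
  | var y i => exact hχ.inB y i
  | add i f g _ _ hf hg => exact .add i _ _ hf hg
  | expMul i f g hi _ _ hf hg => exact .expMul i _ _ hi hf hg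
  | psi f g _ _ hn hf hg =>
    obtain ⟨k, hk, hn⟩ := hn χ hχ
    exact .psi _ _ k hf hg hk hn
  | ofZero i h hi _ hh => exact .ofZero i _ hi hh

section Values

variable {Γ : Ctx} {χ : OSub Γ []}

theorem InCf.one_le (hχ : Admissible χ) {i : ℕ} {h : OT Γ} (hh : InCf i h) : 1 ≤ ev χ h :=
  (hh.inB hχ).spec.1

theorem InCf.nat (hχ : Admissible χ) {h : OT Γ} (hh : InCf 0 h) : ∃ k : ℕ, ev χ h = k :=
  (hh.inB hχ).spec.2.2 rfl

theorem below_ev (hχ : Admissible χ) (h : OT Γ) : Below (ev χ h) := by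
  induction h with
  | var x i => exact (hχ.inB x i).spec.2.1
  | zero => exact NatOrd.below_zero
  | one => exact NatOrd.below_one
  | omega => exact NatOrd.below_omega
  | add f g hf hg => exact hf.add hg
  | expMul f g hf hg => exact hf.exp.mul hg
  | psi f g _ _ => exact below_natCast _

end Values

/-- The substitution replaces variable vectors by vectors of terms the closed instances of which
are admissible. -/
structure Adm {Γ Δ : Ctx} (s : OSub Γ Δ) : Prop where
  inCf : ∀ (σ : Ty) (x : Var Γ σ) (i : Fin (σ.lv + 1)), InCf i (s σ x i)
  comp : ∀ χ : OSub Δ [], Admissible χ → Admissible (χ.comp s)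

theorem OT.NormLeF2.subst {Γ Δ : Ctx} {s : OSub Γ Δ} (hs : Adm s) {f g : OT Γ}
    (h : f.NormLeF2 g) : (f.subst s).NormLeF2 (g.subst s) := by
  intro χ hχ
  rw [OT.subst_subst, OT.subst_subst]
  exact h _ (hs.comp χ hχ)

theorem InCf.subst {Γ Δ : Ctx} {s : OSub Γ Δ} (hs : Adm s) {i : ℕ} {h : OT Γ} (hh : InCf i h) :
    InCf i (h.subst s) := by
  induction hh with
  | one i => exact .one i
  | omega i hi => exact .omega i hi
  | var y i => exact hs.inCf _ y i
  | add i f g _ _ hf hg => exact .add i _ _ hf hg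
  | expMul i f g hi _ _ hf hg => exact .expMul i _ _ hi hf hg
  | psi f g _ _ hn hf hg => exact .psi _ _ hf hg (hn.subst hs)
  | ofZero i h hi _ hh => exact .ofZero i _ hi hh

theorem admissible_iff {Γ : Ctx} {χ : OSub Γ []} : Admissible χ ↔
    (∀ (σ : Ty) (x : Var Γ σ) (i : Fin (σ.lv + 1)), InB i (χ σ x i)) ∧
      ∀ (σ : Ty) (x : Var Γ σ) (i : Fin (σ.lv + 1)),
        no (χ σ x i).val ≤ no (χ σ x 0).val := by
  have hget : ∀ (σ : Ty) (x : Var Γ σ) (i : ℕ) (hi : i ≤ σ.lv),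
      (OVec.mk σ.lv (χ σ x)).get i = χ σ x ⟨i, Nat.lt_succ_of_le hi⟩ :=
    fun σ x i hi => OVec.get_of_le (v := OVec.mk σ.lv (χ σ x)) hi
  refine ⟨fun h => ⟨fun σ x i => h.inB x i, fun σ x i => ?_⟩, fun h σ x => ⟨?_, ?_⟩⟩
  · have := (h σ x).2 i
    rwa [hget _ _ _ (Nat.le_of_lt_succ i.2), hget _ _ _ (Nat.zero_le _)] at this
  · intro i hi
    rw [hget _ _ _ hi]
    exact h.1 σ x ⟨i, Nat.lt_succ_of_le hi⟩
  · intro i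
    rcases le_or_gt i σ.lv with hi | hi
    · rw [hget _ _ _ hi, hget _ _ _ (Nat.zero_le _)]
      exact h.2 σ x _
    · rw [OVec.get_of_lt (v := OVec.mk σ.lv (χ σ x)) hi]
      have h0 : no (0 : Ordinal.{0}) = 0 := by simpa using no_natCast 0
      exact h0.le.trans (Nat.zero_le _)

theorem Adm.mk' {Γ Δ : Ctx} {s : OSub Γ Δ}
    (h1 : ∀ (σ : Ty) (x : Var Γ σ) (i : Fin (σ.lv + 1)), InCf i (s σ x i))
    (h2 : ∀ χ : OSub Δ [], Admissible χ → ∀ (σ : Ty) (x : Var Γ σ) (i : Fin (σ.lv + 1)),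
      (ev χ (s σ x i)).no ≤ (ev χ (s σ x 0)).no) : Adm s :=
  ⟨h1, fun χ hχ => admissible_iff.2 ⟨fun σ x i => (h1 σ x i).inB hχ, h2 χ hχ⟩⟩

theorem Admissible.no_le {Γ : Ctx} {χ : OSub Γ []} (hχ : Admissible χ) {σ : Ty} (x : Var Γ σ)
    (i : Fin (σ.lv + 1)) : (ev χ (.var x i)).no ≤ (ev χ (.var x 0)).no :=
  (admissible_iff.1 hχ).2 σ x i

theorem Admissible.good_var {Γ : Ctx} {χ : OSub Γ []} (hχ : Admissible χ) {σ : Ty}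
    (x : Var Γ σ) : Good σ.lv (evv χ (OVec.var x)) where
  pos i hi := by
    rw [evv, OVec.get_of_le (v := OVec.var x) hi]
    exact InCf.one_le hχ (.var x _)
  below i := below_ev hχ _
  nat := InCf.nat hχ (.var x 0)
  norm i := by
    rcases le_or_gt i σ.lv with hi | hi
    · rw [evv, OVec.get_of_le (v := OVec.var x) hi]
      exact hχ.no_le x _
    · rw [evv_of_lt χ (v := OVec.var x) hi, NatOrd.no_zero]
      exact Nat.zero_le _

end GodelT

namespace GodelT

open NatOrd (Below collapse psi_lt psi_le below_collapse no_collapse_le le_no_collapse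
  omega_mul_add_lt lt_psi_of_le_Phi psi_add_nat_le psi_add_psi_le psi_add_le below_natCast
  below_tower isExp_exp)

/-! # The operators `δˣ` -/

theorem Var.idx_inj {Γ : Ctx} {σ ρ : Ty} (x : Var Γ σ) (y : Var Γ ρ) (h : y.idx = x.idx) :
    ρ = σ ∧ HEq y x := by
  induction x generalizing ρ with
  | zero =>
    cases y with
    | zero => exact ⟨rfl, HEq.rfl⟩
    | succ y => simp [Var.idx] at h
  | succ x ih =>
    cases y with
    | zero => simp [Var.idx] at h
    | succ y =>
      obtain ⟨rfl, h'⟩ := ih y (by simpa [Var.idx] using h)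
      rw [eq_of_heq h']
      exact ⟨rfl, HEq.rfl⟩

section Free

variable {Γ : Ctx} {σ : Ty} {x : Var Γ σ}

/-- The variable xᵢ enters only at index i ≤ lv x. A term under an exponent moves to a higher index,
ψ lives at index 0 only, and the transfer from index 0 to higher ones is restricted to x-free terms.
-/
theorem InC.hasVar_eq_false {i : ℕ} {h : OT Γ} (hh : InC x i h) (hi : σ.lv < i) :
    h.hasVar x = false := by
  induction hh with
  | one i => rfl
  | omega i _ => rfl
  | var y i =>
    rw [OT.hasVar, beq_eq_false_iff_ne]
    intro he
    obtain ⟨rfl, -⟩ := Var.idx_inj x y he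
    have := i.2
    omega
  | add i f g _ _ hf hg => rw [OT.hasVar, hf hi, hg hi]; rfl
  | expMul i f g _ _ _ hf hg => rw [OT.hasVar, hf (by omega), hg hi]; rfl
  | psi f g _ _ _ _ _ => omega
  | ofZero i h _ _ hx _ => exact hx

theorem dopAux_of_free {h : OT Γ} (hx : h.hasVar x = false) (i j : ℕ) :
    dopAux x i h j = if i = j then .add h .one else .one := by
  cases h <;> simp [dopAux, hx]

theorem sz_of_free {h : OT Γ} (hx : h.hasVar x = false) : h.sz x = 1 := by
  cases h <;> simp [OT.sz, hx]

theorem setOne_of_free {h : OT Γ} (hx : h.hasVar x = false) : h.setOne x = h := by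
  induction h with
  | var y i =>
    rw [OT.hasVar, beq_eq_false_iff_ne] at hx
    simp [OT.setOne, OT.subst, hx]
  | zero => rfl
  | one => rfl
  | omega => rfl
  | add f g hf hg =>
    rw [OT.hasVar, Bool.or_eq_false_iff] at hx
    exact congrArg₂ OT.add (hf hx.1) (hg hx.2)
  | expMul f g hf hg =>
    rw [OT.hasVar, Bool.or_eq_false_iff] at hx
    exact congrArg₂ OT.expMul (hf hx.1) (hg hx.2)
  | psi f g hf hg =>
    rw [OT.hasVar, Bool.or_eq_false_iff] at hx
    exact congrArg₂ OT.psi (hf hx.1) (hg hx.2)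

theorem one_le_sz (h : OT Γ) : 1 ≤ h.sz x := by
  cases h <;> simp only [OT.sz, le_refl] <;> split_ifs <;> simp

end Free

/-- Interpretations of ordinal terms in an ordered semiring with exponentiation, where the variable
vector of `X` is bounded by `b`. -/
structure IsInterp {K : Type*} [CommSemiring K] [LinearOrder K] (e : K → K) {Γ : Ctx} {σ : Ty}
    (x : Var Γ σ) (b : ℕ → K) (I : OT Γ → K) : Prop where
  one : I .one = 1
  add : ∀ f g, I (.add f g) = I f + I g
  expMul : ∀ f g, I (.expMul f g) ≤ e (I f) * I g
  var : ∀ (i : Fin (σ.lv + 1)), I (.var x i) ≤ b i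

section Interp

variable {K : Type*} [CommSemiring K] [LinearOrder K] [IsStrictOrderedRing K] {e : K → K}
  {Γ : Ctx} {σ : Ty} {x : Var Γ σ} {b : ℕ → K} {I : OT Γ → K}

theorem IsInterp.one_le_dopAux (he : IsExp e) (hI : IsInterp e x b I) (h : OT Γ) (i j : ℕ)
    (hj : j ≠ 0) : 1 ≤ I (dopAux x i h j) := by
  have hfree : ∀ (h : OT Γ) (i : ℕ), h.hasVar x = false → 1 ≤ I (dopAux x i h j) := by
    intro h i hx
    rw [dopAux_of_free hx]
    split_ifs
    · rw [hI.add, hI.one]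
      exact le_add_of_nonneg_left (he.nonneg _)
    · exact hI.one.ge
  induction h generalizing i with
  | var y k =>
    rw [dopAux]
    split_ifs
    · exact hI.one.ge
    · rw [hI.add, hI.one]
      exact le_add_of_nonneg_left (he.nonneg _)
    · exact hI.one.ge
  | zero => exact hfree _ _ rfl
  | one => exact hfree _ _ rfl
  | omega => exact hfree _ _ rfl
  | add f g _ _ =>
    by_cases hx : (OT.add f g).hasVar x = true
    · rw [dopAux, if_pos hx, hI.add, hI.one]
      exact le_add_of_nonneg_left (he.nonneg _)
    · exact hfree _ _ (by simpa using hx)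
  | expMul f g _ _ =>
    by_cases hx : (OT.expMul f g).hasVar x = true
    · rw [dopAux, if_pos hx, hI.add, hI.one]
      exact le_add_of_nonneg_left (he.nonneg _)
    · exact hfree _ _ (by simpa using hx)
  | psi f g hf _ =>
    by_cases hx : (OT.psi f g).hasVar x = true
    · rw [dopAux, if_pos hx, if_neg hj, hI.add]
      exact (hf 1).trans (le_add_of_nonneg_right (he.nonneg _))
    · exact hfree _ _ (by simpa using hx)

/-- The value of a term is dominated by the tower over the components of `δˣᵢ`. -/
theorem IsInterp.lt_tower (he : IsExp e) (hI : IsInterp e x b I) {i : ℕ} {h : OT Γ}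
    (hh : InC x i h) (hi : 1 ≤ i) (hn : i ≤ σ.lv + 1) :
    I h < tower e (fun j => I (dopAux x i h j)) b (σ.lv + 1 - i) i := by
  have hfree : ∀ (h : OT Γ) (i : ℕ), h.hasVar x = false →
      I h < tower e (fun j => I (dopAux x i h j)) b (σ.lv + 1 - i) i := by
    intro h i hx
    refine lt_tower_of_lt he ?_
    rw [dopAux_of_free hx, if_pos rfl, hI.add, hI.one]
    exact lt_add_one _
  have hone : ∀ (i : ℕ), 1 ≤ i → ∀ h : OT Γ, ∀ j, i ≤ j → 1 ≤ I (dopAux x i h j) :=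
    fun i hi h j hj => hI.one_le_dopAux he h i j (by omega)
  induction hh with
  | one i => exact hfree _ _ rfl
  | omega i _ => exact hfree _ _ rfl
  | var y i =>
    by_cases hx : (OT.var y i).hasVar x = true
    · rw [OT.hasVar, beq_iff_eq] at hx
      obtain ⟨rfl, hy⟩ := Var.idx_inj x y hx
      obtain rfl := eq_of_heq hy
      have h2 := i.2
      -- Since i ≤ lv x, the tower has at least one level, and its lowest factor is δ + bᵢ = 1 + bᵢ.
      rw [show _ + 1 - (i : ℕ) = (_ - (i : ℕ)) + 1 from Nat.succ_sub (by omega)]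
      refine lt_of_lt_of_le ?_ (add_le_tower_succ he _ _ _ _)
      rw [dopAux, if_pos (by simp [OT.hasVar]), hI.one]
      exact (hI.var i).trans_lt (lt_one_add _)
    · exact hfree _ _ (by simpa using hx)
  | add i f g _ _ hf hg =>
    by_cases hx : (OT.add f g).hasVar x = true
    · have hf := hf hi hn
      have hg := hg hi hn
      rw [hI.add]
      refine (add_lt_add hf hg).trans_le
        ((tower_add he (hone i hi f) (hone i hi g) _).trans (tower_mono he ?_ fun _ _ _ => le_rfl))
      intro j _ _
      rw [dopAux, if_pos hx, hI.add, hI.add]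
      exact le_add_of_nonneg_right (he.nonneg _)
    · exact hfree _ _ (by simpa using hx)
  | expMul i f g _ hfC hgC hf hg =>
    by_cases hx : (OT.expMul f g).hasVar x = true
    · have hil : i ≤ σ.lv := by
        by_contra hlt
        rw [OT.hasVar, hfC.hasVar_eq_false (by omega), hgC.hasVar_eq_false (by omega)] at hx
        simp at hx
      have hf := hf (by omega) (by omega)
      have hg := hg hi hn
      have hdop : ∀ j, I (dopAux x i (.expMul f g) j) =
          I (dopAux x (i + 1) f j) + I (dopAux x (i + 1) f j) + I (dopAux x i g j) + 1 := by
        intro j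
        rw [dopAux, if_pos hx, hI.add, hI.add, hI.one]
        simp only [OT.nsmul, hI.add]
      obtain ⟨k, hk⟩ : ∃ k, σ.lv = i + k := Nat.exists_eq_add_of_le hil
      rw [show σ.lv + 1 - (i + 1) = k by omega] at hf
      rw [show σ.lv + 1 - i = k + 1 by omega] at hg ⊢
      have hof : ∀ j, i + 1 ≤ j → 1 ≤ I (dopAux x (i + 1) f j) := hone (i + 1) (by omega) f
      have hog : ∀ j, i + 1 ≤ j → 1 ≤ I (dopAux x i g j) := fun j hj =>
        hone i hi g j (by omega)
      have hpos : 0 < e (I f) := lt_of_lt_of_le zero_lt_one (he.one_le _)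
      calc I (.expMul f g) ≤ e (I f) * I g := hI.expMul f g
        _ < e (I f) * tower e (fun j => I (dopAux x i g j)) b (k + 1) i :=
            mul_lt_mul_of_pos_left hg hpos
        _ ≤ e (tower e (fun j => I (dopAux x (i + 1) f j)) b k (i + 1)) *
            (e (tower e (fun j => I (dopAux x i g j)) b k (i + 1)) *
              (I (dopAux x i g i) + b i)) :=
            mul_le_mul_of_nn he.nonneg (he.mono hf.le) le_rfl
        _ = e (tower e (fun j => I (dopAux x (i + 1) f j)) b k (i + 1) +
              tower e (fun j => I (dopAux x i g j)) b k (i + 1)) *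
              (I (dopAux x i g i) + b i) := by
            rw [he.add]
            ring
        _ ≤ tower e (fun j => I (dopAux x i (.expMul f g) j)) b (k + 1) i := by
            refine mul_le_mul_of_nn he.nonneg (he.mono ?_) ?_
            -- The two exponents are merged by superadditivity; δ of the product contains a copy of
            -- δ f and one of δ g.
            · refine (tower_add he hof hog k).trans (tower_mono he ?_ fun _ _ _ => le_rfl)
              intro j _ _
              rw [hdop, add_assoc, add_assoc]
              refine le_trans ?_ (le_add_of_nonneg_left (he.nonneg _))
              rw [← add_assoc]
              exact le_add_of_nonneg_right (he.nonneg _)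
            · refine add_le_add ?_ le_rfl
              dsimp only
              rw [hdop, add_assoc, add_comm]
              exact (le_add_of_nonneg_right (he.nonneg 1)).trans
                (le_add_of_nonneg_right (he.nonneg _))
    · exact hfree _ _ (by simpa using hx)
  | psi f g _ _ _ _ _ => omega
  | ofZero i h _ _ hx _ => exact hfree _ _ hx

end Interp

section Dop

variable {Γ : Ctx} {σ : Ty} {x : Var Γ σ} {χ : OSub Γ []}

theorem evv_var (i : Fin (σ.lv + 1)) : evv χ (OVec.var x) i = ev χ (.var x i) := by
  rw [evv, OVec.get_of_le (v := OVec.var x) (Nat.le_of_lt_succ i.2)]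
  rfl

theorem isInterp_ev : IsInterp NatOrd.exp x (evv χ (OVec.var x)) (ev χ) where
  one := rfl
  add _ _ := rfl
  expMul _ _ := le_rfl
  var i := (evv_var i).ge

/-- The norm is an interpretation with 4^n as exponential. Thus `IsInterp.lt_tower` also bounds the
norm of a term by a tower over the norms of its δ-components. -/
theorem isInterp_no (hχ : Admissible χ) :
    IsInterp (fun n : ℕ => 4 ^ n) x (fun j => (evv χ (OVec.var x) j).no)
      (fun h => (ev χ h).no) where
  one := NatOrd.no_one
  add f g := NatOrd.no_add (below_ev hχ f) (below_ev hχ g)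
  expMul f g :=
    (NatOrd.no_mul_le (below_ev hχ f).exp (below_ev hχ g)).trans
      (Nat.mul_le_mul_right _ (NatOrd.no_exp_le (below_ev hχ f)))
  var i := (congrArg NatOrd.no (evv_var i)).ge

theorem adm_setOne (x : Var Γ σ) :
    Adm (Γ := Γ) (Δ := Γ) fun _ y i => if y.idx = x.idx then .one else .var y i := by
  refine .mk' (fun ρ y i => ?_) fun χ hχ ρ y i => ?_
  · split_ifs
    · exact .one _
    · exact .var y i
  · split_ifs
    · exact le_rfl
    · exact hχ.no_le y i

theorem InCf.setOne {i : ℕ} {h : OT Γ} (hh : InCf i h) : InCf i (h.setOne x) :=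
  hh.subst (adm_setOne x)

theorem setOne_add (f g : OT Γ) : (OT.add f g).setOne x = .add (f.setOne x) (g.setOne x) := rfl

theorem setOne_expMul (f g : OT Γ) :
    (OT.expMul f g).setOne x = .expMul (f.setOne x) (g.setOne x) := rfl

theorem setOne_psi (f g : OT Γ) : (OT.psi f g).setOne x = .psi (f.setOne x) (g.setOne x) := rfl

theorem dopAux_var_self (y : Var Γ σ) (i j : ℕ) (k : Fin (σ.lv + 1)) (h : y.idx = x.idx) :
    dopAux x i (.var y k) j = .one := by
  rw [dopAux, if_pos (by simpa [OT.hasVar] using h)]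

/-- Raising the finite summand increases the value of `ψ`. -/
theorem collapse_mono_right {a : NatOrd} (ha : Below a) {m n : ℕ} (h : m ≤ n) :
    collapse (NatOrd.omega * a + m) ≤ collapse (NatOrd.omega * a + n) := by
  refine psi_le (below_collapse ha n) (by gcongr) ?_
  rw [NatOrd.no_add (NatOrd.below_omega.mul ha) (below_natCast m),
    NatOrd.no_add (NatOrd.below_omega.mul ha) (below_natCast n), NatOrd.no_nat, NatOrd.no_nat]
  have := lt_Phi ((NatOrd.omega * a).no + n)
  omega

/-- Both claims are proved together: the ψ-clause of δˣ is well-formed only because the second claim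
holds for its finite argument. -/
theorem InC.dopAux_spec {i : ℕ} {h : OT Γ} (hh : InC x i h) :
    (∀ j, InCf j (dopAux x i h j)) ∧ (i = 0 → ∀ χ : OSub Γ [], Admissible χ →
      ev χ (h.setOne x) ≤ ev χ (dopAux x 0 h 0)) := by
  have hfree : ∀ (h : OT Γ) (i : ℕ), InCf i h → h.hasVar x = false →
      (∀ j, InCf j (dopAux x i h j)) ∧ (i = 0 → ∀ χ : OSub Γ [], Admissible χ →
        ev χ (h.setOne x) ≤ ev χ (dopAux x 0 h 0)) := by
    intro h i hC hx
    refine ⟨fun j => ?_, fun _ χ _ => ?_⟩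
    · rw [dopAux_of_free hx]
      split_ifs with hij
      · subst hij
        exact .add _ _ _ hC (.one _)
      · exact .one _
    · rw [dopAux_of_free hx, if_pos rfl, setOne_of_free hx, ev_add]
      exact le_add_of_nonneg_right (NatOrd.zero_le _)
  induction hh with
  | one i => exact hfree _ _ (.one i) rfl
  | omega i hi => exact hfree _ _ (.omega i hi) rfl
  | var y k =>
    by_cases hx : (OT.var y k).hasVar x = true
    · rw [OT.hasVar, beq_iff_eq] at hx
      obtain ⟨rfl, -⟩ := Var.idx_inj x y hx
      refine ⟨fun j => ?_, fun _ χ _ => ?_⟩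
      · rw [dopAux_var_self _ _ _ _ hx]
        exact .one _
      · rw [dopAux_var_self _ _ _ _ hx, OT.setOne, OT.subst, if_pos hx]
    · exact hfree _ _ (.var y k) (by simpa using hx)
  | add i f g hfC hgC hf hg =>
    by_cases hx : (OT.add f g).hasVar x = true
    · refine ⟨fun j => ?_, fun hi χ hχ => ?_⟩
      · rw [dopAux, if_pos hx]
        exact .add _ _ _ (.add _ _ _ (hf.1 j) (hg.1 j)) (.one _)
      · rw [dopAux, if_pos hx, setOne_add, ev_add, ev_add, ev_add]
        exact (add_le_add (hf.2 hi χ hχ) (hg.2 hi χ hχ)).trans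
          (le_add_of_nonneg_right (NatOrd.zero_le _))
    · exact hfree _ _ (.add _ _ _ hfC.inCf hgC.inCf) (by simpa using hx)
  | expMul i f g hi hfC hgC hf hg =>
    by_cases hx : (OT.expMul f g).hasVar x = true
    · refine ⟨fun j => ?_, fun h0 => by omega⟩
      rw [dopAux, if_pos hx]
      exact .add _ _ _ (.add _ _ _ (.add _ _ _ (hf.1 j) (hf.1 j)) (hg.1 j)) (.one _)
    · exact hfree _ _ (.expMul _ _ _ hi hfC.inCf hgC.inCf) (by simpa using hx)
  | psi f g hfC hgC hn hf hg =>
    by_cases hx : (OT.psi f g).hasVar x = true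
    · have hle := hg.2 rfl
      refine ⟨fun j => ?_, fun _ χ hχ => ?_⟩
      · rw [dopAux, if_pos hx]
        split_ifs with hj
        · subst hj
          refine .psi _ _ hfC.inCf.setOne (hg.1 0) fun χ hχ => ?_
          obtain ⟨m, hm⟩ := InCf.nat hχ (hg.1 0)
          -- The bound for no(f{x:=1}) is known relative to g{x:=1}. It carries over because (δ g)₀
          -- is at least g{x:=1}.
          obtain ⟨k, hk, hfk⟩ := NormLeF2.spec hχ (hn.subst (adm_setOne x))
          refine ⟨m, congrArg NatOrd.ord hm, hfk.trans (F_mono 2 ?_)⟩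
          have := hle χ hχ
          rw [hm] at this
          exact Nat.cast_le.1 (hk.symm.trans_le this)
        · exact .add _ _ _ (hf.1 j) (hg.1 j)
      · rw [dopAux, if_pos hx, if_pos rfl, setOne_psi, ev_psi, ev_psi, Nat.cast_le]
        obtain ⟨m, hm⟩ := InCf.nat hχ (hg.1 0)
        obtain ⟨k, hk⟩ := InCf.nat hχ (hgC.inCf.setOne (x := x))
        have := hle χ hχ
        rw [hm, hk] at this ⊢
        exact collapse_mono_right (below_ev hχ _) (Nat.cast_le.1 this)
    · exact hfree _ _ (.psi _ _ hfC.inCf hgC.inCf hn) (by simpa using hx)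
  | ofZero i h hi hC hx _ => exact hfree _ _ (.ofZero _ _ hi hC.inCf) hx

/-- The norm of the parts of a tower is controlled by the norm of the tower. -/
theorem tower_four_le_normBound {Θ b : ℕ → NatOrd} {θ : ℕ → ℕ} (hΘ : ∀ j, Below (Θ j))
    (hb : ∀ j, Below (b j)) (h1 : ∀ j, 1 ≤ j → 1 ≤ Θ j) (hθ : ∀ j, 1 ≤ j → θ j ≤ (Θ j).no)
    {k N : ℕ} (hN : (tower NatOrd.exp Θ b k 1).no + k ≤ N) :
    tower (fun n : ℕ => 4 ^ n) θ (fun j => (b j).no) k 1 ≤ normBound N := by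
  refine le_trans ?_ (F_two_two_pow_mul_le_normBound N)
  have hM : 2 ^ k * (tower NatOrd.exp Θ b k 1).no ≤ 2 ^ N * N :=
    Nat.mul_le_mul (Nat.pow_le_pow_right two_pos (by omega)) (by omega)
  refine tower_four_le (by omega) (by omega) (fun j hj hjk => ?_) (fun j hj hjk => ?_)
  · have := NatOrd.no_le_two_pow_mul_no_tower hΘ hb k 1 j h1 hj hjk
    have := hθ j hj
    omega
  · have := NatOrd.no_le_two_pow_mul_no_tower hΘ hb k 1 j h1 hj hjk.le
    rw [if_pos hjk] at this
    have := hθ j hj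
    omega

/-- The tower over the components of `δˣᵢ h`. -/
noncomputable def dopTower (x : Var Γ σ) (χ : OSub Γ []) (i : ℕ) (h : OT Γ) : NatOrd :=
  tower NatOrd.exp (fun j => ev χ (dopAux x i h j)) (evv χ (OVec.var x)) σ.lv 1

/-- The finite summand that accompanies `dopTower`. -/
noncomputable def dopConst (x : Var Γ σ) (χ : OSub Γ []) (h : OT Γ) : ℕ :=
  (ev χ (dopAux x 0 h 0)).no + (evv χ (OVec.var x) 0).no + σ.lv

theorem below_dopTower (hχ : Admissible χ) (i : ℕ) (h : OT Γ) : Below (dopTower x χ i h) :=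
  below_tower (fun _ => below_ev hχ _) (hχ.good_var x).below _ _

theorem one_le_ev_dopAux (i : ℕ) (h : OT Γ) (j : ℕ) (hj : 1 ≤ j) : 1 ≤ ev χ (dopAux x i h j) :=
  isInterp_ev.one_le_dopAux isExp_exp h i j (by omega)

theorem one_le_dopTower (i : ℕ) (h : OT Γ) : 1 ≤ dopTower x χ i h :=
  (one_le_ev_dopAux i h 1 le_rfl).trans (le_tower isExp_exp _ _ _ _)

/-- Comparing collapses requires a bound for the smaller argument in terms of the norm of the larger
one. The tower for h is decomposed into its entries, at the cost of 2^(lv x), and the tower for f is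
built up again from them. -/
theorem no_dopTower_le (hχ : Admissible χ) {i : ℕ} {f h : OT Γ}
    (hle : ∀ j, 1 ≤ j → (ev χ (dopAux x i f j)).no ≤ (ev χ (dopAux x 0 h j)).no) {N : ℕ}
    (hN : (dopTower x χ 0 h).no + σ.lv ≤ N) : (dopTower x χ i f).no ≤ normBound N :=
  (NatOrd.no_tower_le (fun _ => below_ev hχ _) (hχ.good_var x).below _ _).trans
    (tower_four_le_normBound (fun _ => below_ev hχ _) (hχ.good_var x).below
      (one_le_ev_dopAux 0 h) hle hN)

/-- The value of a term in `Cˣ₀` is dominated by a value of `ψ` over the components of `δˣ₀`. -/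
theorem InC.ev_lt_collapse (hχ : Admissible χ) {h : OT Γ} (hh : InC x 0 h) :
    ev χ h < (collapse (NatOrd.omega * dopTower x χ 0 h + dopConst x χ h) : NatOrd) := by
  have hsmall : ∀ (h : OT Γ) (m : ℕ), ev χ h = m → m ≤ dopConst x χ h →
      ev χ h < (collapse (NatOrd.omega * dopTower x χ 0 h + dopConst x χ h) : NatOrd) := by
    intro h m hm hle
    rw [hm, Nat.cast_lt]
    have := add_lt_collapse (below_dopTower (x := x) hχ 0 h) (one_le_dopTower (x := x) 0 h)
      (dopConst x χ h)
    omega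
  have hfree : ∀ h : OT Γ, InCf 0 h → h.hasVar x = false →
      ev χ h < (collapse (NatOrd.omega * dopTower x χ 0 h + dopConst x χ h) : NatOrd) := by
    intro h hC hx
    obtain ⟨m, hm⟩ := InCf.nat hχ hC
    refine hsmall h m hm ?_
    rw [dopConst, dopAux_of_free hx, if_pos rfl, ev_add, hm, ev_one,
      NatOrd.no_add (below_natCast m) NatOrd.below_one, NatOrd.no_nat]
    omega
  -- The index is generalised so that the induction on membership in Cˣ applies.
  obtain ⟨i, hi⟩ : ∃ i, i = 0 := ⟨0, rfl⟩
  rw [← hi] at hh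
  induction hh with
  | one i => exact hfree _ (.one _) rfl
  | omega i _ => omega
  | var y k =>
    by_cases hx : (OT.var y k).hasVar x = true
    · rw [OT.hasVar, beq_iff_eq] at hx
      obtain ⟨rfl, hy⟩ := Var.idx_inj x y hx
      obtain rfl := eq_of_heq hy
      obtain rfl : k = 0 := Fin.ext hi
      refine hsmall _ (evv χ (OVec.var y) 0).no ?_ ?_
      · rw [(hχ.good_var y).no_zero_eq]
        exact (evv_var 0).symm
      · unfold dopConst
        omega
    · refine hfree _ ?_ (by simpa using hx)
      have := InCf.var y k
      rwa [hi] at this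
  | add i f g hfC hgC hf hg =>
    subst hi
    by_cases hx : (OT.add f g).hasVar x = true
    · have hf := hf rfl
      have hg := hg rfl
      obtain ⟨mf, hmf⟩ := InCf.nat hχ hfC.inCf
      obtain ⟨mg, hmg⟩ := InCf.nat hχ hgC.inCf
      rw [hmf, Nat.cast_lt] at hf
      rw [hmg, Nat.cast_lt] at hg
      rw [ev_add, hmf, hmg, ← Nat.cast_add, Nat.cast_lt]
      have hbf := below_dopTower (x := x) hχ 0 f
      have hbg := below_dopTower (x := x) hχ 0 g
      have hdop : ∀ j, ev χ (dopAux x 0 (.add f g) j) =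
          ev χ (dopAux x 0 f j) + ev χ (dopAux x 0 g j) + 1 := by
        intro j
        rw [dopAux, if_pos hx]
        rfl
      have hno : ∀ j, (ev χ (dopAux x 0 (.add f g) j)).no =
          (ev χ (dopAux x 0 f j)).no + (ev χ (dopAux x 0 g j)).no + 1 := by
        intro j
        have h1 := below_ev hχ (dopAux x 0 f j)
        have h2 := below_ev hχ (dopAux x 0 g j)
        rw [hdop, NatOrd.no_add (h1.add h2) NatOrd.below_one, NatOrd.no_add h1 h2, NatOrd.no_one]
      -- Strictness comes from the summand 1 in δ(f+g): superadditivity is applied once more, to the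
      -- constant sequence 1, whose tower is at least 1.
      have hT : dopTower x χ 0 f + dopTower x χ 0 g < dopTower x χ 0 (.add f g) := by
        refine NatOrd.add_one_le_iff.1 ?_
        have h1 := tower_add isExp_exp (one_le_ev_dopAux (χ := χ) (x := x) 0 f)
          (one_le_ev_dopAux (χ := χ) (x := x) 0 g) (g := evv χ (OVec.var x)) σ.lv
        have h2 := tower_add isExp_exp (f := fun j => ev χ (dopAux x 0 f j) +
          ev χ (dopAux x 0 g j)) (f' := fun _ => 1) (g := evv χ (OVec.var x)) (i := 1)
          (fun j hj => (one_le_ev_dopAux 0 f j hj).trans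
            (le_add_of_nonneg_right (NatOrd.zero_le _))) (fun _ _ => le_rfl) σ.lv
        simp only [← hdop] at h2
        exact (add_le_add h1 (le_tower isExp_exp (fun _ => 1) _ _ _)).trans h2
      set N := (dopTower x χ 0 (.add f g)).no + dopConst x χ (.add f g) with hN
      have hlv : σ.lv ≤ dopConst x χ (.add f g) := by
        unfold dopConst
        omega
      have hnf : (dopTower x χ 0 f).no ≤ normBound N :=
        no_dopTower_le hχ (h := .add f g) (fun j _ => by rw [hno]; omega) (by omega)
      have hng : (dopTower x χ 0 g).no ≤ normBound N :=
        no_dopTower_le hχ (h := .add f g) (fun j _ => by rw [hno]; omega) (by omega)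
      have hNb := add_le_normBound N
      have hc : dopConst x χ f + dopConst x χ g ≤ 2 * dopConst x χ (.add f g) := by
        unfold dopConst
        rw [hno]
        omega
      -- The two values of ψ are added inside one collapse. The finite summand may double, which is
      -- harmless since the coefficient of ω increases strictly.
      calc mf + mg
          ≤ collapse (NatOrd.omega * dopTower x χ 0 f + dopConst x χ f) +
            collapse (NatOrd.omega * dopTower x χ 0 g + dopConst x χ g) :=
            add_le_add hf.le hg.le
        _ ≤ collapse (NatOrd.omega * dopTower x χ 0 f + dopConst x χ f +
              (NatOrd.omega * dopTower x χ 0 g + dopConst x χ g)) :=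
            psi_add_le (below_collapse hbf _) (below_collapse hbg _)
        _ = collapse (NatOrd.omega * (dopTower x χ 0 f + dopTower x χ 0 g) +
              (dopConst x χ f + dopConst x χ g : ℕ)) := by
            congr 1
            push_cast
            ring
        _ < collapse (NatOrd.omega * dopTower x χ 0 (.add f g) +
              (dopConst x χ (.add f g) : ℕ)) := by
            refine collapse_lt_of_lt (hbf.add hbg) (below_dopTower hχ 0 _) hT (x := N) le_rfl
              (by omega) ?_
            rw [NatOrd.no_add hbf hbg]
            omega
    · exact hfree _ (.add _ _ _ hfC.inCf hgC.inCf) (by simpa using hx)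
  | expMul i f g h1 _ _ _ _ => omega
  | psi f g hfC hgC hn _ hg =>
    by_cases hx : (OT.psi f g).hasVar x = true
    · have hg := hg rfl
      obtain ⟨mg, hmg⟩ := InCf.nat hχ hgC.inCf
      rw [hmg, Nat.cast_lt] at hg
      rw [ev_psi, hmg, Nat.cast_lt]
      have hbg := below_dopTower (x := x) hχ 0 g
      have hbf := below_ev hχ f
      have hdop : ∀ j, 1 ≤ j → ev χ (dopAux x 0 (.psi f g) j) =
          ev χ (dopAux x 1 f j) + ev χ (dopAux x 0 g j) := by
        intro j hj
        rw [dopAux, if_pos hx, if_neg (by omega)]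
        rfl
      have hno : ∀ j, 1 ≤ j → (ev χ (dopAux x 0 (.psi f g) j)).no =
          (ev χ (dopAux x 1 f j)).no + (ev χ (dopAux x 0 g j)).no := by
        intro j hj
        rw [hdop j hj, NatOrd.no_add (below_ev hχ _) (below_ev hχ _)]
      have hfT : ev χ f < dopTower x χ 1 f := by
        have := (isInterp_ev (χ := χ)).lt_tower isExp_exp hfC le_rfl (by omega)
        rwa [Nat.add_sub_cancel] at this
      have hfN := (isInterp_no hχ).lt_tower isExp_four_pow hfC le_rfl (by omega)
      rw [Nat.add_sub_cancel] at hfN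
      have hT : ev χ f + dopTower x χ 0 g < dopTower x χ 0 (.psi f g) := by
        refine lt_of_lt_of_le (add_lt_add_of_lt_of_le hfT le_rfl)
          ((tower_add isExp_exp (one_le_ev_dopAux (χ := χ) (x := x) 1 f)
            (one_le_ev_dopAux (χ := χ) (x := x) 0 g) (g := evv χ (OVec.var x)) σ.lv).trans
            (tower_mono isExp_exp ?_ fun _ _ _ => le_rfl))
        intro j hj _
        exact (hdop j hj).ge
      set N := (dopTower x χ 0 (.psi f g)).no + dopConst x χ (.psi f g) with hN
      have hlv : σ.lv ≤ dopConst x χ (.psi f g) := by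
        unfold dopConst
        omega
      have hng : (dopTower x χ 0 g).no ≤ normBound N :=
        no_dopTower_le hχ (h := .psi f g) (fun j hj => by rw [hno j hj]; omega) (by omega)
      -- The norm of f need not be bounded by a value of g below the present one, so it is estimated
      -- by the tower over the norms of δ f, whose entries are parts of the tower for the whole
      -- term.
      have hnf : (ev χ f).no ≤ normBound N :=
        hfN.le.trans (tower_four_le_normBound (fun _ => below_ev hχ _) (hχ.good_var x).below
          (one_le_ev_dopAux 0 (.psi f g)) (fun j hj => by rw [hno j hj]; omega)
          (by unfold dopTower at hN; omega))
      have hc : dopConst x χ g ≤ dopConst x χ (.psi f g) := by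
        obtain ⟨k, hk⟩ := InCf.nat hχ (hgC.dopAux_spec.1 0)
        unfold dopConst
        have : dopAux x 0 (.psi f g) 0 = .psi (f.setOne x) (dopAux x 0 g 0) := by
          rw [dopAux, if_pos hx, if_pos rfl]
        rw [this, ev_psi, hk, NatOrd.no_nat, NatOrd.no_nat]
        have := le_collapse (below_ev hχ (f.setOne x)) k
        omega
      have hNb := add_le_normBound N
      -- The finite value of g is replaced by its bound, a value of ψ, which is then absorbed. In
      -- the coefficient of ω the term f lies below its tower, and the two towers are merged by
      -- superadditivity.
      calc collapse (NatOrd.omega * ev χ f + mg)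
          ≤ collapse (NatOrd.omega * ev χ f +
              (collapse (NatOrd.omega * dopTower x χ 0 g + dopConst x χ g) : ℕ)) :=
            collapse_mono_right hbf hg.le
        _ ≤ collapse (NatOrd.omega * ev χ f +
              (NatOrd.omega * dopTower x χ 0 g + dopConst x χ g)) :=
            psi_add_psi_le (NatOrd.below_omega.mul hbf) (below_collapse hbg _)
        _ = collapse (NatOrd.omega * (ev χ f + dopTower x χ 0 g) + dopConst x χ g) := by
            congr 1
            ring
        _ < collapse (NatOrd.omega * dopTower x χ 0 (.psi f g) +
              (dopConst x χ (.psi f g) : ℕ)) := by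
            refine collapse_lt_of_lt (hbf.add hbg) (below_dopTower hχ 0 _) hT (x := N) le_rfl
              (by omega) ?_
            rw [NatOrd.no_add hbf hbg]
            omega
    · exact hfree _ (.psi _ _ hfC.inCf hgC.inCf hn) (by simpa using hx)
  | ofZero i h h1 _ _ _ => omega

/-- The norm of the components of `δˣᵢ h`. -/
theorem InC.no_dopAux_le (hχ : Admissible χ) {i : ℕ} {h : OT Γ} (hh : InC x i h) {j : ℕ}
    (hj : 1 ≤ j) (hjn : j ≤ σ.lv + 1) :
    (ev χ (dopAux x i h j)).no ≤
      2 ^ (σ.lv + 1 - (i - 1)) * h.sz x * (ev χ (h.setOne x)).no := by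
  have hpos : ∀ {i : ℕ} {h : OT Γ}, InCf i h → 1 ≤ (ev χ (h.setOne x)).no := fun hC =>
    NatOrd.one_le_no (below_ev hχ _) (InCf.one_le hχ hC.setOne)
  have hpow : ∀ k, 1 ≤ 2 ^ k := fun k => Nat.one_le_two_pow
  have hfree : ∀ {i : ℕ} {h : OT Γ}, InCf i h → h.hasVar x = false →
      (ev χ (dopAux x i h j)).no ≤
        2 ^ (σ.lv + 1 - (i - 1)) * h.sz x * (ev χ (h.setOne x)).no := by
    intro i h hC hx
    have h1 := hpos hC
    rw [dopAux_of_free hx, sz_of_free hx, mul_one]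
    rw [setOne_of_free hx] at h1 ⊢
    split_ifs with hij
    · rw [ev_add, ev_one, NatOrd.no_add (below_ev hχ h) NatOrd.below_one, NatOrd.no_one]
      have h2 : 2 ^ 1 ≤ 2 ^ (σ.lv + 1 - (i - 1)) := Nat.pow_le_pow_right two_pos (by omega)
      nlinarith
    · rw [ev_one, NatOrd.no_one]
      exact Nat.mul_pos (hpow _) h1
  induction hh with
  | one i => exact hfree (.one i) rfl
  | omega i hi => exact hfree (.omega i hi) rfl
  | var y k =>
    by_cases hx : (OT.var y k).hasVar x = true
    · rw [OT.hasVar, beq_iff_eq] at hx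
      obtain ⟨rfl, hy⟩ := Var.idx_inj x y hx
      have h1 := hpos (.var y k)
      rw [dopAux_var_self _ _ _ _ hx, ev_one, NatOrd.no_one, OT.sz, mul_one]
      exact Nat.mul_pos (hpow _) h1
    · exact hfree (.var y k) (by simpa using hx)
  | add i f g hfC hgC hf hg =>
    by_cases hx : (OT.add f g).hasVar x = true
    · have h1 := below_ev hχ (dopAux x i f j)
      have h2 := below_ev hχ (dopAux x i g j)
      have h3 := hpos hfC.inCf
      have h4 := hpos hgC.inCf
      have h5 := hpow (σ.lv + 1 - (i - 1))
      rw [dopAux, if_pos hx, OT.sz, if_pos hx, setOne_add, ev_add, ev_add, ev_one, ev_add,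
        NatOrd.no_add (h1.add h2) NatOrd.below_one, NatOrd.no_add h1 h2, NatOrd.no_one,
        NatOrd.no_add (below_ev hχ _) (below_ev hχ _)]
      generalize 2 ^ (σ.lv + 1 - (i - 1)) = c at *
      generalize (ev χ (f.setOne x)).no = u at *
      generalize (ev χ (g.setOne x)).no = v at *
      generalize f.sz x = p at *
      generalize g.sz x = q at *
      calc _ ≤ c * p * u + c * q * v + 1 := by omega
        _ ≤ c * p * u + c * q * v + c * (u + v) := by nlinarith
        _ ≤ c * p * u + c * q * v + c * (u + v) + (c * p * v + c * q * u) := Nat.le_add_right _ _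
        _ = c * (p + q + 1) * (u + v) := by ring
    · exact hfree (.add _ _ _ hfC.inCf hgC.inCf) (by simpa using hx)
  | expMul i f g hi hfC hgC hf hg =>
    by_cases hx : (OT.expMul f g).hasVar x = true
    · have hil : i ≤ σ.lv := by
        by_contra hlt
        rw [OT.hasVar, hfC.hasVar_eq_false (by omega), hgC.hasVar_eq_false (by omega)] at hx
        simp at hx
      have h1 := below_ev hχ (dopAux x (i + 1) f j)
      have h2 := below_ev hχ (dopAux x i g j)
      have hbf := below_ev hχ (f.setOne x)
      have hbg := below_ev hχ (g.setOne x)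
      have h3 : (ev χ (f.setOne x)).no ≤
          2 * (NatOrd.exp (ev χ (f.setOne x)) * ev χ (g.setOne x)).no :=
        (NatOrd.no_le_two_mul_no_exp hbf).trans (Nat.mul_le_mul_left 2
          (NatOrd.le_no_mul hbf.exp hbg (InCf.one_le hχ hgC.inCf.setOne)))
      have h4 : (ev χ (g.setOne x)).no ≤
          (NatOrd.exp (ev χ (f.setOne x)) * ev χ (g.setOne x)).no := by
        rw [mul_comm]
        exact NatOrd.le_no_mul hbg hbf.exp (isExp_exp.one_le _)
      have h6 := hpos hgC.inCf
      have h5 := hpow (σ.lv + 1 - i)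
      -- The norm of f may be twice that of 2^f · g, and f stands at the next index, where the power
      -- of 2 is half as large; the two effects cancel. Truncation in i - 1 gives indices 0 and 1
      -- the same power, as ψ causes no such loss.
      have hc : 2 ^ (σ.lv + 1 - (i - 1)) = 2 * 2 ^ (σ.lv + 1 - i) := by
        rw [← pow_succ']
        congr 1
        omega
      rw [dopAux, if_pos hx, OT.sz, if_pos hx, setOne_expMul, ev_add, ev_add, ev_one, ev_nsmul,
        ev_expMul, Nat.cast_two, two_mul, NatOrd.no_add ((h1.add h1).add h2) NatOrd.below_one,
        NatOrd.no_add (h1.add h1) h2, NatOrd.no_add h1 h1, NatOrd.no_one, hc]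
      rw [hc] at hg
      rw [Nat.add_sub_cancel] at hf
      generalize 2 ^ (σ.lv + 1 - i) = c at *
      generalize (NatOrd.exp (ev χ (f.setOne x)) * ev χ (g.setOne x)).no = w at *
      generalize (ev χ (f.setOne x)).no = u at *
      generalize (ev χ (g.setOne x)).no = v at *
      generalize f.sz x = p at *
      generalize g.sz x = q at *
      have h7 : c * p * u ≤ c * p * (2 * w) := Nat.mul_le_mul_left _ h3
      have h8 : 2 * c * q * v ≤ 2 * c * q * w := Nat.mul_le_mul_left _ h4
      have h9 : 1 ≤ 2 * c * w := by nlinarith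
      calc _ ≤ c * p * (2 * w) + c * p * (2 * w) + 2 * c * q * w + 2 * c * w := by omega
        _ = 2 * c * (2 * p + q + 1) * w := by ring
    · exact hfree (.expMul _ _ _ hi hfC.inCf hgC.inCf) (by simpa using hx)
  | psi f g hfC hgC hn hf hg =>
    by_cases hx : (OT.psi f g).hasVar x = true
    · have h1 := below_ev hχ (dopAux x 1 f j)
      have h2 := below_ev hχ (dopAux x 0 g j)
      obtain ⟨k, hk, hfk⟩ := NormLeF2.spec hχ (hn.subst (adm_setOne x))
      have hk : ev χ (g.setOne x) = k := hk
      have hfk : (ev χ (f.setOne x)).no ≤ F 2 k := hfk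
      have hbf := below_ev hχ (f.setOne x)
      -- The side condition no(f) ≼ F₂(g) puts the norm of f{x:=1} below Φ(k), hence below the value
      -- of ψ.
      have h3 : (ev χ (f.setOne x)).no ≤ collapse (NatOrd.omega * ev χ (f.setOne x) + k) :=
        (lt_psi_of_le_Phi hbf (InCf.one_le hχ hfC.inCf.setOne)
          (hfk.trans (F_two_le_Phi le_rfl))).le
      have h4 := le_collapse hbf k
      have h5 : (ev χ (g.setOne x)).no = k := by rw [hk, NatOrd.no_nat]
      have h6 := hpow (σ.lv + 1)
      rw [dopAux, if_pos hx, if_neg (by omega), OT.sz, if_pos hx, setOne_psi, ev_add, ev_psi,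
        NatOrd.no_nat, NatOrd.no_add h1 h2, hk]
      rw [h5] at hg
      simp only [Nat.sub_self, Nat.zero_sub, Nat.sub_zero] at *
      generalize 2 ^ (σ.lv + 1) = c at *
      generalize collapse (NatOrd.omega * ev χ (f.setOne x) + k) = w at *
      generalize f.sz x = p at *
      generalize g.sz x = q at *
      calc _ ≤ c * p * w + c * q * w :=
            add_le_add (hf.trans (Nat.mul_le_mul_left _ h3)) (hg.trans (Nat.mul_le_mul_left _ h4))
        _ ≤ c * p * w + c * q * w + c * w := Nat.le_add_right _ _
        _ = c * (p + q + 1) * w := by ring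
    · exact hfree (.psi _ _ hfC.inCf hgC.inCf hn) (by simpa using hx)
  | ofZero i h hi hC hx _ => exact hfree (.ofZero _ _ hi hC.inCf) hx

end Dop

end GodelT

namespace GodelT

open NatOrd (Below collapse psi_lt psi_le below_collapse below_natCast below_tower isExp_exp
  no_tower_le_F)

/-! # Regular vectors -/

theorem Good.add {l m : ℕ} {f g : ℕ → NatOrd} (hf : Good l f) (hg : Good m g) :
    Good (max l m) fun i => f i + g i where
  pos i hi := by
    rcases le_max_iff.1 hi with h | h
    · exact (hf.pos i h).trans (le_add_of_nonneg_right (NatOrd.zero_le _))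
    · exact (hg.pos i h).trans (le_add_of_nonneg_left (NatOrd.zero_le _))
  below i := (hf.below i).add (hg.below i)
  nat := by
    obtain ⟨k, hk⟩ := hf.nat
    obtain ⟨m, hm⟩ := hg.nat
    exact ⟨k + m, by rw [hk, hm, Nat.cast_add]⟩
  norm i := by
    rw [NatOrd.no_add (hf.below i) (hg.below i), NatOrd.no_add (hf.below 0) (hg.below 0)]
    exact add_le_add (hf.norm i) (hg.norm i)

section Get

variable {Γ Δ : Ctx}

theorem OVec.get_subst (s : OSub Γ Δ) (v : OVec Γ) (i : ℕ) :
    (v.subst s).get i = (v.get i).subst s := by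
  by_cases h : i ≤ v.lv
  · rw [get_of_le (v := v.subst s) h, get_of_le h]
    rfl
  · rw [get_of_lt (v := v.subst s) (not_le.1 h), get_of_lt (not_le.1 h)]
    rfl

theorem OVec.get_restrict (v : OVec Γ) {l i : ℕ} (h : i ≤ l) : (v.restrict l).get i = v.get i :=
  get_of_le (v := v.restrict l) h

theorem OVec.get_add {v w : OVec Γ} {i : ℕ} (h : i ≤ max v.lv w.lv) :
    (v.add w).get i = if w.lv < i then v.get i else if v.lv < i then w.get i
      else .add (v.get i) (w.get i) :=
  get_of_le (v := v.add w) h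

theorem OVec.get_box {f g : OVec Γ} {i : ℕ} (h : i ≤ f.lv) :
    (f.box g).get i = if i = 0 then
      .psi (boxAux f g g.lv 1) (OT.addNat (.add (f.get 0) (g.get 0)) g.lv)
      else boxAux f g (g.lv + 1 - i) i :=
  get_of_le (v := f.box g) h

theorem OVec.get_dop {σ : Ty} {x : Var Γ σ} {h : OVec Γ} {j : ℕ}
    (hj : j ≤ max (σ.lv + 1) h.lv) :
    (h.dop x).get j = if j = 0 then OT.nsmul (h.S x) (dopAux x 0 (h.get 0) 0)
      else if j ≤ σ.lv + 1 then OT.sumUpTo (fun i => dopAux x i (h.get i) j) h.lv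
      else h.get j :=
  get_of_le (v := h.dop x) hj

theorem OVec.ext_get {v w : OVec Γ} (h : v.lv = w.lv) (hg : ∀ i ≤ v.lv, v.get i = w.get i) :
    v = w := by
  obtain ⟨l, v⟩ := v
  obtain ⟨m, w⟩ := w
  obtain rfl : l = m := h
  congr 1
  funext i
  have := hg i (Nat.le_of_lt_succ i.2)
  rwa [get_of_le (v := ⟨l, v⟩) (Nat.le_of_lt_succ i.2),
    get_of_le (v := ⟨l, w⟩) (Nat.le_of_lt_succ i.2)] at this

end Get

/-- Vectors the closed instances of which belong to the class `B` and are of bounded norm. -/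
structure OVec.Regular {Γ : Ctx} (v : OVec Γ) : Prop where
  inCf : ∀ i ≤ v.lv, InCf i (v.get i)
  norm : ∀ χ : OSub Γ [], Admissible χ → ∀ i, (evv χ v i).no ≤ (evv χ v 0).no

theorem OVec.lt_iff {Γ : Ctx} {v w : OVec Γ} :
    v.Lt w ↔ ∀ χ : OSub Γ [], Admissible χ → VLt (evv χ v) (evv χ w) :=
  ⟨fun h χ hχ => ⟨h.1 χ hχ, fun i hi => h.2 i hi χ hχ⟩,
    fun h => ⟨fun χ hχ => (h χ hχ).1, fun i hi χ hχ => (h χ hχ).2 i hi⟩⟩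

section Regular

variable {Γ Δ : Ctx}

theorem OVec.Regular.good {v : OVec Γ} (hv : v.Regular) {χ : OSub Γ []} (hχ : Admissible χ) :
    Good v.lv (evv χ v) where
  pos i hi := (hv.inCf i hi).one_le hχ
  below _ := below_ev hχ _
  nat := (hv.inCf 0 (Nat.zero_le _)).nat hχ
  norm := hv.norm χ hχ

theorem evv_subst (χ : OSub Δ []) (s : OSub Γ Δ) (v : OVec Γ) :
    evv χ (v.subst s) = evv (χ.comp s) v := by
  funext i
  rw [evv, OVec.get_subst, ev_subst]
  rfl

theorem OVec.Regular.subst {v : OVec Γ} (hv : v.Regular) {s : OSub Γ Δ} (hs : Adm s) :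
    (v.subst s).Regular where
  inCf i hi := by
    rw [OVec.get_subst]
    exact (hv.inCf i hi).subst hs
  norm χ hχ i := by
    rw [evv_subst]
    exact hv.norm _ (hs.comp χ hχ) i

theorem OVec.Lt.subst {v w : OVec Γ} (h : v.Lt w) {s : OSub Γ Δ} (hs : Adm s) :
    (v.subst s).Lt (w.subst s) := by
  rw [OVec.lt_iff] at h ⊢
  intro χ hχ
  rw [evv_subst, evv_subst]
  exact h _ (hs.comp χ hχ)

theorem OVec.Regular.add {v w : OVec Γ} (hv : v.Regular) (hw : w.Regular) :
    (v.add w).Regular where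
  inCf i hi := by
    have hi : i ≤ max v.lv w.lv := hi
    rw [OVec.get_add hi]
    split_ifs with h1 h2
    · exact hv.inCf i (by omega)
    · exact hw.inCf i (by omega)
    · exact .add _ _ _ (hv.inCf i (by omega)) (hw.inCf i (by omega))
  norm χ hχ i := by
    rw [evv_add, evv_add]
    exact ((hv.good hχ).add (hw.good hχ)).norm i

theorem OVec.Regular.restrict {v : OVec Γ} (hv : v.Regular) {l : ℕ} (h : l ≤ v.lv) :
    (v.restrict l).Regular where
  inCf i hi := by
    have hi : i ≤ l := hi
    rw [OVec.get_restrict v hi]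
    exact hv.inCf i (hi.trans h)
  norm χ hχ i := by
    rw [evv_restrict]
    exact ((hv.good hχ).vres h).norm i

/-- The alternative in `hk` separates the positions inside the tower, which ends at lv g + 1, from
the components of f beyond it. -/
theorem InCf.boxAux {f g : OVec Γ} (hf : f.Regular) (hg : g.Regular) (h : g.lv < f.lv)
    (k i : ℕ) (hi : 1 ≤ i) (hk : i + k = g.lv + 1 ∨ k = 0 ∧ i ≤ f.lv) :
    InCf i (GodelT.boxAux f g k i) := by
  induction k generalizing i with
  | zero => exact hf.inCf i (by omega)
  | succ k ih =>
    exact .expMul _ _ _ hi (ih (i + 1) (by omega) (by omega))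
      (.add _ _ _ (hf.inCf i (by omega)) (hg.inCf i (by omega)))

theorem InCf.nsmul {i n : ℕ} {h : OT Γ} (hn : 1 ≤ n) (hh : InCf i h) :
    InCf i (OT.nsmul n h) := by
  induction n, hn using Nat.le_induction with
  | base => exact hh
  | succ n hn ih =>
    obtain ⟨m, rfl⟩ := Nat.exists_eq_add_of_le' hn
    exact .add _ _ _ ih hh

theorem InCf.addNat {i : ℕ} {h : OT Γ} (hh : InCf i h) (n : ℕ) : InCf i (OT.addNat h n) := by
  cases n with
  | zero => exact hh
  | succ n => exact .add _ _ _ hh (.nsmul (by omega) (.one i))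

theorem InCf.sumUpTo {i m : ℕ} {c : ℕ → OT Γ} (hc : ∀ j ≤ m, InCf i (c j)) :
    InCf i (OT.sumUpTo c m) := by
  induction m with
  | zero => exact hc 0 le_rfl
  | succ m ih => exact .add _ _ _ (ih fun j hj => hc j (by omega)) (hc _ le_rfl)

theorem OVec.Regular.box {f g : OVec Γ} (hf : f.Regular) (hg : g.Regular) (h : g.lv < f.lv) :
    (f.box g).Regular where
  inCf i hi := by
    have hi : i ≤ f.lv := hi
    rw [OVec.get_box hi]
    split_ifs with h0
    · subst h0
      refine .psi _ _ (.boxAux hf hg h _ _ le_rfl (by omega))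
        (.addNat (.add _ _ _ (hf.inCf 0 (Nat.zero_le _)) (hg.inCf 0 (Nat.zero_le _))) _)
        fun χ hχ => ?_
      have hf' := hf.good hχ
      have hg' := hg.good hχ
      refine ⟨(evv χ f 0).no + (evv χ g 0).no + g.lv, congrArg NatOrd.ord
        (?_ : ev χ (OT.addNat _ _) = (_ : ℕ)), ?_⟩
      · rw [ev_addNat, ev_add]
        push_cast
        rw [hf'.no_zero_eq, hg'.no_zero_eq]
        rfl
      -- The side condition of the ψ-clause holds because the finite argument bounds both the norms
      -- of the entries and the height of the tower.
      · have := ev_boxAux χ f g g.lv 1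
        refine (congrArg NatOrd.no this).trans_le ?_
        exact hf'.no_tower_le hg' _ _ (by omega) (by omega)
    · exact .boxAux hf hg h _ _ (by omega) (by omega)
  norm χ hχ i := by
    rw [evv_box χ h]
    exact ((hf.good hχ).vbox (hg.good hχ) h).norm i

theorem OVec.regular_var {σ : Ty} (x : Var Γ σ) : (OVec.var x).Regular where
  inCf i hi := by
    rw [OVec.get_of_le hi]
    exact .var x ⟨i, _⟩
  norm _ hχ := (hχ.good_var x).norm

end Regular

/-! # The operator `δˣ` on vectors -/

section Dop

variable {Γ : Ctx} {σ : Ty} {x : Var Γ σ} {χ : OSub Γ []} {h : OVec Γ}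

theorem evv_dop_zero : evv χ (h.dop x) 0 = h.S x * ev χ (dopAux x 0 (h.get 0) 0) := by
  rw [evv, OVec.get_dop (Nat.zero_le _), if_pos rfl, ev_nsmul]

theorem evv_dop_of_le {j : ℕ} (h0 : 0 < j) (hj : j ≤ σ.lv + 1) :
    evv χ (h.dop x) j = ∑ i ∈ Finset.range (h.lv + 1), ev χ (dopAux x i (h.get i) j) := by
  rw [evv, OVec.get_dop (by omega), if_neg h0.ne', if_pos hj, ev_sumUpTo]

theorem evv_dop_of_lt {j : ℕ} (hj : σ.lv + 1 < j) : evv χ (h.dop x) j = evv χ h j := by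
  by_cases hjm : j ≤ h.lv
  · rw [evv, OVec.get_dop (by omega), if_neg (by omega), if_neg (by omega)]
    rfl
  · rw [evv_of_lt χ (v := h.dop x), evv_of_lt χ (not_le.1 hjm)]
    exact max_lt hj (not_le.1 hjm)

theorem OVec.one_le_S : 1 ≤ h.S x := by
  refine Nat.mul_pos (by positivity) ?_
  rw [Finset.sum_range_succ]
  exact Nat.add_pos_right _ (one_le_sz _)

theorem no_sum_le {f : ℕ → NatOrd} (hf : ∀ i, Below (f i)) (m : ℕ) :
    Below (∑ i ∈ Finset.range m, f i) ∧
      (∑ i ∈ Finset.range m, f i).no = ∑ i ∈ Finset.range m, (f i).no := by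
  induction m with
  | zero => exact ⟨NatOrd.below_zero, NatOrd.no_zero⟩
  | succ m ih =>
    rw [Finset.sum_range_succ, Finset.sum_range_succ, NatOrd.no_add ih.1 (hf m), ih.2]
    exact ⟨ih.1.add (hf m), rfl⟩

/-- Regularity of h, applied at x := 1, bounds the norms of all hᵢ{x:=1} by h₀{x:=1}, which is at
most (δ₀h₀)₀. Passing from hᵢ{x:=1} to δᵢhᵢ costs the factors counted in `OVec.S`, and component 0
is multiplied by exactly these. -/
theorem OVec.Regular.dop (hh : h.Regular) (hC : h.IsC x) : (h.dop x).Regular where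
  inCf j hj := by
    have hj : j ≤ max (σ.lv + 1) h.lv := hj
    rw [OVec.get_dop hj]
    split_ifs with h0 hn
    · subst h0
      exact .nsmul one_le_S ((hC 0 (Nat.zero_le _)).dopAux_spec.1 0)
    · exact .sumUpTo fun i hi => (hC i hi).dopAux_spec.1 j
    · exact hh.inCf j (by omega)
  norm χ hχ j := by
    have hg := hh.good ((adm_setOne x).comp χ hχ)
    have hset : ∀ i, ev χ ((h.get i).setOne x) = evv (χ.comp fun _ y i =>
        if y.idx = x.idx then OT.one else OT.var y i) h i := fun i => ev_subst _ _ _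
    have h0 := (hC 0 (Nat.zero_le _)).dopAux_spec
    obtain ⟨k, hk⟩ := (h0.1 0).nat hχ
    have hle := h0.2 rfl χ hχ
    rw [hset, ← hg.no_zero_eq, hk, Nat.cast_le] at hle
    have hS := OVec.one_le_S (x := x) (h := h)
    rw [evv_dop_zero, hk, ← Nat.cast_mul, NatOrd.no_nat]
    rcases Nat.eq_zero_or_pos j with rfl | hj
    · rw [evv_dop_zero, hk, ← Nat.cast_mul, NatOrd.no_nat]
    rcases le_or_gt j (σ.lv + 1) with hjn | hjn
    · rw [evv_dop_of_le hj hjn, (no_sum_le (fun i => below_ev hχ _) _).2]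
      calc _ ≤ ∑ i ∈ Finset.range (h.lv + 1), 2 ^ (σ.lv + 1) * (h.get i).sz x * k := by
            refine Finset.sum_le_sum fun i hi => ?_
            have hi : i ≤ h.lv := Nat.lt_succ_iff.1 (Finset.mem_range.1 hi)
            refine ((hC i hi).no_dopAux_le hχ hj hjn).trans ?_
            rw [hset]
            exact Nat.mul_le_mul (Nat.mul_le_mul_right _ (Nat.pow_le_pow_right two_pos
              (Nat.sub_le _ _))) ((hg.norm i).trans hle)
        _ = h.S x * k := by
            rw [OVec.S, Finset.mul_sum, Finset.sum_mul]
    · rw [evv_dop_of_lt hjn]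
      have : (evv χ h j).no ≤ k := by
        refine le_trans ?_ ((hg.norm j).trans hle)
        rw [← hset]
        rcases le_or_gt j h.lv with hjm | hjm
        -- Beyond lv x + 1 the components are copied unchanged; they are x-free, so their norm is
        -- not affected by setting x to 1.
        · rw [setOne_of_free ((hC j hjm).hasVar_eq_false (by omega))]
          rfl
        · rw [evv_of_lt χ hjm, NatOrd.no_zero]
          exact Nat.zero_le _
      exact this.trans (Nat.le_mul_of_pos_left _ hS)

/-- The decisive property of the operator `δˣ`. -/
theorem OVec.Regular.vlt_vbox_dop (hh : h.Regular) (hC : h.IsC x) (hχ : Admissible χ) {m : ℕ}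
    {k : ℕ → NatOrd} (hk : Good m k) :
    VLt (evv χ h) (vbox (fun j => evv χ (h.dop x) j + k j) (evv χ (OVec.var x)) σ.lv) := by
  have hb := hχ.good_var x
  have hD := ((hh.dop hC).good hχ).add hk
  have hle : ∀ i ≤ h.lv, ∀ j, 1 ≤ j → j ≤ σ.lv + 1 →
      ev χ (dopAux x i (h.get i) j) ≤ evv χ (h.dop x) j + k j := by
    intro i hi j h1 hj
    rw [evv_dop_of_le h1 hj]
    exact (Finset.single_le_sum (f := fun i => ev χ (dopAux x i (h.get i) j))
      (fun _ _ => NatOrd.zero_le _) (Finset.mem_range.2 (Nat.lt_succ_of_le hi))).trans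
      (le_add_of_nonneg_right (NatOrd.zero_le _))
  refine ⟨?_, fun i hi => ?_⟩
  · have h0 := hC 0 (Nat.zero_le _)
    refine (h0.ev_lt_collapse hχ).trans_le ?_
    rw [vbox_zero hD hb, Nat.cast_le]
    -- The inequality is strict because k has a positive component 0. It makes the finite summand of
    -- the collapse increase strictly.
    have hno : (ev χ (dopAux x 0 (h.get 0) 0)).no < (evv χ (h.dop x) 0 + k 0).no := by
      rw [NatOrd.no_add (((hh.dop hC).good hχ).below 0) (hk.below 0), evv_dop_zero]
      obtain ⟨c, hc⟩ := (h0.dopAux_spec.1 0).nat hχ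
      rw [hc, ← Nat.cast_mul, NatOrd.no_nat, NatOrd.no_nat]
      have := hk.one_le_no_zero
      have := Nat.le_mul_of_pos_left c (OVec.one_le_S (x := x) (h := h))
      omega
    have hpos := hD.one_le_no_zero
    have hpos' := hb.one_le_no_zero
    refine (collapse_lt_of_le (below_dopTower hχ 0 _) (below_tower hD.below hb.below _ _)
      (tower_mono isExp_exp (fun j h1 hj => hle 0 (Nat.zero_le _) j h1 (by omega))
        fun _ _ _ => le_rfl) (by unfold dopConst; omega) ?_).le
    -- The components of δ₀h₀ are summands of those of δˣh, whose norms are bounded by component 0.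
    have hnoj : ∀ j, 1 ≤ j → j ≤ 1 + σ.lv → (ev χ (dopAux x 0 (h.get 0) j)).no ≤
        (evv χ (h.dop x) 0 + k 0).no := by
      intro j h1 hj
      refine le_trans ?_ (hD.norm j)
      rw [NatOrd.no_add (((hh.dop hC).good hχ).below j) (hk.below j), evv_dop_of_le h1 (by omega),
        (no_sum_le (fun i => below_ev hχ _) _).2]
      exact (Finset.single_le_sum (f := fun i => (ev χ (dopAux x i (h.get i) j)).no)
        (fun _ _ => Nat.zero_le _) (Finset.mem_range.2 (Nat.succ_pos _))).trans
        (Nat.le_add_right _ _)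
    refine no_tower_le_F (fun _ => below_ev hχ _) hb.below (by omega) (by omega)
      (fun j h1 hj => (hnoj j h1 hj).trans (by omega)) fun j h1 hj => ?_
    have := hnoj j h1 (by omega)
    have := hb.norm j
    omega
  · rw [vbox_of_pos _ _ _ hi]
    rcases lt_or_ge h.lv i with him | him
    · rw [evv_of_lt χ him]
      exact NatOrd.zero_le _
    rcases le_or_gt i (σ.lv + 1) with hin | hin
    · refine ((isInterp_ev (χ := χ)).lt_tower isExp_exp (hC i him) hi hin).le.trans
        (tower_mono isExp_exp (fun j h1 hj => hle i him j (by omega) (by omega))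
          fun _ _ _ => le_rfl)
    · rw [show σ.lv + 1 - i = 0 by omega]
      refine le_trans ?_ (le_tower isExp_exp _ _ _ _)
      rw [evv_dop_of_lt hin]
      exact le_add_of_nonneg_right (NatOrd.zero_le _)

-- The vector δˣh is x-free.

theorem hasVar_setOne (h : OT Γ) : (h.setOne x).hasVar x = false := by
  induction h with
  | var y i =>
    rw [OT.setOne, OT.subst]
    split_ifs with he
    · rfl
    · simpa [OT.hasVar] using he
  | zero => rfl
  | one => rfl
  | omega => rfl
  | add f g hf hg => rw [setOne_add, OT.hasVar, hf, hg]; rfl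
  | expMul f g hf hg => rw [setOne_expMul, OT.hasVar, hf, hg]; rfl
  | psi f g hf hg => rw [setOne_psi, OT.hasVar, hf, hg]; rfl

theorem hasVar_dopAux (h : OT Γ) (i j : ℕ) : (dopAux x i h j).hasVar x = false := by
  have hfree : ∀ (h : OT Γ) (i j : ℕ), h.hasVar x = false →
      (dopAux x i h j).hasVar x = false := by
    intro h i j hx
    rw [dopAux_of_free hx]
    split_ifs
    · rw [OT.hasVar, hx]
      rfl
    · rfl
  induction h generalizing i j with
  | var y k =>
    by_cases hx : (OT.var y k).hasVar x = true
    · rw [dopAux, if_pos hx]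
      rfl
    · exact hfree _ _ _ (by simpa using hx)
  | zero => exact hfree _ _ _ rfl
  | one => exact hfree _ _ _ rfl
  | omega => exact hfree _ _ _ rfl
  | add f g hf hg =>
    by_cases hx : (OT.add f g).hasVar x = true
    · rw [dopAux, if_pos hx]
      simp [OT.hasVar, hf, hg]
    · exact hfree _ _ _ (by simpa using hx)
  | expMul f g hf hg =>
    by_cases hx : (OT.expMul f g).hasVar x = true
    · rw [dopAux, if_pos hx]
      simp [OT.hasVar, OT.nsmul, hf, hg]
    · exact hfree _ _ _ (by simpa using hx)
  | psi f g hf hg =>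
    by_cases hx : (OT.psi f g).hasVar x = true
    · rw [dopAux, if_pos hx]
      split_ifs <;> simp [OT.hasVar, hasVar_setOne, hf, hg]
    · exact hfree _ _ _ (by simpa using hx)

theorem ev_of_free {h : OT Γ} (hx : h.hasVar x = false) {χ χ' : OSub Γ []}
    (hχ : ∀ (ρ : Ty) (y : Var Γ ρ), y.idx ≠ x.idx → χ ρ y = χ' ρ y) : ev χ h = ev χ' h := by
  induction h with
  | var y i =>
    rw [OT.hasVar, beq_eq_false_iff_ne] at hx
    rw [ev, ev, OT.subst, OT.subst, hχ _ y hx]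
  | zero => rfl
  | one => rfl
  | omega => rfl
  | add f g hf hg =>
    rw [OT.hasVar, Bool.or_eq_false_iff] at hx
    rw [ev_add, ev_add, hf hx.1, hg hx.2]
  | expMul f g hf hg =>
    rw [OT.hasVar, Bool.or_eq_false_iff] at hx
    rw [ev_expMul, ev_expMul, hf hx.1, hg hx.2]
  | psi f g hf hg =>
    rw [OT.hasVar, Bool.or_eq_false_iff] at hx
    rw [ev_psi, ev_psi, hf hx.1, hg hx.2]

/-- If `h ∈ Cˣ`, then `δˣ h` is `x`-free. -/
theorem OVec.IsC.evv_dop_congr (hC : h.IsC x) {χ χ' : OSub Γ []}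
    (hχ : ∀ (ρ : Ty) (y : Var Γ ρ), y.idx ≠ x.idx → χ ρ y = χ' ρ y) :
    evv χ (h.dop x) = evv χ' (h.dop x) := by
  funext j
  rcases Nat.eq_zero_or_pos j with rfl | hj
  · rw [evv_dop_zero, evv_dop_zero, ev_of_free (hasVar_dopAux _ _ _) hχ]
  rcases le_or_gt j (σ.lv + 1) with hjn | hjn
  · rw [evv_dop_of_le hj hjn, evv_dop_of_le hj hjn]
    exact Finset.sum_congr rfl fun i _ => ev_of_free (hasVar_dopAux _ _ _) hχ
  · rw [evv_dop_of_lt hjn, evv_dop_of_lt hjn]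
    rcases le_or_gt j h.lv with hjm | hjm
    · exact ev_of_free ((hC j hjm).hasVar_eq_false (by omega)) hχ
    · rw [evv_of_lt χ hjm, evv_of_lt χ' hjm]

end Dop

end GodelT

namespace GodelT

/-! # Substitution in terms -/

theorem Ren.lift_comp {Γ Δ Θ : Ctx} (r : Ren Γ Δ) (q : Ren Δ Θ) (ρ : Ty) :
    (fun σ x => q.lift ρ σ (r.lift ρ σ x)) = Ren.lift (fun σ x => q σ (r σ x)) ρ := by
  funext σ x
  cases x <;> rfl

theorem Tm.rename_rename {Γ Δ Θ : Ctx} {σ : Ty} (A : Tm Γ σ) (r : Ren Γ Δ) (q : Ren Δ Θ) :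
    (A.rename r).rename q = A.rename fun σ x => q σ (r σ x) := by
  induction A generalizing Δ Θ with
  | app B C hB hC => simp only [Tm.rename, hB, hC]
  | lam G hG => simp only [Tm.rename, hG, Ren.lift_comp]
  | Rsup τ t ht => simp only [Tm.rename, ht]
  | _ => rfl

theorem Tm.subst_rename {Γ Δ Θ : Ctx} {σ : Ty} (A : Tm Γ σ) (r : Ren Γ Δ) (s : Sub Δ Θ) :
    (A.rename r).subst s = A.subst fun σ x => s σ (r σ x) := by
  induction A generalizing Δ Θ with
  | app B C hB hC => simp only [Tm.rename, Tm.subst, hB, hC]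
  | lam G hG =>
    simp only [Tm.rename, Tm.subst, hG]
    congr 2
    funext σ x
    cases x <;> rfl
  | Rsup τ t ht => simp only [Tm.rename, Tm.subst, ht]
  | _ => rfl

theorem Tm.rename_subst {Γ Δ Θ : Ctx} {σ : Ty} (A : Tm Γ σ) (s : Sub Γ Δ) (r : Ren Δ Θ) :
    (A.subst s).rename r = A.subst fun σ x => (s σ x).rename r := by
  induction A generalizing Δ Θ with
  | app B C hB hC => simp only [Tm.rename, Tm.subst, hB, hC]
  | lam G hG =>
    simp only [Tm.rename, Tm.subst, hG]
    congr 2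
    funext σ x
    cases x with
    | zero => rfl
    | succ y =>
      simp only [Sub.lift, Tm.rename_rename]
      rfl
  | Rsup τ t ht => simp only [Tm.rename, Tm.subst, ht]
  | _ => rfl

theorem Tm.subst_subst {Γ Δ Θ : Ctx} {σ : Ty} (A : Tm Γ σ) (s : Sub Γ Δ) (t : Sub Δ Θ) :
    (A.subst s).subst t = A.subst fun σ x => (s σ x).subst t := by
  induction A generalizing Δ Θ with
  | app B C hB hC => simp only [Tm.subst, hB, hC]
  | lam G hG =>
    simp only [Tm.subst, hG]
    congr 2
    funext σ x
    cases x with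
    | zero => rfl
    | succ y =>
      simp only [Sub.lift, Tm.subst_rename, Tm.rename_subst]
      rfl
  | Rsup τ u hu => simp only [Tm.subst, hu]
  | _ => rfl

theorem Tm.subst_var {Γ : Ctx} {σ : Ty} (A : Tm Γ σ) : A.subst (fun _ x => .var x) = A := by
  have hl : ∀ (Γ : Ctx) (ρ : Ty),
      Sub.lift (fun _ x => Tm.var x) ρ = fun (σ : Ty) (x : Var (ρ :: Γ) σ) => Tm.var x := by
    intro Γ ρ
    funext σ x
    cases x <;> rfl
  induction A with
  | app B C hB hC => simp only [Tm.subst, hB, hC]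
  | lam G hG => simp only [Tm.subst, hl, hG]
  | Rsup τ u hu => simp only [Tm.subst, hu]
  | _ => rfl

theorem Tm.rename_eq_subst {Γ Δ : Ctx} {σ : Ty} (A : Tm Γ σ) (r : Ren Γ Δ) :
    A.rename r = A.subst fun σ x => .var (r σ x) := by
  have := A.subst_rename r fun _ x => .var x
  rwa [Tm.subst_var] at this

theorem Tm.inst_subst {Γ Δ : Ctx} {ρ σ : Ty} (G : Tm (ρ :: Γ) σ) (H : Tm Γ ρ) (s : Sub Γ Δ) :
    (G.inst H).subst s = (G.subst (s.lift ρ)).inst (H.subst s) := by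
  rw [Tm.inst, Tm.inst, Tm.subst_subst, Tm.subst_subst]
  congr 1
  funext τ x
  cases x with
  | zero => rfl
  | succ y =>
    simp only [Sub.lift, Tm.subst_rename]
    exact (Tm.subst_var _).symm

theorem Reduces.subst {Γ Δ : Ctx} {σ : Ty} {A B : Tm Γ σ} (h : Reduces A B) (s : Sub Γ Δ) :
    Reduces (A.subst s) (B.subst s) := by
  obtain ⟨r⟩ := h
  induction r generalizing Δ with
  | D0 A B => exact ⟨.D0 _ _⟩
  | DS t A B => exact ⟨.DS _ _ _⟩
  | R t => exact ⟨.R _⟩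
  | R0 A B => exact ⟨.R0 _ _⟩
  | RS t A B => exact ⟨.RS _ _ _⟩
  | beta G H =>
    rw [Tm.inst_subst]
    exact ⟨.beta _ _⟩
  | appr C _ ih =>
    obtain ⟨r⟩ := ih s
    exact ⟨.appr _ r⟩
  | appl A _ ih =>
    obtain ⟨r⟩ := ih s
    exact ⟨.appl _ r⟩
  | appR τ _ ih =>
    obtain ⟨r⟩ := ih s
    exact ⟨.appR _ r⟩
  | xi _ ih =>
    obtain ⟨r⟩ := ih (s.lift _)
    exact ⟨.xi r⟩

theorem Reduces.rename {Γ Δ : Ctx} {σ : Ty} {A B : Tm Γ σ} (h : Reduces A B) (r : Ren Γ Δ) :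
    Reduces (A.rename r) (B.rename r) := by
  rw [Tm.rename_eq_subst, Tm.rename_eq_subst]
  exact h.subst _

/-! ## Occurrences of variables -/

theorem Tm.Occurs.of_rename {Γ Δ : Ctx} {σ : Ty} {A : Tm Γ σ} {r : Ren Γ Δ} {k : ℕ}
    (h : (A.rename r).Occurs k) : ∃ (ρ : Ty) (x : Var Γ ρ), (r ρ x).idx = k ∧ A.Occurs x.idx := by
  induction A generalizing Δ k with
  | var x => exact ⟨_, x, h, rfl⟩
  | app B C hB hC =>
    rcases h with h | h
    · obtain ⟨ρ, x, h1, h2⟩ := hB h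
      exact ⟨ρ, x, h1, .inl h2⟩
    · obtain ⟨ρ, x, h1, h2⟩ := hC h
      exact ⟨ρ, x, h1, .inr h2⟩
  | lam G hG =>
    obtain ⟨ρ, x, h1, h2⟩ := hG (r := r.lift _) (k := k + 1) h
    cases x with
    | zero => exact absurd h1 (Nat.succ_ne_zero k).symm
    | succ y => exact ⟨ρ, y, Nat.succ_injective h1, h2⟩
  | Rsup τ t ht => exact ht h
  | _ => exact h.elim

theorem Tm.OccursInRsup.of_rename {Γ Δ : Ctx} {σ : Ty} {A : Tm Γ σ} {r : Ren Γ Δ} {k : ℕ}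
    (h : (A.rename r).OccursInRsup k) :
    ∃ (ρ : Ty) (x : Var Γ ρ), (r ρ x).idx = k ∧ A.OccursInRsup x.idx := by
  induction A generalizing Δ k with
  | app B C hB hC =>
    rcases h with h | h
    · obtain ⟨ρ, x, h1, h2⟩ := hB h
      exact ⟨ρ, x, h1, .inl h2⟩
    · obtain ⟨ρ, x, h1, h2⟩ := hC h
      exact ⟨ρ, x, h1, .inr h2⟩
  | lam G hG =>
    obtain ⟨ρ, x, h1, h2⟩ := hG (r := r.lift _) (k := k + 1) h
    cases x with
    | zero => exact absurd h1 (Nat.succ_ne_zero k).symm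
    | succ y => exact ⟨ρ, y, Nat.succ_injective h1, h2⟩
  | Rsup τ t _ => exact Tm.Occurs.of_rename (A := t) h
  | _ => exact h.elim

theorem Tm.Occurs.of_subst {Γ Δ : Ctx} {σ : Ty} {A : Tm Γ σ} {s : Sub Γ Δ} {k : ℕ}
    (h : (A.subst s).Occurs k) :
    ∃ (ρ : Ty) (x : Var Γ ρ), (s ρ x).Occurs k ∧ A.Occurs x.idx := by
  induction A generalizing Δ k with
  | var x => exact ⟨_, x, h, rfl⟩
  | app B C hB hC =>
    rcases h with h | h
    · obtain ⟨ρ, x, h1, h2⟩ := hB h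
      exact ⟨ρ, x, h1, .inl h2⟩
    · obtain ⟨ρ, x, h1, h2⟩ := hC h
      exact ⟨ρ, x, h1, .inr h2⟩
  | lam G hG =>
    obtain ⟨ρ, x, h1, h2⟩ := hG (s := s.lift _) (k := k + 1) h
    cases x with
    | zero => exact absurd h1 (Nat.succ_ne_zero k).symm
    | succ y =>
      obtain ⟨τ, z, h3, h4⟩ := Tm.Occurs.of_rename h1
      obtain rfl : z.idx = k := Nat.succ_injective h3
      exact ⟨ρ, y, h4, h2⟩
  | Rsup τ t ht => exact ht h
  | _ => exact h.elim

/-- An occurrence inside some Rᵗ of the instance is either brought along by a substituted term, or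
arises because a replaced variable stood inside an Rᵗ. -/
theorem Tm.OccursInRsup.of_subst {Γ Δ : Ctx} {σ : Ty} {A : Tm Γ σ} {s : Sub Γ Δ} {k : ℕ}
    (h : (A.subst s).OccursInRsup k) :
    ∃ (ρ : Ty) (x : Var Γ ρ), (s ρ x).OccursInRsup k ∨
      (s ρ x).Occurs k ∧ A.OccursInRsup x.idx := by
  induction A generalizing Δ k with
  | var x => exact ⟨_, x, .inl h⟩
  | app B C hB hC =>
    rcases h with h | h
    · obtain ⟨ρ, x, h1⟩ := hB h
      exact ⟨ρ, x, h1.imp_right fun h2 => ⟨h2.1, .inl h2.2⟩⟩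
    · obtain ⟨ρ, x, h1⟩ := hC h
      exact ⟨ρ, x, h1.imp_right fun h2 => ⟨h2.1, .inr h2.2⟩⟩
  | lam G hG =>
    obtain ⟨ρ, x, h1⟩ := hG (s := s.lift _) (k := k + 1) h
    cases x with
    | zero =>
      rcases h1 with h1 | h1
      · exact h1.elim
      · exact absurd h1.1 (Nat.succ_ne_zero k).symm
    | succ y =>
      refine ⟨ρ, y, ?_⟩
      rcases h1 with h1 | ⟨h1, h2⟩
      · obtain ⟨τ, z, h3, h4⟩ := Tm.OccursInRsup.of_rename h1
        obtain rfl : z.idx = k := Nat.succ_injective h3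
        exact .inl h4
      · obtain ⟨τ, z, h3, h4⟩ := Tm.Occurs.of_rename h1
        obtain rfl : z.idx = k := Nat.succ_injective h3
        exact .inr ⟨h4, h2⟩
  | Rsup τ t _ =>
    obtain ⟨ρ, x, h1, h2⟩ := Tm.Occurs.of_subst (A := t) h
    exact ⟨ρ, x, .inr ⟨h1, h2⟩⟩
  | _ => exact h.elim

theorem Tm.OccursInRsup.of_rename_lift {Γ Δ : Ctx} {ρ σ : Ty} {A : Tm (ρ :: Γ) σ}
    {r : Ren Γ Δ} (h : (A.rename (r.lift ρ)).OccursInRsup 0) : A.OccursInRsup 0 := by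
  obtain ⟨τ, x, h1, h2⟩ := h.of_rename
  cases x with
  | zero => exact h2
  | succ y => exact absurd h1 (Nat.succ_ne_zero _)

/-- Substituted terms are renamed away from the bound variable, so they cannot create occurrences of
it. -/
theorem Tm.OccursInRsup.of_subst_lift {Γ Δ : Ctx} {ρ σ : Ty} {A : Tm (ρ :: Γ) σ}
    {s : Sub Γ Δ} (h : (A.subst (s.lift ρ)).OccursInRsup 0) : A.OccursInRsup 0 := by
  obtain ⟨τ, x, h1⟩ := h.of_subst
  cases x with
  | zero => exact h1.elim False.elim And.right
  | succ y =>
    rcases h1 with h1 | ⟨h1, -⟩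
    · obtain ⟨_, z, h3, -⟩ := Tm.OccursInRsup.of_rename h1
      exact absurd h3 (Nat.succ_ne_zero _)
    · obtain ⟨_, z, h3, -⟩ := Tm.Occurs.of_rename h1
      exact absurd h3 (Nat.succ_ne_zero _)

end GodelT

namespace GodelT

/-! # Substitution in ordinal terms and vectors -/

/-- The substitution of ordinal variables that belongs to a renaming. -/
def OSub.ofRen {Γ Δ : Ctx} (r : Ren Γ Δ) : OSub Γ Δ := fun σ x i => .var (r σ x) i

/-- Extension of a substitution of ordinal terms under a binder. -/
def OSub.lift {Γ Δ : Ctx} (s : OSub Γ Δ) (ρ : Ty) : OSub (ρ :: Γ) (ρ :: Δ)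
  | _, .zero, i => .var .zero i
  | _, .succ x, i => (s _ x i).subst (OSub.ofRen (Ren.shift Δ ρ))

section Subst

variable {Γ Δ : Ctx}

theorem OSub.adm_ofRen (r : Ren Γ Δ) : Adm (OSub.ofRen r) :=
  .mk' (fun _ x i => .var (r _ x) i) fun _ hχ _ x i => hχ.no_le (r _ x) i

theorem OSub.adm_oneSub (Γ : Ctx) (ρ : Ty) : Adm (oneSub Γ ρ) := by
  refine .mk' (fun σ x i => ?_) fun χ hχ σ x i => ?_
  · cases x with
    | zero => exact .one _
    | succ y => exact .var y i
  · cases x with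
    | zero => exact le_rfl
    | succ y => exact hχ.no_le y i

theorem Adm.lift {s : OSub Γ Δ} (hs : Adm s) (ρ : Ty) : Adm (s.lift ρ) := by
  refine .mk' (fun σ x i => ?_) fun χ hχ σ x i => ?_
  · cases x with
    | zero => exact .var _ i
    | succ y => exact (hs.inCf _ y i).subst (OSub.adm_ofRen _)
  · cases x with
    | zero => exact hχ.no_le _ i
    | succ y =>
      rw [OSub.lift, OSub.lift, ev_subst, ev_subst]
      exact (hs.comp _ ((OSub.adm_ofRen _).comp χ hχ)).no_le y i

theorem OSub.lift_ofRen (r : Ren Γ Δ) (ρ : Ty) :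
    (OSub.ofRen r).lift ρ = OSub.ofRen (r.lift ρ) := by
  funext σ x i
  cases x <;> rfl

theorem OT.nsmul_subst (s : OSub Γ Δ) (n : ℕ) (h : OT Γ) :
    (OT.nsmul n h).subst s = OT.nsmul n (h.subst s) := by
  induction n using Nat.strong_induction_on with
  | _ n ih =>
    match n with
    | 0 => rfl
    | 1 => rfl
    | n + 2 => simp only [OT.nsmul, OT.subst, ih (n + 1) (Nat.lt_succ_self _)]

theorem OT.addNat_subst (s : OSub Γ Δ) (h : OT Γ) (n : ℕ) :
    (OT.addNat h n).subst s = OT.addNat (h.subst s) n := by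
  cases n with
  | zero => rfl
  | succ n => rw [OT.addNat, OT.addNat, OT.subst, OT.nsmul_subst, OT.subst]

theorem OT.sumUpTo_subst (s : OSub Γ Δ) (c : ℕ → OT Γ) (m : ℕ) :
    (OT.sumUpTo c m).subst s = OT.sumUpTo (fun i => (c i).subst s) m := by
  induction m with
  | zero => rfl
  | succ m ih => rw [OT.sumUpTo, OT.sumUpTo, OT.subst, ih]

theorem OVec.add_subst (s : OSub Γ Δ) (v w : OVec Γ) :
    (v.add w).subst s = (v.subst s).add (w.subst s) := by
  refine OVec.ext_get rfl fun i hi => ?_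
  have hi : i ≤ max v.lv w.lv := hi
  rw [OVec.get_subst, OVec.get_add hi, OVec.get_add (v := v.subst s) (w := w.subst s) hi,
    OVec.get_subst, OVec.get_subst]
  change _ = if w.lv < i then _ else if v.lv < i then _ else _
  split_ifs <;> rfl

theorem OVec.restrict_subst (s : OSub Γ Δ) (v : OVec Γ) (l : ℕ) :
    (v.restrict l).subst s = (v.subst s).restrict l := by
  refine OVec.ext_get rfl fun i hi => ?_
  have hi : i ≤ l := hi
  rw [OVec.get_subst, OVec.get_restrict _ hi, OVec.get_restrict _ hi, OVec.get_subst]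

theorem boxAux_subst (s : OSub Γ Δ) (f g : OVec Γ) (k i : ℕ) :
    (boxAux f g k i).subst s = boxAux (f.subst s) (g.subst s) k i := by
  induction k generalizing i with
  | zero => rw [boxAux, boxAux, OVec.get_subst]
  | succ k ih =>
    rw [boxAux, boxAux, OT.subst, OT.subst, ih, OVec.get_subst, OVec.get_subst]

theorem OVec.box_subst (s : OSub Γ Δ) (f g : OVec Γ) :
    (f.box g).subst s = (f.subst s).box (g.subst s) := by
  refine OVec.ext_get rfl fun i hi => ?_
  have hi : i ≤ f.lv := hi
  rw [OVec.get_subst, OVec.get_box hi, OVec.get_box (f := f.subst s) hi]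
  split_ifs
  · rw [OT.subst, boxAux_subst, OT.addNat_subst, OT.subst, OVec.get_subst, OVec.get_subst]
    rfl
  · exact boxAux_subst _ _ _ _ _

theorem OVec.subst_subst {Θ : Ctx} (s : OSub Γ Δ) (t : OSub Δ Θ) (v : OVec Γ) :
    (v.subst s).subst t = v.subst (t.comp s) := by
  refine OVec.ext_get rfl fun i _ => ?_
  rw [OVec.get_subst, OVec.get_subst, OVec.get_subst, OT.subst_subst]

theorem OT.subst_var (h : OT Γ) : h.subst (fun _ x i => .var x i) = h := by
  induction h with
  | add f g hf hg => simp only [OT.subst, hf, hg]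
  | expMul f g hf hg => simp only [OT.subst, hf, hg]
  | psi f g hf hg => simp only [OT.subst, hf, hg]
  | _ => rfl

theorem OVec.lift_oneSub (s : OSub Γ Δ) (ρ : Ty) (v : OVec (ρ :: Γ)) :
    (v.subst (s.lift ρ)).subst (oneSub Δ ρ) = (v.subst (oneSub Γ ρ)).subst s := by
  rw [OVec.subst_subst, OVec.subst_subst]
  congr 1
  funext σ x i
  cases x with
  | zero => rfl
  | succ y =>
    rw [OSub.comp, OSub.lift, OT.subst_subst]
    exact OT.subst_var _

variable {ρ : Ty}

theorem hasVar_ofRen_shift (h : OT Γ) :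
    (h.subst (OSub.ofRen (Ren.shift Γ ρ))).hasVar (Var.zero (Γ := Γ) (σ := ρ)) = false := by
  induction h with
  | add f g hf hg => rw [OT.subst, OT.hasVar, hf, hg]; rfl
  | expMul f g hf hg => rw [OT.subst, OT.hasVar, hf, hg]; rfl
  | psi f g hf hg => rw [OT.subst, OT.hasVar, hf, hg]; rfl
  | _ => rfl

theorem hasVar_subst_lift (s : OSub Γ Δ) (h : OT (ρ :: Γ)) :
    (h.subst (s.lift ρ)).hasVar (Var.zero (Γ := Δ) (σ := ρ)) =
      h.hasVar (Var.zero (Γ := Γ) (σ := ρ)) := by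
  induction h with
  | var x i =>
    cases x with
    | zero => rfl
    | succ y => exact hasVar_ofRen_shift _
  | add f g hf hg => rw [OT.subst, OT.hasVar, hf, hg]; rfl
  | expMul f g hf hg => rw [OT.subst, OT.hasVar, hf, hg]; rfl
  | psi f g hf hg => rw [OT.subst, OT.hasVar, hf, hg]; rfl
  | _ => rfl

theorem setOne_subst_lift (s : OSub Γ Δ) (h : OT (ρ :: Γ)) :
    (h.subst (s.lift ρ)).setOne (Var.zero (Γ := Δ) (σ := ρ)) =
      (h.setOne (Var.zero (Γ := Γ) (σ := ρ))).subst (s.lift ρ) := by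
  induction h with
  | var x i =>
    cases x with
    | zero => rfl
    | succ y => exact setOne_of_free (hasVar_ofRen_shift _)
  | add f g hf hg => rw [OT.subst, setOne_add, setOne_add, hf, hg]; rfl
  | expMul f g hf hg => rw [OT.subst, setOne_expMul, setOne_expMul, hf, hg]; rfl
  | psi f g hf hg => rw [OT.subst, setOne_psi, setOne_psi, hf, hg]; rfl
  | _ => rfl

theorem sz_subst_lift (s : OSub Γ Δ) (h : OT (ρ :: Γ)) :
    (h.subst (s.lift ρ)).sz (Var.zero (Γ := Δ) (σ := ρ)) =
      h.sz (Var.zero (Γ := Γ) (σ := ρ)) := by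
  have e := hasVar_subst_lift s h
  induction h with
  | var x i =>
    cases x with
    | zero => rfl
    | succ y => exact sz_of_free (hasVar_ofRen_shift _)
  | add f g hf hg =>
    rw [OT.subst] at e ⊢
    rw [OT.sz, OT.sz, e, hf (hasVar_subst_lift s f), hg (hasVar_subst_lift s g)]
  | expMul f g hf hg =>
    rw [OT.subst] at e ⊢
    rw [OT.sz, OT.sz, e, hf (hasVar_subst_lift s f), hg (hasVar_subst_lift s g)]
  | psi f g hf hg =>
    rw [OT.subst] at e ⊢
    rw [OT.sz, OT.sz, e, hf (hasVar_subst_lift s f), hg (hasVar_subst_lift s g)]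
  | _ => rfl

/-- The definition of δˣ branches on x-freeness, which a lifted substitution neither creates nor
destroys. On x-free terms the clause is uniform, so a variable replaced there by a compound term
makes no difference. -/
theorem dopAux_subst_lift (s : OSub Γ Δ) (h : OT (ρ :: Γ)) (i j : ℕ) :
    dopAux (Var.zero (Γ := Δ) (σ := ρ)) i (h.subst (s.lift ρ)) j =
      (dopAux (Var.zero (Γ := Γ) (σ := ρ)) i h j).subst (s.lift ρ) := by
  have hfree : ∀ (h : OT (ρ :: Γ)) (i j : ℕ), h.hasVar (Var.zero (Γ := Γ) (σ := ρ)) = false →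
      dopAux (Var.zero (Γ := Δ) (σ := ρ)) i (h.subst (s.lift ρ)) j =
        (dopAux (Var.zero (Γ := Γ) (σ := ρ)) i h j).subst (s.lift ρ) := by
    intro h i j hx
    rw [dopAux_of_free hx, dopAux_of_free (by rw [hasVar_subst_lift, hx])]
    split_ifs <;> rfl
  induction h generalizing i j with
  | var x k =>
    cases x with
    | zero => rfl
    | succ y => exact hfree _ _ _ rfl
  | add f g hf hg =>
    have e := hasVar_subst_lift s (.add f g)
    rw [OT.subst] at e ⊢
    rw [dopAux, dopAux, e, hf, hg]
    split_ifs <;> rfl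
  | expMul f g hf hg =>
    have e := hasVar_subst_lift s (.expMul f g)
    rw [OT.subst] at e ⊢
    rw [dopAux, dopAux, e, hf, hg]
    split_ifs <;> rfl
  | psi f g hf hg =>
    have e := hasVar_subst_lift s (.psi f g)
    rw [OT.subst] at e ⊢
    rw [dopAux, dopAux, e, hf, hg, hg, setOne_subst_lift]
    split_ifs <;> rfl
  | zero => exact hfree _ _ _ rfl
  | one => exact hfree _ _ _ rfl
  | omega => exact hfree _ _ _ rfl

theorem OVec.dop_subst_lift (s : OSub Γ Δ) (h : OVec (ρ :: Γ)) :
    (h.dop (Var.zero (Γ := Γ) (σ := ρ))).subst (s.lift ρ) =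
      (h.subst (s.lift ρ)).dop (Var.zero (Γ := Δ) (σ := ρ)) := by
  refine OVec.ext_get rfl fun j hj => ?_
  have hj : j ≤ max (ρ.lv + 1) h.lv := hj
  rw [OVec.get_subst, OVec.get_dop hj, OVec.get_dop (h := h.subst (s.lift ρ)) hj]
  split_ifs
  · rw [OT.nsmul_subst, ← dopAux_subst_lift, OVec.get_subst, OVec.S, OVec.S]
    simp only [OVec.get_subst, sz_subst_lift]
    rfl
  · rw [OT.sumUpTo_subst]
    simp only [OVec.get_subst, ← dopAux_subst_lift]
    rfl
  · exact (OVec.get_subst _ _ _).symm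

/-- After the shift the new variable does not occur, so the x-freeness required for passing from
index 0 to higher ones is automatic. -/
theorem InCf.inC_shift {i : ℕ} {h : OT Γ} (hh : InCf i h) :
    InC (Var.zero (Γ := Γ) (σ := ρ)) i (h.subst (OSub.ofRen (Ren.shift Γ ρ))) := by
  induction hh with
  | one i => exact .one i
  | omega i hi => exact .omega i hi
  | var y i => exact .var _ i
  | add i f g _ _ hf hg => exact .add i _ _ hf hg
  | expMul i f g hi _ _ hf hg => exact .expMul i _ _ hi hf hg
  | psi f g _ _ hn hf hg => exact .psi _ _ hf hg (hn.subst (OSub.adm_ofRen _))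
  | ofZero i h hi _ hh => exact .ofZero i _ hi hh (hasVar_ofRen_shift h)

theorem InC.subst_lift {s : OSub Γ Δ} (hs : Adm s) {i : ℕ} {h : OT (ρ :: Γ)}
    (hh : InC (Var.zero (Γ := Γ) (σ := ρ)) i h) :
    InC (Var.zero (Γ := Δ) (σ := ρ)) i (h.subst (s.lift ρ)) := by
  induction hh with
  | one i => exact .one i
  | omega i hi => exact .omega i hi
  | var y i =>
    cases y with
    | zero => exact .var _ i
    | succ y => exact (hs.inCf _ y i).inC_shift
  | add i f g _ _ hf hg => exact .add i _ _ hf hg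
  | expMul i f g hi _ _ hf hg => exact .expMul i _ _ hi hf hg
  | psi f g _ _ hn hf hg => exact .psi _ _ hf hg (hn.subst (hs.lift ρ))
  | ofZero i h hi _ hx hh => exact .ofZero i _ hi hh (by rw [hasVar_subst_lift, hx])

theorem OVec.IsC.subst_lift {s : OSub Γ Δ} (hs : Adm s) {h : OVec (ρ :: Γ)}
    (hh : h.IsC (Var.zero (Γ := Γ) (σ := ρ))) :
    (h.subst (s.lift ρ)).IsC (Var.zero (Γ := Δ) (σ := ρ)) := by
  intro i hi
  rw [OVec.get_subst]
  exact (hh i hi).subst_lift hs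

end Subst

/-- The vector assigned to `R_τ`, where `l` is the level of `τ`. -/
def OVec.recursor (Γ : Ctx) (l : ℕ) : OVec Γ :=
  ⟨l + 2, fun i => if (i : ℕ) = 0 then .add .one .one else if (i : ℕ) = l + 2 then .omega
    else .one⟩

/-- The vector `⟨f, 1, …, 1, f⟩` of level `l + 2`. -/
def OVec.recursorAt {Γ : Ctx} (l : ℕ) (f : OT Γ) : OVec Γ :=
  ⟨l + 2, fun i => if (i : ℕ) = 0 ∨ (i : ℕ) = l + 2 then f else .one⟩

theorem OVec.recursor_subst {Γ Δ : Ctx} (s : OSub Γ Δ) (l : ℕ) :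
    (OVec.recursor Γ l).subst s = OVec.recursor Δ l := by
  refine congrArg (OVec.mk (l + 2)) (funext fun i => ?_)
  simp only [OVec.recursor]
  split_ifs <;> rfl

theorem OVec.recursorAt_subst {Γ Δ : Ctx} (s : OSub Γ Δ) (l : ℕ) (f : OT Γ) :
    (OVec.recursorAt l f).subst s = OVec.recursorAt l (f.subst s) := by
  refine congrArg (OVec.mk (l + 2)) (funext fun i => ?_)
  simp only [OVec.recursorAt]
  split_ifs <;> rfl

/-! # Substitution in assignment derivations -/

mutual
  theorem PD.lv_vec : {Γ : Ctx} → {σ : Ty} → {A : Tm Γ σ} → (d : PD A) → d.vec.lv = σ.lv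
    | _, _, _, .var _ => rfl
    | _, _, _, .zero => rfl
    | _, _, _, .succ => rfl
    | _, _, _, .D τ => by
      simp only [PD.vec, Ty.lv]
      omega
    | _, _, _, .R τ => by
      simp only [PD.vec, Ty.lv]
      omega
    | _, _, _, .app _ _ => rfl
    | _, _, _, .Rsup τ _ => by
      simp only [PD.vec, Ty.lv]
      omega
    | _, .arr σ τ, _, .lam s => by
      change max (max (σ.lv + 1) s.firstVec.lv) s.lastVec.lv = max (σ.lv + 1) τ.lv
      rw [s.lv_firstVec, s.lv_lastVec]
      omega
  theorem PDSeq.lv_firstVec : {Γ : Ctx} → {σ : Ty} → {G : Tm Γ σ} → (s : PDSeq G) →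
      s.firstVec.lv = σ.lv
    | _, _, _, .single d => d.lv_vec
    | _, _, _, .snoc s _ => s.lv_firstVec
  theorem PDSeq.lv_lastVec : {Γ : Ctx} → {σ : Ty} → {G : Tm Γ σ} → (s : PDSeq G) →
      s.lastVec.lv = σ.lv
    | _, _, _, .single d => d.lv_vec
    | _, _, _, .snoc _ d => d.lv_vec
end

mutual
  theorem PD.vec_rename : {Γ Δ : Ctx} → {σ : Ty} → {A : Tm Γ σ} → (r : Ren Γ Δ) → (d : PD A) →
      (d.rename r).vec = d.vec.subst (OSub.ofRen r)
    | _, _, _, _, _, .var _ => rfl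
    | _, _, _, _, _, .zero => rfl
    | _, _, _, _, _, .succ => rfl
    | _, _, _, _, _, .D _ => rfl
    | _, _, _, _, _, .R τ => (OVec.recursor_subst _ τ.lv).symm
    | _, _, _, _, r, .app d e => by
      change ((d.rename r).vec.box (e.rename r).vec).restrict _ =
        ((d.vec.box e.vec).restrict _).subst _
      rw [d.vec_rename r, e.vec_rename r, OVec.restrict_subst, OVec.box_subst]
    | _, _, _, _, r, .Rsup τ d => by
      have := OVec.recursorAt_subst (OSub.ofRen r) τ.lv (d.vec.get 0)
      rw [← OVec.get_subst, ← d.vec_rename r] at this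
      exact this.symm
    | _, _, _, _, r, .lam s => by
      change (((s.rename (r.lift _)).firstVec.dop Var.zero).subst (oneSub _ _)).add
        ((s.rename (r.lift _)).lastVec.subst (oneSub _ _)) =
        (((s.firstVec.dop Var.zero).subst (oneSub _ _)).add
          (s.lastVec.subst (oneSub _ _))).subst _
      rw [s.firstVec_rename, s.lastVec_rename, OVec.add_subst,
        ← OSub.lift_ofRen, ← OVec.dop_subst_lift, OVec.lift_oneSub, OVec.lift_oneSub]
  theorem PDSeq.firstVec_rename : {Γ Δ : Ctx} → {σ : Ty} → {G : Tm Γ σ} → (r : Ren Γ Δ) →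
      (s : PDSeq G) → (s.rename r).firstVec = s.firstVec.subst (OSub.ofRen r)
    | _, _, _, _, r, .single d => d.vec_rename r
    | _, _, _, _, r, .snoc s _ => s.firstVec_rename r
  theorem PDSeq.lastVec_rename : {Γ Δ : Ctx} → {σ : Ty} → {G : Tm Γ σ} → (r : Ren Γ Δ) →
      (s : PDSeq G) → (s.rename r).lastVec = s.lastVec.subst (OSub.ofRen r)
    | _, _, _, _, r, .single d => d.vec_rename r
    | _, _, _, _, r, .snoc _ d => d.vec_rename r
end

/-- The substitution of ordinal terms that belongs to trees for the terms of a substitution. -/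
def PDSub.osub {Γ Δ : Ctx} {s : Sub Γ Δ} (p : PDSub s) : OSub Γ Δ :=
  fun σ x i => (p σ x).vec.get i

theorem PDSub.osub_lift {Γ Δ : Ctx} {s : Sub Γ Δ} (p : PDSub s) (ρ : Ty) :
    (p.lift ρ).osub = p.osub.lift ρ := by
  funext σ x i
  cases x with
  | zero =>
    exact OVec.get_of_le (v := OVec.var (Var.zero (Γ := Δ) (σ := ρ))) (Nat.le_of_lt_succ i.2)
  | succ y =>
    change ((p _ y).rename (Ren.shift Δ ρ)).vec.get i = ((p _ y).vec.get i).subst _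
    rw [PD.vec_rename, OVec.get_subst]

mutual
  -- Substitution of trees acts on vectors as substitution of the assigned vectors. At an
  -- abstraction this uses that δˣ commutes with lifted substitutions, as all members of the
  -- sequence are substituted into.
  theorem PD.vec_subst : {Γ Δ : Ctx} → {σ : Ty} → {A : Tm Γ σ} → {s : Sub Γ Δ} →
      (p : PDSub s) → (d : PD A) → (d.subst p).vec = d.vec.subst p.osub
    | _, _, _, _, _, p, .var x => by
      refine OVec.ext_get (p _ x).lv_vec fun i hi => ?_
      have hi := hi.trans_eq (p _ x).lv_vec
      have := OVec.get_of_le (v := OVec.var x) hi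
      exact (congrArg (OT.subst p.osub) this).symm.trans (OVec.get_subst _ _ _).symm
    | _, _, _, _, _, _, .zero => rfl
    | _, _, _, _, _, _, .succ => rfl
    | _, _, _, _, _, _, .D _ => rfl
    | _, _, _, _, _, _, .R τ => (OVec.recursor_subst _ τ.lv).symm
    | _, _, _, _, _, p, .app d e => by
      change ((d.subst p).vec.box (e.subst p).vec).restrict _ =
        ((d.vec.box e.vec).restrict _).subst _
      rw [d.vec_subst p, e.vec_subst p, OVec.restrict_subst, OVec.box_subst]
    | _, _, _, _, _, p, .Rsup τ d => by
      have := OVec.recursorAt_subst (p.osub) τ.lv (d.vec.get 0)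
      rw [← OVec.get_subst, ← d.vec_subst p] at this
      exact this.symm
    | _, _, _, _, _, p, .lam q => by
      change (((q.subst (p.lift _)).firstVec.dop Var.zero).subst (oneSub _ _)).add
        ((q.subst (p.lift _)).lastVec.subst (oneSub _ _)) =
        (((q.firstVec.dop Var.zero).subst (oneSub _ _)).add
          (q.lastVec.subst (oneSub _ _))).subst _
      rw [q.firstVec_subst, q.lastVec_subst, OVec.add_subst,
        PDSub.osub_lift, ← OVec.dop_subst_lift, OVec.lift_oneSub, OVec.lift_oneSub]
  theorem PDSeq.firstVec_subst : {Γ Δ : Ctx} → {σ : Ty} → {G : Tm Γ σ} → {s : Sub Γ Δ} →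
      (p : PDSub s) → (q : PDSeq G) → (q.subst p).firstVec = q.firstVec.subst p.osub
    | _, _, _, _, _, p, .single d => d.vec_subst p
    | _, _, _, _, _, p, .snoc q _ => q.firstVec_subst p
  theorem PDSeq.lastVec_subst : {Γ Δ : Ctx} → {σ : Ty} → {G : Tm Γ σ} → {s : Sub Γ Δ} →
      (p : PDSub s) → (q : PDSeq G) → (q.subst p).lastVec = q.lastVec.subst p.osub
    | _, _, _, _, _, p, .single d => d.vec_subst p
    | _, _, _, _, _, p, .snoc _ d => d.vec_subst p
end

theorem PDSeq.firstTm_rename : {Γ Δ : Ctx} → {σ : Ty} → {G : Tm Γ σ} → (r : Ren Γ Δ) →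
    (s : PDSeq G) → (s.rename r).firstTm = s.firstTm.rename r
  | _, _, _, _, _, .single _ => rfl
  | _, _, _, _, r, .snoc s _ => s.firstTm_rename r

theorem PDSeq.firstTm_subst : {Γ Δ : Ctx} → {σ : Ty} → {G : Tm Γ σ} → {s : Sub Γ Δ} →
    (p : PDSub s) → (q : PDSeq G) → (q.subst p).firstTm = q.firstTm.subst s
  | _, _, _, _, _, _, .single _ => rfl
  | _, _, _, _, _, p, .snoc q _ => q.firstTm_subst p

theorem OVec.regular_recursorAt {Γ : Ctx} {f : OT Γ} (l : ℕ) (hf : InCf 0 f) :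
    (OVec.recursorAt l f).Regular where
  inCf i hi := by
    rw [OVec.get_of_le hi]
    simp only [OVec.recursorAt]
    split_ifs with h
    · rcases h with rfl | rfl
      · exact hf
      · exact .ofZero _ _ (by omega) hf
    · exact .one i
  norm χ hχ i := by
    rcases le_or_gt i (l + 2) with hi | hi
    · rw [evv, evv, OVec.get_of_le (v := OVec.recursorAt l f) hi,
        OVec.get_of_le (v := OVec.recursorAt l f) (Nat.zero_le _)]
      simp only [OVec.recursorAt, true_or, if_true]
      split_ifs
      · exact le_rfl
      · rw [ev_one, NatOrd.no_one]
        exact NatOrd.one_le_no (below_ev hχ f) (hf.one_le hχ)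
    · rw [evv_of_lt χ (v := OVec.recursorAt l f) hi, NatOrd.no_zero]
      exact Nat.zero_le _

theorem OVec.regular_recursor {Γ : Ctx} (l : ℕ) :
    (OVec.recursor Γ l).Regular where
  inCf i hi := by
    rw [OVec.get_of_le hi]
    simp only [OVec.recursor]
    split_ifs
    · exact .add _ _ _ (.one i) (.one i)
    · exact .omega _ (by omega)
    · exact .one i
  norm χ hχ i := by
    have h2 : NatOrd.no (1 + 1) = 2 := by
      rw [NatOrd.no_add NatOrd.below_one NatOrd.below_one, NatOrd.no_one]
    rcases le_or_gt i (l + 2) with hi | hi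
    · rw [evv, evv, OVec.get_of_le (v := OVec.recursor Γ l) hi,
        OVec.get_of_le (v := OVec.recursor Γ l) (Nat.zero_le _)]
      simp only [OVec.recursor, if_true]
      split_ifs
      · exact le_rfl
      · rw [ev_omega, NatOrd.no_omega, ev_add, ev_one, h2]
      · rw [ev_add, ev_one, NatOrd.no_one, h2]
        norm_num
    · rw [evv_of_lt χ (v := OVec.recursor Γ l) hi, NatOrd.no_zero]
      exact Nat.zero_le _

theorem OVec.regular_one {Γ : Ctx} (l : ℕ) : (OVec.mk (Γ := Γ) l fun _ => .one).Regular where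
  inCf i hi := by
    rw [OVec.get_of_le hi]
    exact .one i
  norm χ hχ i := by
    rw [evv, evv, OVec.get_of_le (v := OVec.mk l _) (Nat.zero_le _)]
    rcases le_or_gt i l with hi | hi
    · rw [OVec.get_of_le (v := OVec.mk l _) hi]
    · rw [OVec.get_of_lt (v := OVec.mk l _) hi, ev_zero, NatOrd.no_zero]
      exact Nat.zero_le _

-- Regularity of assigned vectors and stability of derivations under renaming and substitution.

mutual
  theorem PD.IsDerivation.regular : {Γ : Ctx} → {σ : Ty} → {A : Tm Γ σ} → {d : PD A} →
      d.IsDerivation → d.vec.Regular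
    | _, _, _, .var x, _ => OVec.regular_var x
    | _, _, _, .zero, _ => OVec.regular_one 0
    | _, _, _, .succ, _ => OVec.regular_one 1
    | _, _, _, .D τ, _ => OVec.regular_one (τ.lv + 1)
    | _, _, _, .R τ, _ => OVec.regular_recursor τ.lv
    | _, τ, _, .app (σ := σ) d e, h => by
      rw [PD.IsDerivation] at h
      have h1 : e.vec.lv < d.vec.lv := by
        rw [d.lv_vec, e.lv_vec, Ty.lv]
        omega
      refine (h.1.regular.box h.2.regular h1).restrict ?_
      change τ.lv ≤ d.vec.lv
      rw [d.lv_vec, Ty.lv]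
      omega
    | _, _, _, .Rsup τ d, h => by
      rw [PD.IsDerivation] at h
      exact OVec.regular_recursorAt τ.lv (h.regular.inCf 0 (Nat.zero_le _))
    | _, _, _, .lam s, h => by
      rw [PD.IsDerivation] at h
      exact ((h.1.regular_firstVec.dop h.2.2).subst (OSub.adm_oneSub _ _)).add
        (h.1.regular_lastVec.subst (OSub.adm_oneSub _ _))
  theorem PDSeq.IsDerivationSeq.regular_firstVec : {Γ : Ctx} → {σ : Ty} → {G : Tm Γ σ} →
      {s : PDSeq G} → s.IsDerivationSeq → s.firstVec.Regular
    | _, _, _, .single d, h => by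
      rw [PDSeq.IsDerivationSeq] at h
      exact h.regular
    | _, _, _, .snoc s d, h => by
      rw [PDSeq.IsDerivationSeq] at h
      exact h.1.regular_firstVec
  theorem PDSeq.IsDerivationSeq.regular_lastVec : {Γ : Ctx} → {σ : Ty} → {G : Tm Γ σ} →
      {s : PDSeq G} → s.IsDerivationSeq → s.lastVec.Regular
    | _, _, _, .single d, h => by
      rw [PDSeq.IsDerivationSeq] at h
      exact h.regular
    | _, _, _, .snoc s d, h => by
      rw [PDSeq.IsDerivationSeq] at h
      exact h.2.1.regular
end

mutual
  theorem PD.IsDerivation.rename : {Γ Δ : Ctx} → {σ : Ty} → {A : Tm Γ σ} → {d : PD A} →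
      d.IsDerivation → (r : Ren Γ Δ) → (d.rename r).IsDerivation
    | _, _, _, _, .var _, _, _ => trivial
    | _, _, _, _, .zero, _, _ => trivial
    | _, _, _, _, .succ, _, _ => trivial
    | _, _, _, _, .D _, _, _ => trivial
    | _, _, _, _, .R _, _, _ => trivial
    | _, _, _, _, .app d e, h, r => by
      rw [PD.IsDerivation] at h
      exact ⟨h.1.rename r, h.2.rename r⟩
    | _, _, _, _, .Rsup _ d, h, r => by
      rw [PD.IsDerivation] at h
      exact PD.IsDerivation.rename (d := d) h r
    | _, _, _, _, .lam s, h, r => by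
      rw [PD.IsDerivation] at h
      refine ⟨h.1.rename _, fun ho => h.2.1 ?_, ?_⟩
      · rw [PDSeq.firstTm_rename] at ho
        exact ho.of_rename_lift
      · rw [PDSeq.firstVec_rename, ← OSub.lift_ofRen]
        exact h.2.2.subst_lift (OSub.adm_ofRen r)
  theorem PDSeq.IsDerivationSeq.rename : {Γ Δ : Ctx} → {σ : Ty} → {G : Tm Γ σ} →
      {s : PDSeq G} → s.IsDerivationSeq → (r : Ren Γ Δ) → (s.rename r).IsDerivationSeq
    | _, _, _, _, .single d, h, r => by
      rw [PDSeq.IsDerivationSeq] at h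
      exact PD.IsDerivation.rename (d := d) h r
    | _, _, _, _, .snoc s d, h, r => by
      rw [PDSeq.IsDerivationSeq] at h
      refine ⟨h.1.rename r, h.2.1.rename r, h.2.2.1.rename r, ?_⟩
      rw [PD.vec_rename, PDSeq.lastVec_rename]
      exact h.2.2.2.subst (OSub.adm_ofRen r)
end

/-- All trees for the terms of the substitution are assignment derivations. -/
def PDSub.IsDerivation {Γ Δ : Ctx} {s : Sub Γ Δ} (p : PDSub s) : Prop :=
  ∀ (σ : Ty) (x : Var Γ σ), (p σ x).IsDerivation

theorem PDSub.IsDerivation.lift {Γ Δ : Ctx} {s : Sub Γ Δ} {p : PDSub s} (h : p.IsDerivation)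
    (ρ : Ty) : (p.lift ρ).IsDerivation
  | _, .zero => trivial
  | _, .succ x => (h _ x).rename _

theorem PDSub.IsDerivation.adm {Γ Δ : Ctx} {s : Sub Γ Δ} {p : PDSub s} (h : p.IsDerivation) :
    Adm p.osub :=
  .mk' (fun σ x i => (h σ x).regular.inCf i
      (by rw [(p σ x).lv_vec]; exact Nat.le_of_lt_succ i.2))
    fun χ hχ σ x i => (h σ x).regular.norm χ hχ i

mutual
  -- The conditions at abstractions survive: reductions are stable under substitution, ≻ is stable
  -- because regular vectors have admissible instances, and membership in Cˣ is stable by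
  -- `OVec.IsC.subst_lift`.
  theorem PD.IsDerivation.subst : {Γ Δ : Ctx} → {σ : Ty} → {A : Tm Γ σ} → {s : Sub Γ Δ} →
      {p : PDSub s} → p.IsDerivation → {d : PD A} → d.IsDerivation → (d.subst p).IsDerivation
    | _, _, _, _, _, _, hp, .var x, _ => hp _ x
    | _, _, _, _, _, _, _, .zero, _ => trivial
    | _, _, _, _, _, _, _, .succ, _ => trivial
    | _, _, _, _, _, _, _, .D _, _ => trivial
    | _, _, _, _, _, _, _, .R _, _ => trivial
    | _, _, _, _, _, _, hp, .app d e, h => by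
      rw [PD.IsDerivation] at h
      exact ⟨h.1.subst hp, h.2.subst hp⟩
    | _, _, _, _, _, _, hp, .Rsup _ d, h => by
      rw [PD.IsDerivation] at h
      exact PD.IsDerivation.subst (d := d) hp h
    | _, _, _, _, _, _, hp, .lam s, h => by
      rw [PD.IsDerivation] at h
      refine ⟨h.1.subst (hp.lift _), fun ho => h.2.1 ?_, ?_⟩
      · rw [PDSeq.firstTm_subst] at ho
        exact ho.of_subst_lift
      · rw [PDSeq.firstVec_subst, PDSub.osub_lift]
        exact h.2.2.subst_lift hp.adm
  theorem PDSeq.IsDerivationSeq.subst : {Γ Δ : Ctx} → {σ : Ty} → {G : Tm Γ σ} →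
      {s : Sub Γ Δ} → {p : PDSub s} → p.IsDerivation → {q : PDSeq G} → q.IsDerivationSeq →
      (q.subst p).IsDerivationSeq
    | _, _, _, _, _, _, hp, .single d, h => by
      rw [PDSeq.IsDerivationSeq] at h
      exact PD.IsDerivation.subst (d := d) hp h
    | _, _, _, _, _, _, hp, .snoc q d, h => by
      rw [PDSeq.IsDerivationSeq] at h
      refine ⟨h.1.subst hp, h.2.1.subst hp, h.2.2.1.subst _, ?_⟩
      rw [PD.vec_subst, PDSeq.lastVec_subst]
      exact h.2.2.2.subst hp.adm
end

end GodelT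

namespace GodelT

open NatOrd (Below collapse below_natCast)

/-! # Reduction steps -/

section Values

variable {Γ : Ctx} {χ : OSub Γ []}

theorem PD.IsDerivation.good {σ : Ty} {A : Tm Γ σ} {d : PD A} (hd : d.IsDerivation)
    (hχ : Admissible χ) : Good σ.lv (evv χ d.vec) := by
  have := hd.regular.good hχ
  rwa [d.lv_vec] at this

theorem PD.evv_of_lv_lt {σ : Ty} {A : Tm Γ σ} (d : PD A) {i : ℕ} (hi : σ.lv < i) :
    evv χ d.vec i = 0 :=
  evv_of_lt χ (d.lv_vec.trans_lt hi)

theorem PD.vres_evv {σ : Ty} {A : Tm Γ σ} (d : PD A) : vres σ.lv (evv χ d.vec) = evv χ d.vec := by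
  funext i
  unfold vres
  split_ifs with h
  · rfl
  · exact (d.evv_of_lv_lt (not_le.1 h)).symm

theorem PD.evv_app {σ τ : Ty} {B : Tm Γ (.arr σ τ)} {C : Tm Γ σ} (d : PD B) (e : PD C) :
    evv χ (PD.app d e).vec = vres τ.lv (vbox (evv χ d.vec) (evv χ e.vec) σ.lv) := by
  have h : e.vec.lv < d.vec.lv := by
    rw [d.lv_vec, e.lv_vec, Ty.lv]
    omega
  change evv χ ((d.vec.box e.vec).restrict τ.lv) = _
  rw [evv_restrict, evv_box χ h, e.lv_vec]

theorem PD.evv_Rsup {τ : Ty} {t : Tm Γ .nat} (d : PD t) :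
    evv χ (PD.Rsup τ d).vec = recVec τ.lv (evv χ d.vec 0) := by
  funext i
  unfold recVec
  change evv χ (OVec.recursorAt τ.lv (d.vec.get 0)) i = _
  rcases le_or_gt i (τ.lv + 2) with hi | hi
  · rw [evv, OVec.get_of_le (v := OVec.recursorAt τ.lv _) hi]
    simp only [OVec.recursorAt]
    split_ifs
    · rfl
    · rfl
    · omega
  · rw [evv_of_lt χ (v := OVec.recursorAt τ.lv _) hi, if_neg (by omega), if_neg (by omega)]

theorem PD.vlt_app_left {σ τ : Ty} {B : Tm Γ (.arr σ τ)} {C : Tm Γ σ} {d : PD B} {e : PD C}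
    (hd : d.IsDerivation) (he : e.IsDerivation) (hχ : Admissible χ) :
    VLt (vres τ.lv (evv χ d.vec)) (evv χ (PD.app d e).vec) := by
  rw [PD.evv_app]
  exact (vlt_vbox_left (hd.good hχ) (he.good hχ) (by rw [Ty.lv]; omega)).vres _

theorem PD.vlt_app_right {σ τ : Ty} {B : Tm Γ (.arr σ τ)} {C : Tm Γ σ} {d : PD B} {e : PD C}
    (hd : d.IsDerivation) (he : e.IsDerivation) (hχ : Admissible χ) :
    VLt (vres τ.lv (evv χ e.vec)) (evv χ (PD.app d e).vec) := by
  rw [PD.evv_app]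
  exact (vlt_vbox_right (hd.good hχ) (he.good hχ) (by rw [Ty.lv]; omega)
    fun i hi => e.evv_of_lv_lt hi).vres _

end Values

theorem vres_vres {l m : ℕ} (h : l ≤ m) (f : ℕ → NatOrd) : vres l (vres m f) = vres l f := by
  funext i
  unfold vres
  split_ifs <;> first | rfl | omega

theorem PDSeq.lastVec_eq : {Γ : Ctx} → {σ : Ty} → {G : Tm Γ σ} → (s : PDSeq G) →
    s.lastVec = s.last.vec
  | _, _, _, .single _ => rfl
  | _, _, _, .snoc _ _ => rfl

theorem PDSeq.IsDerivationSeq.last : {Γ : Ctx} → {σ : Ty} → {G : Tm Γ σ} → {s : PDSeq G} →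
    s.IsDerivationSeq → s.last.IsDerivation
  | _, _, _, .single _, h => by
    rw [PDSeq.IsDerivationSeq] at h
    exact h
  | _, _, _, .snoc _ _, h => by
    rw [PDSeq.IsDerivationSeq] at h
    exact h.2.1

theorem PDSeq.IsDerivationSeq.lastVec_le : {Γ : Ctx} → {σ : Ty} → {G : Tm Γ σ} →
    {s : PDSeq G} → s.IsDerivationSeq → {χ : OSub Γ []} → Admissible χ → ∀ i,
    evv χ s.lastVec i ≤ evv χ s.firstVec i
  | _, _, _, .single _, _, _, _, _ => le_rfl
  | _, _, _, .snoc s _, h, χ, hχ, i => by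
    rw [PDSeq.IsDerivationSeq] at h
    refine le_trans ?_ (h.1.lastVec_le hχ i)
    have := OVec.lt_iff.1 h.2.2.2 χ hχ
    rcases Nat.eq_zero_or_pos i with rfl | hi
    · exact this.1.le
    · exact this.2 i hi

/-- The vector assigned to the reduct of a `β`-redex. -/
theorem PD.vlt_beta {Γ : Ctx} {σ τ : Ty} {G : Tm (σ :: Γ) τ} {H : Tm Γ σ} {s : PDSeq G}
    {e : PD H} (hs : (PD.lam s).IsDerivation)
    (hp : (PDSub.single e).IsDerivation) {χ : OSub Γ []} (hχ : Admissible χ) :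
    VLt (evv χ (s.last.inst e).vec) (evv χ (PD.app (PD.lam s) e).vec) := by
  rw [PD.IsDerivation] at hs
  -- Under χ' the variable vector of X takes the values of the vector of H, so the inequality for x
  -- itself can be read at H.
  set χ' := χ.comp (PDSub.single e).osub with hχ'_def
  have hχ' : Admissible χ' := hp.adm.comp χ hχ
  have hlast := hs.1.last
  have hone : Admissible (χ.comp (oneSub Γ σ)) := (OSub.adm_oneSub Γ σ).comp χ hχ
  have hv : evv χ (s.last.inst e).vec = evv χ' s.last.vec := by
    rw [hχ'_def, ← evv_subst, ← PD.vec_subst]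
    rfl
  have hx : evv χ' (OVec.var (Var.zero (Γ := Γ) (σ := σ))) = evv χ e.vec := by
    funext i
    rcases le_or_gt i σ.lv with hi | hi
    · rw [evv, OVec.get_of_le (v := OVec.var _) hi]
      rfl
    · rw [e.evv_of_lv_lt hi, evv_of_lt χ' (v := OVec.var _) hi]
  -- Being x-free, the δ-summand has the same value at x := [[H]] as after x := 1. The other summand
  -- is the last member at x := 1.
  have hlam : evv χ (PD.lam s).vec = fun j =>
      evv χ' (s.firstVec.dop Var.zero) j + evv (χ.comp (oneSub Γ σ)) s.last.vec j := by
    funext j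
    change evv χ (((s.firstVec.dop Var.zero).subst (oneSub Γ σ)).add
      (s.lastVec.subst (oneSub Γ σ))) j = _
    rw [evv_add, evv_subst, evv_subst, PDSeq.lastVec_eq]
    refine congrArg (· + _) (congrFun (hs.2.2.evv_dop_congr fun ρ y hy => ?_) j)
    cases y with
    | zero => exact absurd rfl hy
    | succ y =>
      funext i
      exact (congrArg (OT.subst χ)
        (OVec.get_of_le (v := OVec.var y) (Nat.le_of_lt_succ i.2))).symm
  have hmain := hs.1.regular_firstVec.vlt_vbox_dop hs.2.2 hχ' (hlast.good hone)
  rw [hx, ← hlam] at hmain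
  -- The decisive inequality concerns the first member of the sequence, and the last member is below
  -- it.
  have hle : VLt (evv χ' s.last.vec) (vbox (evv χ (PD.lam s).vec) (evv χ e.vec) σ.lv) := by
    have h := hs.1.lastVec_le hχ'
    rw [PDSeq.lastVec_eq] at h
    exact ⟨(h 0).trans_lt hmain.1, fun i hi => (h i).trans (hmain.2 i hi)⟩
  rw [hv, ← s.last.vres_evv, PD.evv_app]
  exact hle.vres _

theorem PDSub.isDerivation_single {Γ : Ctx} {ρ : Ty} {H : Tm Γ ρ} {e : PD H} (he : e.IsDerivation) :
    (PDSub.single e).IsDerivation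
  | _, .zero => he
  | _, .succ _ => trivial

section Recursor

variable {Γ : Ctx} {χ : OSub Γ []}

theorem Ty.lv_iter (τ : Ty) : (Ty.arr .nat (.arr τ τ)).lv = τ.lv + 1 := by
  simp only [Ty.lv]
  omega

theorem Ty.lv_endo (τ : Ty) : (Ty.arr τ τ).lv = τ.lv + 1 := by
  simp only [Ty.lv]
  omega

/-- Component 0 is dominated because □ dominates its right argument. In the top component ω exceeds
the finite value of t, and the other components of the reduct are 1. -/
theorem PD.vlt_R {τ : Ty} {t : Tm Γ .nat} {d : PD t} (hd : d.IsDerivation)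
    (hχ : Admissible χ) : VLt (evv χ (PD.Rsup τ d).vec) (evv χ (PD.app (PD.R τ) d).vec) := by
  have hR : (PD.R (Γ := Γ) τ).IsDerivation := trivial
  have hg := hd.good hχ
  have h1 := PD.vlt_app_left hR hd hχ
  have h2 := PD.vlt_app_right hR hd hχ
  rw [PD.evv_Rsup]
  refine ⟨h2.1, fun i hi => ?_⟩
  unfold recVec
  rcases le_or_gt i (τ.lv + 2) with hl | hl
  · refine le_trans ?_ (h1.2 i hi)
    have e : evv χ (PD.R (Γ := Γ) τ).vec i =
        if i = τ.lv + 2 then NatOrd.omega else 1 := by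
      change evv χ (OVec.recursor Γ τ.lv) i = _
      rw [evv, OVec.get_of_le (v := OVec.recursor Γ τ.lv) hl]
      simp only [OVec.recursor]
      rw [if_neg hi.ne']
      split_ifs <;> rfl
    have hl' : i ≤ (Ty.arr (.arr .nat (.arr τ τ)) (.arr τ τ)).lv := by
      simp only [Ty.lv]
      omega
    rw [vres, if_pos hl', e]
    by_cases h3 : i = τ.lv + 2
    · rw [if_pos (.inr h3), if_pos h3]
      obtain ⟨k, hk⟩ := hg.nat
      rw [hk]
      exact (NatOrd.natCast_lt_omega k).le
    · rw [if_neg (by omega), if_neg h3]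
      split_ifs
      · exact le_rfl
      · exact NatOrd.zero_le _
  · rw [if_neg (by omega), if_neg (by omega)]
    exact NatOrd.zero_le _

theorem PD.evv_Rsup_app {τ : Ty} {t : Tm Γ .nat} {A : Tm Γ (.arr .nat (.arr τ τ))} {B : Tm Γ τ}
    {d : PD t} {a : PD A} {b : PD B} {n : ℕ} (hd : evv χ d.vec 0 = n) :
    evv χ (PD.app (PD.app (PD.Rsup τ d) a) b).vec =
      recVec₂ τ.lv (evv χ a.vec) (evv χ b.vec) n := by
  rw [PD.evv_app, PD.evv_app, PD.evv_Rsup, Ty.lv_iter, Ty.lv_endo, hd]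
  rfl

theorem PD.vlt_RS {τ : Ty} {t : Tm Γ .nat} {A : Tm Γ (.arr .nat (.arr τ τ))} {B : Tm Γ τ}
    {d : PD t} {a : PD A} {b : PD B} (hd : d.IsDerivation) (ha : a.IsDerivation)
    (hb : b.IsDerivation) (hχ : Admissible χ) :
    VLt (evv χ (PD.app (PD.app a d) (PD.app (PD.app (PD.Rsup τ d) a) b)).vec)
      (evv χ (PD.app (PD.app (PD.Rsup τ (PD.app PD.succ d)) a) b).vec) := by
  have hS : (PD.succ (Γ := Γ)).IsDerivation := trivial
  have hSd : (PD.app PD.succ d).IsDerivation := ⟨hS, hd⟩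
  have hg := hd.good hχ
  have hgS := hSd.good hχ
  have hga := ha.good hχ
  rw [Ty.lv_iter] at hga
  -- The value of St is a collapse that exceeds the value of t by far more than the 2 required.
  have hs : (evv χ d.vec 0).no + 2 ≤ (evv χ (PD.app PD.succ d).vec 0).no := by
    have := lt_no_vbox_zero (hS.good hχ) hg (by simp only [Ty.lv]; omega)
    rw [PD.evv_app, vres, if_pos (Nat.zero_le _)]
    change _ + 2 ≤ (vbox _ _ Ty.nat.lv 0).no
    omega
  rw [PD.evv_Rsup_app (d := PD.app PD.succ d) (a := a) (b := b) hgS.no_zero_eq.symm,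
    PD.evv_app (PD.app a d), PD.evv_Rsup_app (d := d) (a := a) (b := b) hg.no_zero_eq.symm,
    PD.evv_app a d, Ty.lv_endo]
  exact vlt_recursor hga (hb.good hχ) hg hg.no_zero_eq.symm hs

end Recursor

/-- Both claims are proved together, since at an abstraction the appended tree must be a derivation
with a smaller vector. -/
theorem algorithm_spec {Γ : Ctx} {σ : Ty} {A B : Tm Γ σ} (r : Step A B) (d : PD A)
    (hd : d.IsDerivation) :
    (algorithm r d).IsDerivation ∧
      ∀ χ : OSub Γ [], Admissible χ → VLt (evv χ (algorithm r d).vec) (evv χ d.vec) := by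
  induction r with
  | @D0 Γ τ A B =>
    match d, hd with
    | .app (.app (.app (.D _) .zero) a) b, hd =>
      have h2 : (PD.app (PD.app (PD.D τ) PD.zero) a).IsDerivation := hd.1
      refine ⟨h2.2, fun χ hχ => ?_⟩
      -- The tree for A is the right argument of the inner application, which is the left argument
      -- of the outer one; the two truncations compose.
      have h1 := ((PD.vlt_app_right h2.1 h2.2 hχ).vres τ.lv).trans
        (PD.vlt_app_left hd.1 hd.2 hχ)
      rwa [vres_vres (by rw [Ty.lv_endo]; omega), PD.vres_evv] at h1
  | @DS Γ τ t A B =>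
    match d, hd with
    | .app (.app (.app (.D _) (.app .succ _)) _) b, hd =>
      refine ⟨hd.2, fun χ hχ => ?_⟩
      have h1 := PD.vlt_app_right hd.1 hd.2 hχ
      rwa [PD.vres_evv] at h1
  | @R Γ τ t =>
    match d, hd with
    | .app (.R _) t, hd => exact ⟨hd.2, fun χ hχ => PD.vlt_R hd.2 hχ⟩
  | @R0 Γ τ A B =>
    match d, hd with
    | .app (.app (.Rsup _ .zero) _) b, hd =>
      refine ⟨hd.2, fun χ hχ => ?_⟩
      have h1 := PD.vlt_app_right hd.1 hd.2 hχ
      rwa [PD.vres_evv] at h1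
  | @RS Γ τ t A B =>
    match d, hd with
    | .app (.app (.Rsup _ (.app .succ t)) a) b, hd =>
      have ha : a.IsDerivation := hd.1.2
      have ht : t.IsDerivation := hd.1.1.2
      exact ⟨⟨⟨ha, ht⟩, ⟨ht, ha⟩, hd.2⟩, fun χ hχ => PD.vlt_RS ht ha hd.2 hχ⟩
  | beta G H =>
    match d, hd with
    | .app (.lam s) h, hd =>
      have h1 : (PD.lam s).IsDerivation ∧ h.IsDerivation := hd
      have hp := PDSub.isDerivation_single h1.2
      refine ⟨?_, fun χ hχ => PD.vlt_beta h1.1 hp hχ⟩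
      have := h1.1
      rw [PD.IsDerivation] at this
      exact this.1.last.subst hp
  | appr C r ih =>
    match d, hd with
    | .app a c, hd =>
      have h1 : a.IsDerivation ∧ c.IsDerivation := hd
      obtain ⟨h2, h3⟩ := ih a h1.1
      refine ⟨⟨h2, h1.2⟩, fun χ hχ => ?_⟩
      change VLt (evv χ (PD.app (algorithm r a) c).vec) _
      rw [PD.evv_app, PD.evv_app]
      exact (vbox_lt_vbox_left (h1.1.good hχ) (h2.good hχ) (h1.2.good hχ) (h3 χ hχ)).vres _
  | appl A r ih =>
    match d, hd with
    | .app a b, hd =>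
      have h1 : a.IsDerivation ∧ b.IsDerivation := hd
      obtain ⟨h2, h3⟩ := ih b h1.2
      refine ⟨⟨h1.1, h2⟩, fun χ hχ => ?_⟩
      change VLt (evv χ (PD.app a (algorithm r b)).vec) _
      rw [PD.evv_app, PD.evv_app]
      exact (vbox_lt_vbox_right (h1.1.good hχ) (h1.2.good hχ) (h2.good hχ) (h3 χ hχ)).vres _
  | appR τ r ih =>
    match d, hd with
    | .Rsup _ s, hd =>
      have h1 : s.IsDerivation := hd
      obtain ⟨h2, h3⟩ := ih s h1
      refine ⟨h2, fun χ hχ => ?_⟩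
      change VLt (evv χ (PD.Rsup τ (algorithm r s)).vec) _
      rw [PD.evv_Rsup, PD.evv_Rsup]
      exact recVec_lt _ (h3 χ hχ).1
  | xi r ih =>
    match d, hd with
    | .lam s, hd =>
      rw [PD.IsDerivation] at hd
      obtain ⟨h2, h3⟩ := ih s.last hd.1.last
      have hlt : (algorithm r s.last).vec.Lt s.lastVec := by
        rw [PDSeq.lastVec_eq, OVec.lt_iff]
        exact h3
      refine ⟨⟨⟨hd.1, h2, ⟨r⟩, hlt⟩, hd.2⟩, fun χ hχ => ?_⟩
      -- The δ-summand depends on the first member only and is common to both sides. Only the last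
      -- member decreases, and this persists at x := 1.
      have h4 := OVec.lt_iff.1 (hlt.subst (OSub.adm_oneSub _ _)) χ hχ
      change VLt (evv χ (((s.firstVec.dop Var.zero).subst (oneSub _ _)).add
          ((algorithm r s.last).vec.subst (oneSub _ _))))
        (evv χ (((s.firstVec.dop Var.zero).subst (oneSub _ _)).add
          (s.lastVec.subst (oneSub _ _))))
      refine ⟨?_, fun i hi => ?_⟩
      · rw [evv_add, evv_add]
        exact add_lt_add_of_le_of_lt le_rfl h4.1
      · rw [evv_add, evv_add]
        exact add_le_add le_rfl (h4.2 i hi)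

end GodelT

theorem theorem3p4 {Γ : GodelT.Ctx} {σ : GodelT.Ty} {A B : GodelT.Tm Γ σ}
    (r : GodelT.Step A B) (d : GodelT.PD A) (hd : d.IsDerivation) :
    (GodelT.algorithm r d).IsDerivation ∧ (GodelT.algorithm r d).vec.Lt d.vec := by
  obtain ⟨h1, h2⟩ := GodelT.algorithm_spec r d hd
  exact ⟨h1, GodelT.OVec.lt_iff.2 h2⟩
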